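/- **Corollary (Optimizing an arbitrary $k$-local Hamiltonian).** Let $n,k\ge 1$ and let $$H=\sum_{P\in\{I,X,Y,Z\}^{\otimes n},\ |P|\le k}\alpha_P P,\qquad \alpha_P\in\mathbb{R},$$ be an $n$-qubit $k$-local Hamiltonian, where $|P|$ is the number of qubits on which the Pauli string $P$ acts nontrivially. There is a randomized algorithm which, given $n$, $k$ and the list of terms $(P,\alpha_P)$ of $H$, runs in time $\mathcal{O}(n^k)$ for every fixed $k$ and produces a random product state $|\psi\rangle=|\psi_1\rangle\otimes\cdots\otimes|\psi_n\rangle$ of single-qubit pure states with $$\Big|\mathbb{E}_{|\psi\rangle}\big[\langle\psi|H|\psi\rangle\big]-\mathbb{E}_{|\phi\rangle:\,\mathrm{Haar}}\big[\langle\phi|H|\phi\rangle\big]\Big|\ \ge\ C(k)\Big(\sum_{P\ne I}|\alpha_P|^{2k/(k+1)}\Big)^{(k+1)/(2k)},$$ where $$C(k)=\frac{\sqrt{2\,(k!)}}{2\,k^{\,k+\frac32+\frac{k+1}{2k}}\,(\sqrt6+2\sqrt3)^k}$$ and $|\phi\rangle$ is a Haar-random $n$-qubit pure state. Here one algorithm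 serves all $k$, $n$ and $H$, and for each $k$ there is a constant $A_k$, depending on $k$ only, such that for all $n$ and $H$ the algorithm makes at most $A_k n^k$ steps, whatever its random choices. The model of computation is the unit-cost real RAM: integer and exact real memory cells with indirect addressing, the operations $+,-,\times$ on integers and $+,-,\times,/,\sqrt{\ }$ on reals, comparisons, and independent uniform samples from $[0,1]$. -/

import Mathlib

open MeasureTheory

/-! ## Qubits, Pauli strings and local Hamiltonians -/

/-- Label of a computational basis state of `n` qubits. -/
abbrev Bits (n : ℕ) : Type := Fin n → Fin 2

/-- A Pauli string on `n` qubits; the letters `0, 1, 2, 3` stand for `I, X, Y, Z`.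
The zero string is the identity string. -/
abbrev PauliString (n : ℕ) : Type := Fin n → Fin 4

/-- The four single-qubit Pauli matrices `I, X, Y, Z`. -/
def pauli : Fin 4 → Matrix (Fin 2) (Fin 2) ℂ :=
  ![!![1, 0; 0, 1], !![0, 1; 1, 0], !![0, -Complex.I; Complex.I, 0], !![1, 0; 0, -1]]

/-- The tensor product `P 0 ⊗ ⋯ ⊗ P (n - 1)` in the computational basis. -/
def pauliMatrix {n : ℕ} (P : PauliString n) : Matrix (Bits n) (Bits n) ℂ :=
  fun a b => ∏ i, pauli (P i) (a i) (b i)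

/-- The qubits on which a Pauli string acts nontrivially. -/
def pauliSupport {n : ℕ} (P : PauliString n) : Finset (Fin n) :=
  Finset.univ.filter fun i => P i ≠ 0

/-- The weight `|P|`. -/
def pauliWeight {n : ℕ} (P : PauliString n) : ℕ := (pauliSupport P).card

/-- The Hermitian operator `H = ∑ P, α P • P` with (real) Pauli coefficients `α`. -/
noncomputable def hamiltonian {n : ℕ} (α : PauliString n → ℝ) : Matrix (Bits n) (Bits n) ℂ :=
  ∑ P, (α P : ℂ) • pauliMatrix P

/-- `H = ∑ P, α P • P` is `k`-local: only strings of weight at most `k` occur. -/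
def IsKLocal {n : ℕ} (k : ℕ) (α : PauliString n → ℝ) : Prop :=
  ∀ P, k < pauliWeight P → α P = 0

/-- The energy `⟨ψ|H|ψ⟩`, which is real for Hermitian `H`. -/
noncomputable def energy {n : ℕ} (H : Matrix (Bits n) (Bits n) ℂ) (ψ : Bits n → ℂ) : ℝ :=
  (star ψ ⬝ᵥ H.mulVec ψ).re

/-- The product vector `φ 0 ⊗ ⋯ ⊗ φ (n - 1)`. -/
def productState {n : ℕ} (φ : Fin n → Fin 2 → ℂ) : Bits n → ℂ :=
  fun b => ∏ i, φ i (b i)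

/-- The `n`-qubit Hilbert space. -/
abbrev QubitSpace (n : ℕ) : Type := EuclideanSpace ℂ (Bits n)

/-- The law of a Haar-random pure state: the normalised surface measure on the unit sphere. -/
noncomputable def haarState (n : ℕ) : Measure (Metric.sphere (0 : QubitSpace n) 1) :=
  ((Measure.addHaar : Measure (QubitSpace n)).toSphere Set.univ)⁻¹ •
    (Measure.addHaar : Measure (QubitSpace n)).toSphere

/-- `𝔼 ⟨φ|H|φ⟩` for a Haar-random state `φ`. -/
noncomputable def haarEnergy {n : ℕ} (H : Matrix (Bits n) (Bits n) ℂ) : ℝ :=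
  ∫ φ, energy H (fun b => (φ : QubitSpace n) b) ∂(haarState n)

/-- `C(k) = √(2 k!) / (2 k^(k + 3/2 + (k+1)/(2k)) (√6 + 2√3)^k)`. -/
noncomputable def optConst (k : ℕ) : ℝ :=
  √(2 * (k.factorial : ℝ)) /
    (2 * (k : ℝ) ^ ((k : ℝ) + 3 / 2 + ((k : ℝ) + 1) / (2 * (k : ℝ))) *
      (√6 + 2 * √3) ^ k)

/-! ## A randomized real RAM

Structured programs over integer and real registers and finitely many integer and real arrays,
with indirect addressing.  Every operation and every memory access costs one unit.  Reals are
exact and allow `+, -, *, /, √` and comparisons, but there is no rounding of reals to integers,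
no integer division and no bitwise operation. -/

namespace RealRAM

/-- The source of randomness: a sequence of numbers in `[0, 1]`. -/
abbrev Tape : Type := ℕ → unitInterval

/-- The entries of the tape are independent and uniform on `[0, 1]`. -/
noncomputable def tapeLaw : Measure Tape :=
  Measure.infinitePi fun _ => (volume : Measure unitInterval)

/-- Memory: registers, arrays (array name, then index), and the number of samples drawn. -/
structure State where
  nreg : ℕ → ℕ
  narr : ℕ → ℕ → ℕ
  rreg : ℕ → ℝ
  rarr : ℕ → ℕ → ℝ
  drawn : ℕ

/-- Integer expressions. -/
inductive NExp : Type
  | const (c : ℕ)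
  | reg (r : ℕ)
  | arr (a : ℕ) (i : NExp)
  | add (x y : NExp)
  | sub (x y : NExp)
  | mul (x y : NExp)

/-- Value of an integer expression (subtraction is truncated at `0`). -/
def NExp.eval (s : State) : NExp → ℕ
  | .const c => c
  | .reg r => s.nreg r
  | .arr a i => s.narr a (i.eval s)
  | .add x y => x.eval s + y.eval s
  | .sub x y => x.eval s - y.eval s
  | .mul x y => x.eval s * y.eval s

/-- Number of operations in an integer expression. -/
def NExp.cost : NExp → ℕ
  | .const _ => 1
  | .reg _ => 1
  | .arr _ i => i.cost + 1
  | .add x y => x.cost + y.cost + 1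
  | .sub x y => x.cost + y.cost + 1
  | .mul x y => x.cost + y.cost + 1

/-- Real expressions. -/
inductive RExp : Type
  | ofNat (x : NExp)
  | reg (r : ℕ)
  | arr (a : ℕ) (i : NExp)
  | add (x y : RExp)
  | sub (x y : RExp)
  | mul (x y : RExp)
  | div (x y : RExp)
  | sqrt (x : RExp)

/-- Value of a real expression. The machine returns `0` for a quotient by `0` and for the
square root of a negative number. -/
noncomputable def RExp.eval (s : State) : RExp → ℝ
  | .ofNat x => (x.eval s : ℝ)
  | .reg r => s.rreg r
  | .arr a i => s.rarr a (i.eval s)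
  | .add x y => x.eval s + y.eval s
  | .sub x y => x.eval s - y.eval s
  | .mul x y => x.eval s * y.eval s
  | .div x y => x.eval s / y.eval s
  | .sqrt x => √(x.eval s)

/-- Number of operations in a real expression. -/
def RExp.cost : RExp → ℕ
  | .ofNat x => x.cost + 1
  | .reg _ => 1
  | .arr _ i => i.cost + 1
  | .add x y => x.cost + y.cost + 1
  | .sub x y => x.cost + y.cost + 1
  | .mul x y => x.cost + y.cost + 1
  | .div x y => x.cost + y.cost + 1
  | .sqrt x => x.cost + 1

/-- Tests. -/
inductive Test : Type
  | nlt (x y : NExp)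
  | neq (x y : NExp)
  | rlt (x y : RExp)
  | not (b : Test)
  | and (b c : Test)

/-- Truth of a test. -/
def Test.Holds (s : State) : Test → Prop
  | .nlt x y => x.eval s < y.eval s
  | .neq x y => x.eval s = y.eval s
  | .rlt x y => x.eval s < y.eval s
  | .not b => ¬ b.Holds s
  | .and b c => b.Holds s ∧ c.Holds s

/-- Number of operations in a test. -/
def Test.cost : Test → ℕ
  | .nlt x y => x.cost + y.cost + 1
  | .neq x y => x.cost + y.cost + 1
  | .rlt x y => x.cost + y.cost + 1
  | .not b => b.cost + 1
  | .and b c => b.cost + c.cost + 1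

/-- Programs. -/
inductive Prog : Type
  | nop
  | setN (r : ℕ) (e : NExp)
  | storeN (a : ℕ) (i : NExp) (e : NExp)
  | setR (r : ℕ) (e : RExp)
  | storeR (a : ℕ) (i : NExp) (e : RExp)
  | sample (r : ℕ)
  | seq (p q : Prog)
  | ite (b : Test) (p q : Prog)
  | loop (b : Test) (p : Prog)

/-- Update of one array cell. -/
def updCell {β : Type} (m : ℕ → ℕ → β) (a i : ℕ) (v : β) : ℕ → ℕ → β :=
  Function.update m a (Function.update (m a) i v)

/-- `Exec ω p s s' t`: on the tape `ω`, the program `p` started in state `s` halts in state `s'`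
after `t` steps.  The program `loop b p` repeats `p` while `b` holds. -/
inductive Exec (ω : Tape) : Prog → State → State → ℕ → Prop
  | nop (s : State) : Exec ω .nop s s 1
  | setN (r : ℕ) (e : NExp) (s : State) :
      Exec ω (.setN r e) s { s with nreg := Function.update s.nreg r (e.eval s) } (e.cost + 1)
  | storeN (a : ℕ) (i e : NExp) (s : State) :
      Exec ω (.storeN a i e) s { s with narr := updCell s.narr a (i.eval s) (e.eval s) }
        (i.cost + e.cost + 1)
  | setR (r : ℕ) (e : RExp) (s : State) :
      Exec ω (.setR r e) s { s with rreg := Function.update s.rreg r (e.eval s) } (e.cost + 1)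
  | storeR (a : ℕ) (i : NExp) (e : RExp) (s : State) :
      Exec ω (.storeR a i e) s { s with rarr := updCell s.rarr a (i.eval s) (e.eval s) }
        (i.cost + e.cost + 1)
  | sample (r : ℕ) (s : State) :
      Exec ω (.sample r) s
        { s with rreg := Function.update s.rreg r (ω s.drawn : ℝ), drawn := s.drawn + 1 } 1
  | seq {p q : Prog} {s₁ s₂ s₃ : State} {t u : ℕ} :
      Exec ω p s₁ s₂ t → Exec ω q s₂ s₃ u → Exec ω (.seq p q) s₁ s₃ (t + u)
  | iteTrue {b : Test} {p q : Prog} {s s' : State} {t : ℕ} :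
      b.Holds s → Exec ω p s s' t → Exec ω (.ite b p q) s s' (b.cost + t)
  | iteFalse {b : Test} {p q : Prog} {s s' : State} {t : ℕ} :
      ¬ b.Holds s → Exec ω q s s' t → Exec ω (.ite b p q) s s' (b.cost + t)
  | loopDone {b : Test} {p : Prog} {s : State} :
      ¬ b.Holds s → Exec ω (.loop b p) s s b.cost
  | loopStep {b : Test} {p : Prog} {s₁ s₂ s₃ : State} {t u : ℕ} :
      b.Holds s₁ → Exec ω p s₁ s₂ t → Exec ω (.loop b p) s₂ s₃ u →
      Exec ω (.loop b p) s₁ s₃ (b.cost + t + u)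

/-- Execution is deterministic once the tape is fixed. -/
theorem Exec.unique {ω : Tape} {p : Prog} {s s₁ s₂ : State} {t₁ t₂ : ℕ}
    (h₁ : Exec ω p s s₁ t₁) (h₂ : Exec ω p s s₂ t₂) : s₁ = s₂ ∧ t₁ = t₂ := by
  induction h₁ generalizing s₂ t₂ with
  | nop s => cases h₂; exact ⟨rfl, rfl⟩
  | setN r e s => cases h₂; exact ⟨rfl, rfl⟩
  | storeN a i e s => cases h₂; exact ⟨rfl, rfl⟩
  | setR r e s => cases h₂; exact ⟨rfl, rfl⟩
  | storeR a i e s => cases h₂; exact ⟨rfl, rfl⟩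
  | sample r s => cases h₂; exact ⟨rfl, rfl⟩
  | seq _ _ ih ih' =>
    cases h₂ with
    | seq a b =>
      obtain ⟨rfl, rfl⟩ := ih a
      obtain ⟨rfl, rfl⟩ := ih' b
      exact ⟨rfl, rfl⟩
  | iteTrue hb _ ih =>
    cases h₂ with
    | iteTrue _ a => obtain ⟨rfl, rfl⟩ := ih a; exact ⟨rfl, rfl⟩
    | iteFalse hn _ => exact absurd hb hn
  | iteFalse hb _ ih =>
    cases h₂ with
    | iteTrue hn _ => exact absurd hn hb
    | iteFalse _ a => obtain ⟨rfl, rfl⟩ := ih a; exact ⟨rfl, rfl⟩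
  | loopDone hb =>
    cases h₂ with
    | loopDone _ => exact ⟨rfl, rfl⟩
    | loopStep hn _ _ => exact absurd hn hb
  | loopStep hb _ _ ih ih' =>
    cases h₂ with
    | loopDone hn => exact absurd hb hn
    | loopStep _ a b =>
      obtain ⟨rfl, rfl⟩ := ih a
      obtain ⟨rfl, rfl⟩ := ih' b
      exact ⟨rfl, rfl⟩

/-! ### Input and output conventions -/

/-- `terms` lists the Pauli strings of a `k`-local Hamiltonian with coefficients `α`: in any
order, without repetition, only strings of weight at most `k`, and at least those that have a
nonzero coefficient. -/
def IsTermList {n : ℕ} (k : ℕ) (α : PauliString n → ℝ) (terms : List (PauliString n)) : Prop :=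
  terms.Nodup ∧ (∀ P ∈ terms, pauliWeight P ≤ k) ∧ ∀ P, α P ≠ 0 → P ∈ terms

/-- The `l`-th qubit, in increasing order, of the support of `P`, if there is one. -/
def slot {n : ℕ} (P : PauliString n) (l : ℕ) : Option (Fin n) := ((pauliSupport P).sort)[l]?

/-- The initial memory.  Integer registers `0, 1, 2` hold `n`, `k` and the number of terms.
The `j`-th term `P` (`j = 0, 1, …`) occupies the cells `j * k + l`, `l < k`, of the integer
arrays `0` and `1`: if `i` is the `l`-th qubit of the support of `P`, they hold `i` and the letter
`P i ∈ {1, 2, 3}`; the remaining cells are `0`.  Cell `j` of the real array `0` holds the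
coefficient of the `j`-th term.  All other cells are `0`. -/
def input {n : ℕ} (k : ℕ) (α : PauliString n → ℝ) (terms : List (PauliString n)) : State where
  nreg := fun r => if r = 0 then n else if r = 1 then k else if r = 2 then terms.length else 0
  narr := fun a q =>
    match terms[q / k]? with
    | none => 0
    | some P =>
      match slot P (q % k) with
      | none => 0
      | some i => if a = 0 then (i : ℕ) else if a = 1 then (P i : ℕ) else 0
  rreg := fun _ => 0
  rarr := fun a j =>
    if a = 0 then
      match terms[j]? with
      | none => 0
      | some P => α P
    else 0
  drawn := 0

/-- The output: the amplitude of basis state `b` of qubit `i` is the complex number whose real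
and imaginary parts stand in the cells `4 i + 2 b` and `4 i + 2 b + 1` of the real array `1`. -/
def output (n : ℕ) (s : State) : Fin n → Fin 2 → ℂ :=
  fun i b => ⟨s.rarr 1 (4 * i + 2 * b), s.rarr 1 (4 * i + 2 * b + 1)⟩

end RealRAM

/-! ## A program logic for the real RAM -/

namespace RealRAM

/-- Does the program write the integer register `r`? -/
def Prog.wN (r : ℕ) : Prog → Bool
  | .setN r' _ => r' == r
  | .seq p q => p.wN r || q.wN r
  | .ite _ p q => p.wN r || q.wN r
  | .loop _ p => p.wN r
  | _ => false

/-- Does the program write the integer array `a`? -/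
def Prog.wNA (a : ℕ) : Prog → Bool
  | .storeN a' _ _ => a' == a
  | .seq p q => p.wNA a || q.wNA a
  | .ite _ p q => p.wNA a || q.wNA a
  | .loop _ p => p.wNA a
  | _ => false

/-- Does the program write the real register `r`? -/
def Prog.wR (r : ℕ) : Prog → Bool
  | .setR r' _ => r' == r
  | .sample r' => r' == r
  | .seq p q => p.wR r || q.wR r
  | .ite _ p q => p.wR r || q.wR r
  | .loop _ p => p.wR r
  | _ => false

/-- Does the program write the real array `a`? -/
def Prog.wRA (a : ℕ) : Prog → Bool
  | .storeR a' _ _ => a' == a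
  | .seq p q => p.wRA a || q.wRA a
  | .ite _ p q => p.wRA a || q.wRA a
  | .loop _ p => p.wRA a
  | _ => false

/-- Does the program draw samples? -/
def Prog.draws : Prog → Bool
  | .sample _ => true
  | .seq p q => p.draws || q.draws
  | .ite _ p q => p.draws || q.draws
  | .loop _ p => p.draws
  | _ => false

/-- `s'` agrees with `s` on everything that `p` does not write. -/
structure Agree (p : Prog) (s s' : State) : Prop where
  n : ∀ r, p.wN r = false → s'.nreg r = s.nreg r
  na : ∀ a, p.wNA a = false → s'.narr a = s.narr a
  r : ∀ r, p.wR r = false → s'.rreg r = s.rreg r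
  ra : ∀ a, p.wRA a = false → s'.rarr a = s.rarr a
  d : p.draws = false → s'.drawn = s.drawn

theorem Agree.refl (p : Prog) (s : State) : Agree p s s :=
  ⟨fun _ _ => rfl, fun _ _ => rfl, fun _ _ => rfl, fun _ _ => rfl, fun _ => rfl⟩

theorem Agree.trans {p : Prog} {s₁ s₂ s₃ : State} (h : Agree p s₁ s₂) (h' : Agree p s₂ s₃) :
    Agree p s₁ s₃ :=
  ⟨fun x hx => (h'.n x hx).trans (h.n x hx), fun x hx => (h'.na x hx).trans (h.na x hx),
    fun x hx => (h'.r x hx).trans (h.r x hx), fun x hx => (h'.ra x hx).trans (h.ra x hx),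
    fun hx => (h'.d hx).trans (h.d hx)⟩

theorem Agree.mono {p q : Prog} {s s' : State} (h : Agree p s s')
    (hn : ∀ r, q.wN r = false → p.wN r = false) (hna : ∀ r, q.wNA r = false → p.wNA r = false)
    (hr : ∀ r, q.wR r = false → p.wR r = false) (hra : ∀ r, q.wRA r = false → p.wRA r = false)
    (hd : q.draws = false → p.draws = false) : Agree q s s' :=
  ⟨fun x hx => h.n x (hn x hx), fun x hx => h.na x (hna x hx), fun x hx => h.r x (hr x hx),
    fun x hx => h.ra x (hra x hx), fun hx => h.d (hd hx)⟩

theorem Agree.seq_left {p q : Prog} {s s' : State} (h : Agree p s s') : Agree (.seq p q) s s' :=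
  h.mono (by simp +contextual [Prog.wN]) (by simp +contextual [Prog.wNA])
    (by simp +contextual [Prog.wR]) (by simp +contextual [Prog.wRA])
    (by simp +contextual [Prog.draws])

theorem Agree.seq_right {p q : Prog} {s s' : State} (h : Agree q s s') : Agree (.seq p q) s s' :=
  h.mono (by simp +contextual [Prog.wN]) (by simp +contextual [Prog.wNA])
    (by simp +contextual [Prog.wR]) (by simp +contextual [Prog.wRA])
    (by simp +contextual [Prog.draws])

theorem Agree.ite_left {b : Test} {p q : Prog} {s s' : State} (h : Agree p s s') :
    Agree (.ite b p q) s s' :=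
  h.mono (by simp +contextual [Prog.wN]) (by simp +contextual [Prog.wNA])
    (by simp +contextual [Prog.wR]) (by simp +contextual [Prog.wRA])
    (by simp +contextual [Prog.draws])

theorem Agree.ite_right {b : Test} {p q : Prog} {s s' : State} (h : Agree q s s') :
    Agree (.ite b p q) s s' :=
  h.mono (by simp +contextual [Prog.wN]) (by simp +contextual [Prog.wNA])
    (by simp +contextual [Prog.wR]) (by simp +contextual [Prog.wRA])
    (by simp +contextual [Prog.draws])

theorem Agree.loop {b : Test} {p : Prog} {s s' : State} (h : Agree p s s') :
    Agree (.loop b p) s s' :=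
  h.mono (fun _ h => h) (fun _ h => h) (fun _ h => h) (fun _ h => h) (fun h => h)

theorem Exec.agree {ω : Tape} {p : Prog} {s s' : State} {t : ℕ} (h : Exec ω p s s' t) :
    Agree p s s' := by
  induction h with
  | nop s => exact .refl _ _
  | setN r e s =>
    refine ⟨fun x hx => ?_, fun _ _ => rfl, fun _ _ => rfl, fun _ _ => rfl, fun _ => rfl⟩
    have hx : r ≠ x := by simpa [Prog.wN] using hx
    exact Function.update_of_ne hx.symm _ _
  | storeN r i e s =>
    refine ⟨fun _ _ => rfl, fun x hx => ?_, fun _ _ => rfl, fun _ _ => rfl, fun _ => rfl⟩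
    have hx : r ≠ x := by simpa [Prog.wNA] using hx
    exact Function.update_of_ne hx.symm _ _
  | setR r e s =>
    refine ⟨fun _ _ => rfl, fun _ _ => rfl, fun x hx => ?_, fun _ _ => rfl, fun _ => rfl⟩
    have hx : r ≠ x := by simpa [Prog.wR] using hx
    exact Function.update_of_ne hx.symm _ _
  | storeR r i e s =>
    refine ⟨fun _ _ => rfl, fun _ _ => rfl, fun _ _ => rfl, fun x hx => ?_, fun _ => rfl⟩
    have hx : r ≠ x := by simpa [Prog.wRA] using hx
    exact Function.update_of_ne hx.symm _ _
  | sample r s =>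
    refine ⟨fun _ _ => rfl, fun _ _ => rfl, fun x hx => ?_, fun _ _ => rfl, fun h => ?_⟩
    · have hx : r ≠ x := by simpa [Prog.wR] using hx
      exact Function.update_of_ne hx.symm _ _
    · simp [Prog.draws] at h
  | seq _ _ ih ih' => exact ih.seq_left.trans ih'.seq_right
  | iteTrue _ _ ih => exact ih.ite_left
  | iteFalse _ _ ih => exact ih.ite_right
  | loopDone _ => exact .refl _ _
  | loopStep _ _ _ ih ih' => exact ih.loop.trans ih'

/-- A program that draws no samples runs in the same way on every tape. -/
theorem Exec.change_tape {ω : Tape} {p : Prog} {s s' : State} {t : ℕ} (h : Exec ω p s s' t)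
    (hp : p.draws = false) (ω' : Tape) : Exec ω' p s s' t := by
  induction h with
  | nop s => exact .nop s
  | setN r e s => exact .setN r e s
  | storeN r i e s => exact .storeN r i e s
  | setR r e s => exact .setR r e s
  | storeR r i e s => exact .storeR r i e s
  | sample r s => simp [Prog.draws] at hp
  | seq _ _ ih ih' =>
    simp only [Prog.draws, Bool.or_eq_false_iff] at hp
    exact .seq (ih hp.1) (ih' hp.2)
  | iteTrue hb _ ih =>
    simp only [Prog.draws, Bool.or_eq_false_iff] at hp
    exact .iteTrue hb (ih hp.1)
  | iteFalse hb _ ih =>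
    simp only [Prog.draws, Bool.or_eq_false_iff] at hp
    exact .iteFalse hb (ih hp.2)
  | loopDone hb => exact .loopDone hb
  | loopStep hb _ _ ih ih' => exact .loopStep hb (ih hp) (ih' hp)

/-- Started in `s`, the program `p` halts after at most `c` steps in a state that satisfies `Q`. -/
def Good (ω : Tape) (p : Prog) (s : State) (c : ℕ) (Q : State → Prop) : Prop :=
  ∃ s' t, Exec ω p s s' t ∧ t ≤ c ∧ Q s'

variable {ω : Tape}

theorem Good.mono {p : Prog} {s : State} {c c' : ℕ} {Q Q' : State → Prop} (h : Good ω p s c Q)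
    (hc : c ≤ c') (hQ : ∀ s', Agree p s s' → Q s' → Q' s') : Good ω p s c' Q' := by
  obtain ⟨s', t, he, ht, hq⟩ := h
  exact ⟨s', t, he, ht.trans hc, hQ s' he.agree hq⟩

theorem Good.seq {p q : Prog} {s : State} {c₁ c₂ : ℕ} {Q₁ Q : State → Prop}
    (h₁ : Good ω p s c₁ Q₁) (h₂ : ∀ s₁, Agree p s s₁ → Q₁ s₁ → Good ω q s₁ c₂ Q) :
    Good ω (.seq p q) s (c₁ + c₂) Q := by
  obtain ⟨s₁, t₁, he₁, ht₁, hq₁⟩ := h₁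
  obtain ⟨s₂, t₂, he₂, ht₂, hq₂⟩ := h₂ s₁ he₁.agree hq₁
  exact ⟨s₂, _, he₁.seq he₂, Nat.add_le_add ht₁ ht₂, hq₂⟩

theorem Good.nop {s : State} {Q : State → Prop} (h : Q s) : Good ω .nop s 1 Q :=
  ⟨s, _, .nop s, le_rfl, h⟩

theorem Good.setN {r : ℕ} {e : NExp} {s : State} {Q : State → Prop}
    (h : Q { s with nreg := Function.update s.nreg r (e.eval s) }) :
    Good ω (.setN r e) s (e.cost + 1) Q :=
  ⟨_, _, .setN r e s, le_rfl, h⟩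

theorem Good.storeN {a : ℕ} {i e : NExp} {s : State} {Q : State → Prop}
    (h : Q { s with narr := updCell s.narr a (i.eval s) (e.eval s) }) :
    Good ω (.storeN a i e) s (i.cost + e.cost + 1) Q :=
  ⟨_, _, .storeN a i e s, le_rfl, h⟩

theorem Good.setR {r : ℕ} {e : RExp} {s : State} {Q : State → Prop}
    (h : Q { s with rreg := Function.update s.rreg r (e.eval s) }) :
    Good ω (.setR r e) s (e.cost + 1) Q :=
  ⟨_, _, .setR r e s, le_rfl, h⟩

theorem Good.storeR {a : ℕ} {i : NExp} {e : RExp} {s : State} {Q : State → Prop}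
    (h : Q { s with rarr := updCell s.rarr a (i.eval s) (e.eval s) }) :
    Good ω (.storeR a i e) s (i.cost + e.cost + 1) Q :=
  ⟨_, _, .storeR a i e s, le_rfl, h⟩

theorem Good.sample {r : ℕ} {s : State} {Q : State → Prop}
    (h : Q { s with rreg := Function.update s.rreg r (ω s.drawn : ℝ), drawn := s.drawn + 1 }) :
    Good ω (.sample r) s 1 Q :=
  ⟨_, _, .sample r s, le_rfl, h⟩

theorem Good.ite {b : Test} {p q : Prog} {s : State} {c c' : ℕ} {Q : State → Prop}
    (h₁ : b.Holds s → Good ω p s c Q) (h₂ : ¬ b.Holds s → Good ω q s c' Q) :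
    Good ω (.ite b p q) s (b.cost + (c + c')) Q := by
  by_cases hb : b.Holds s
  · obtain ⟨s', t, he, ht, hq⟩ := h₁ hb
    exact ⟨s', _, .iteTrue hb he, by omega, hq⟩
  · obtain ⟨s', t, he, ht, hq⟩ := h₂ hb
    exact ⟨s', _, .iteFalse hb he, by omega, hq⟩

/-- `for r in [0, nreg b) do p`. -/
def forR (r b : ℕ) (p : Prog) : Prog :=
  .seq (.setN r (.const 0))
    (.loop (.nlt (.reg r) (.reg b)) (.seq p (.setN r (.add (.reg r) (.const 1)))))

theorem Good.forLoop {r b : ℕ} {p : Prog} {s₀ : State} {N c : ℕ} (I : ℕ → State → Prop)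
    (hN : s₀.nreg b = N) (hbr : b ≠ r) (hpr : p.wN r = false) (hpb : p.wN b = false)
    (hI : ∀ i s v, I i s → I i { s with nreg := Function.update s.nreg r v })
    (h₀ : I 0 s₀)
    (hstep : ∀ i < N, ∀ s, Agree (forR r b p) s₀ s → s.nreg r = i → I i s →
      Good ω p s c (I (i + 1))) :
    Good ω (forR r b p) s₀ (N * (c + 7) + 5) (I N) := by
  have key : ∀ m i s, i + m = N → Agree (forR r b p) s₀ s → s.nreg r = i → I i s →
      Good ω (.loop (.nlt (.reg r) (.reg b)) (.seq p (.setN r (.add (.reg r) (.const 1)))))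
        s (m * (c + 7) + 3) (I N) := by
    intro m
    induction m with
    | zero =>
      intro i s hi ha hr h
      obtain rfl : i = N := by simpa using hi
      refine ⟨s, _, .loopDone ?_, ?_, h⟩
      · have := ha.n b (by simp [forR, Prog.wN, hpb, hbr.symm])
        simp only [Test.Holds, NExp.eval]
        omega
      · simp [Test.cost, NExp.cost]
    | succ m ih =>
      intro i s hi ha hr h
      obtain ⟨s₁, t₁, he₁, ht₁, hq₁⟩ := hstep i (by omega) s ha hr h
      have hs₁ := he₁.agree.n r hpr
      have he : Exec ω (.seq p (.setN r (.add (.reg r) (.const 1)))) s _ _ :=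
        he₁.seq (.setN r (.add (.reg r) (.const 1)) s₁)
      have ha₁ := (he.agree.loop (b := .nlt (.reg r) (.reg b))).seq_right
        (p := .setN r (.const 0))
      obtain ⟨s₂, t₂, he₂, ht₂, hq₂⟩ := ih (i + 1) _ (by omega) (ha.trans ha₁)
        (by simp [NExp.eval, hs₁, hr]) (hI _ _ _ hq₁)
      refine ⟨s₂, _, .loopStep ?_ he he₂, ?_, hq₂⟩
      · have := ha.n b (by simp [forR, Prog.wN, hpb, hbr.symm])
        simp only [Test.Holds, NExp.eval]
        omega
      · simp only [Test.cost, NExp.cost]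
        linarith
  have h1 : Good ω (.setN r (.const 0)) s₀ 2
      (fun s => Agree (forR r b p) s₀ s ∧ s.nreg r = 0 ∧ I 0 s) :=
    Good.setN (r := r) (e := .const 0) ⟨(Exec.setN (ω := ω) r (.const 0) s₀).agree.seq_left,
      by simp [NExp.eval], hI _ _ _ h₀⟩
  exact (h1.seq fun s₁ _ h => key N 0 s₁ (by omega) h.1 h.2.1 h.2.2).mono (by omega)
    fun _ _ h => h

@[simp] theorem updCell_apply {β : Type} (m : ℕ → ℕ → β) (a i : ℕ) (v : β) (a' i' : ℕ) :
    updCell m a i v a' i' = if a' = a ∧ i' = i then v else m a' i' := by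
  unfold updCell
  by_cases h : a' = a
  · subst h
    by_cases h' : i' = i
    · subst h'; simp
    · simp [h']
  · simp [h]

end RealRAM

/-! ## The program -/

namespace RealRAM

instance : Add NExp := ⟨.add⟩
instance : Sub NExp := ⟨.sub⟩
instance : Mul NExp := ⟨.mul⟩
instance (c : ℕ) : OfNat NExp c := ⟨.const c⟩
instance : Add RExp := ⟨.add⟩
instance : Sub RExp := ⟨.sub⟩
instance : Mul RExp := ⟨.mul⟩
instance : Div RExp := ⟨.div⟩
instance (c : ℕ) : OfNat RExp c := ⟨.ofNat (.const c)⟩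

@[simp] theorem NExp.eval_hadd (s : State) (x y : NExp) :
    (x + y).eval s = x.eval s + y.eval s := rfl
@[simp] theorem NExp.eval_hsub (s : State) (x y : NExp) :
    (x - y).eval s = x.eval s - y.eval s := rfl
@[simp] theorem NExp.eval_hmul (s : State) (x y : NExp) :
    (x * y).eval s = x.eval s * y.eval s := rfl
@[simp] theorem NExp.eval_zero (s : State) : NExp.eval s (0 : NExp) = 0 := rfl
@[simp] theorem NExp.eval_one (s : State) : NExp.eval s (1 : NExp) = 1 := rfl
@[simp] theorem NExp.eval_two (s : State) : NExp.eval s (2 : NExp) = 2 := rfl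
@[simp] theorem NExp.eval_three (s : State) : NExp.eval s (3 : NExp) = 3 := rfl
@[simp] theorem NExp.eval_four (s : State) : NExp.eval s (4 : NExp) = 4 := rfl
@[simp] theorem NExp.eval_nreg (s : State) (r : ℕ) : (NExp.reg r).eval s = s.nreg r := rfl
@[simp] theorem NExp.eval_narr (s : State) (a : ℕ) (i : NExp) :
    (NExp.arr a i).eval s = s.narr a (i.eval s) := rfl
@[simp] theorem RExp.eval_hadd (s : State) (x y : RExp) :
    (x + y).eval s = x.eval s + y.eval s := rfl
@[simp] theorem RExp.eval_hsub (s : State) (x y : RExp) :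
    (x - y).eval s = x.eval s - y.eval s := rfl
@[simp] theorem RExp.eval_hmul (s : State) (x y : RExp) :
    (x * y).eval s = x.eval s * y.eval s := rfl
@[simp] theorem RExp.eval_hdiv (s : State) (x y : RExp) :
    (x / y).eval s = x.eval s / y.eval s := rfl
@[simp] theorem RExp.eval_zero (s : State) : RExp.eval s (0 : RExp) = 0 := Nat.cast_zero
@[simp] theorem RExp.eval_one (s : State) : RExp.eval s (1 : RExp) = 1 := Nat.cast_one
@[simp] theorem RExp.eval_two (s : State) : RExp.eval s (2 : RExp) = 2 := Nat.cast_ofNat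
@[simp] theorem RExp.eval_three (s : State) : RExp.eval s (3 : RExp) = 3 := Nat.cast_ofNat
@[simp] theorem RExp.eval_six (s : State) : RExp.eval s (6 : RExp) = 6 := Nat.cast_ofNat
@[simp] theorem RExp.eval_rreg (s : State) (r : ℕ) : (RExp.reg r).eval s = s.rreg r := rfl
@[simp] theorem RExp.eval_rarr (s : State) (a : ℕ) (i : NExp) :
    (RExp.arr a i).eval s = s.rarr a (i.eval s) := rfl
@[simp] theorem RExp.eval_ofNExp (s : State) (x : NExp) :
    (RExp.ofNat x).eval s = (x.eval s : ℝ) := rfl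
@[simp] theorem RExp.eval_root (s : State) (x : RExp) :
    (RExp.sqrt x).eval s = √(x.eval s) := rfl

/-- Integer registers: `0, 1, 2` the input `n`, `k` and the number of terms; `3` holds
`D = 3 n + 1`, `4` holds `D ^ k`, `5` holds `D ^ (k - 1)`, `6` holds `3 n`, `16` holds `k - 1` and
`7` holds `1`.  Cell `i` of the integer array `4` holds `D ^ i`. -/
def initProg : Prog :=
  .seq (.setN 6 (3 * .reg 0)) <|
  .seq (.setN 3 (.reg 6 + 1)) <|
  .seq (.setN 16 (.reg 1 - 1)) <|
  .seq (.storeN 4 0 1) <|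
  .seq (forR 10 1 (.storeN 4 (.reg 10 + 1) (.arr 4 (.reg 10) * .reg 3))) <|
  .seq (.setN 4 (.arr 4 (.reg 1))) <|
  .seq (.setN 5 (.arr 4 (.reg 16))) <|
  .setN 7 1

/-- Fills the cells `q < D ^ k` of the integer array `3` with the codes of the digits of `q`. -/
def codeProg : Prog :=
  .seq (.storeN 3 0 1) <|
  forR 10 5 <| forR 11 3 <|
    .storeN 3 (.reg 11 + .reg 3 * .reg 10) (.arr 3 (.reg 10) * (1 + .reg 11 * .reg 4))

/-- The index of the letter in slot `l` of term `t`. -/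
def slotExp (t l : NExp) : NExp :=
  3 * .arr 0 (t * .reg 1 + l) + .arr 1 (t * .reg 1 + l)

/-- Processes one slot of a term: register `14` accumulates the code, real register `0` the scaled
coefficient, and real register `1` the factorial of the number of empty slots. -/
def slotProg : Prog :=
  .seq (.setN 13 (slotExp (.reg 10) (.reg 11))) <|
  .seq (.setN 14 (.reg 14 * (1 + .reg 13 * .reg 4))) <|
  .ite (.neq (.reg 13) 0)
    (.seq (.setN 15 (.reg 15 + 1)) (.setR 1 (.reg 1 * .ofNat (.reg 15))))
    (.setR 0 (.reg 0 / .sqrt 3))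

/-- Processes one term. -/
def termProg : Prog :=
  .seq (.setN 14 1) <|
  .seq (.setN 15 0) <|
  .seq (.setR 0 (.arr 0 (.reg 10))) <|
  .seq (.setR 1 1) <|
  .seq (forR 11 1 slotProg) <|
  .seq (.ite (.neq (.reg 14) 1) (.setR 0 0) .nop) <|
  .seq (.storeR 2 (.reg 10) (.reg 0)) <|
  .storeR 3 (.reg 14) (.arr 3 (.reg 14) + .reg 0 * .reg 1)

/-- Reads the terms: real array `2` receives the scaled coefficients, real array `3` the entries of
the symmetric tensor, addressed by codes. -/
def termsProg : Prog := forR 10 2 termProg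

/-- Expands the symmetric tensor into the real array `4`. -/
def fillProg : Prog := forR 10 4 (.storeR 4 (.reg 10) (.arr 3 (.arr 3 (.reg 10))))

/-- The cell of digit `reg 13 + 1` above the cell `q`. -/
def upper (q : NExp) : NExp := q + .reg 8 * (.reg 13 + 1)

/-- Sums of squares for one cell `reg 18`. -/
def prepCellProg : Prog :=
  .seq (.setN 18 (.reg 11 + .reg 3 * .reg 12)) <|
  .seq (.setR 1 0) <|
  .seq (forR 13 6 (.setR 1 (.reg 1 + .arr 4 (upper (.reg 18)) * .arr 4 (upper (.reg 18))))) <|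
  .seq (.storeR 5 (.reg 18) (.reg 1)) <|
  .seq (.storeR 6 (.reg 18) (.arr 4 (.reg 18) * .arr 4 (.reg 18) + .reg 1)) <|
  .setR 0 (.reg 0 + .arr 6 (.reg 18))

/-- Sums of squares of all cells and of all blocks. -/
def prepProg : Prog :=
  forR 11 3 <|
  .seq (.setR 0 0) <|
  .seq (forR 12 9 prepCellProg) <|
  .storeR 7 (.reg 11) (.sqrt (.reg 0))

/-- Contribution of one cell to the drift of the potential. -/
def driftCellProg : Prog :=
  .seq (.setN 18 (.reg 11 + .reg 3 * .reg 12)) <|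
  .seq (.setR 3 (.arr 4 (.reg 18))) <|
  .seq (.setR 4 (.arr 4 (upper (.reg 18)))) <|
  .seq (.storeR 5 (.reg 18) (.arr 5 (.reg 18) - .reg 4 * .reg 4)) <|
  .setR 2 (.reg 2 + .reg 3 * .reg 4 *
    (6 - (.reg 3 * .reg 3 + .reg 4 * .reg 4 + 3 * .arr 5 (.reg 18)) / .arr 6 (.reg 18)) /
      .arr 7 (.reg 11))

/-- Real register `5` receives the sign that does not decrease the potential. -/
def signProg : Prog :=
  .seq (.setR 2 0) <|
  .seq (forR 11 3 (forR 12 9 driftCellProg)) <|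
  .ite (.rlt (.reg 2) 0) (.setR 5 (0 - 1)) (.setR 5 1)

/-- The choice of the sign in the last stage. -/
def lastSignProg : Prog :=
  .ite (.rlt (.arr 4 0 * .arr 4 (.reg 13 + 1)) 0) (.setR 5 (0 - 1)) (.setR 5 1)

/-- Applies the chosen sign to the tensor and to the table of subset sums. -/
def applyProg : Prog :=
  .seq (forR 11 8 (.storeR 4 (.reg 11) (.arr 4 (.reg 11) + .reg 5 * .arr 4 (upper (.reg 11))))) <|
  forR 11 7 (.storeR 8 ((.reg 11 + .reg 7) * .reg 3 + (.reg 13 + 1))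
    (.arr 8 (.reg 11 * .reg 3 + (.reg 13 + 1)) + .reg 5))

/-- Doubles the table of subset sums. -/
def doubleProg : Prog :=
  .seq (forR 11 7 (.storeR 8 ((.reg 11 + .reg 7) * .reg 3) (.arr 8 (.reg 11 * .reg 3) + 1))) <|
  .setN 7 (.reg 7 + .reg 7)

/-- Contraction of the top digit. -/
def stageProg : Prog :=
  .seq (.setN 8 (.arr 4 (.reg 16 - .reg 10))) <|
  .seq (.setN 9 (.arr 4 (.reg 16 - .reg 10 - 1))) <|
  .seq prepProg <|
  .seq (forR 13 6 (.seq signProg applyProg)) doubleProg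

/-- Contraction of the last digit. -/
def lastStageProg : Prog :=
  .seq (.setN 8 1) <|
  .seq (forR 13 6 (.seq lastSignProg applyProg)) doubleProg

/-- Real register `0` receives the gain of candidate `reg 10`. -/
def gainProg : Prog :=
  .seq (.setR 0 0) <|
  forR 11 2 <|
  .seq (.setR 1 (.arr 2 (.reg 11))) <|
  .seq (forR 12 1 (.setR 1 (.reg 1 *
    (.arr 8 (.reg 10 * .reg 3 + slotExp (.reg 11) (.reg 12)) / .arr 8 (.reg 10 * .reg 3))))) <|
  .setR 0 (.reg 0 + .reg 1)

/-- Integer register `17` receives the best candidate. -/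
def searchProg : Prog :=
  .seq (.setN 17 0) <|
  .seq (.setR 6 0) <|
  forR 10 7 <|
  .seq gainProg <|
  .ite (.rlt (.reg 6 * .reg 6) (.reg 0 * .reg 0))
    (.seq (.setR 6 (.reg 0)) (.setN 17 (.reg 10))) .nop

/-- Draws the sign of component `c` of qubit `reg 10`. -/
def drawProg (c : ℕ) : Prog :=
  .seq (.sample 0) <|
  .ite (.rlt (.reg 0 + .reg 0)
      (1 + .arr 8 (.reg 17 * .reg 3 + (3 * .reg 10 + .const c)) / .arr 8 (.reg 17 * .reg 3)))
    (.setR c 1) (.setR c (0 - 1))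

/-- Writes the amplitudes of one qubit. -/
def qubitProg : Prog :=
  .seq (drawProg 1) <|
  .seq (drawProg 2) <|
  .seq (drawProg 3) <|
  .seq (.setR 4 (.sqrt ((1 + .reg 3 / .sqrt 3) / 2))) <|
  .seq (.storeR 1 (4 * .reg 10) (.reg 4)) <|
  .seq (.storeR 1 (4 * .reg 10 + 1) 0) <|
  .seq (.storeR 1 (4 * .reg 10 + 2) (.reg 1 / (2 * .sqrt 3 * .reg 4))) <|
  .storeR 1 (4 * .reg 10 + 3) (.reg 2 / (2 * .sqrt 3 * .reg 4))

/-- Randomized rounding. -/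
def roundProg : Prog := forR 10 0 qubitProg

/-- The deterministic part: finds the table of subset sums and the best candidate. -/
def searchPhase : Prog :=
  .seq initProg <|
  .seq codeProg <|
  .seq termsProg <|
  .seq fillProg <|
  .seq (forR 10 16 stageProg) <|
  .seq lastStageProg searchProg

/-- The optimizer. -/
def optimizer : Prog := .seq searchPhase roundProg

end RealRAM

/-! ## Verification of the preprocessing -/

namespace RealRAM

variable {ω : Tape}

theorem Good.of_cost {p : Prog} {s : State} {c c' : ℕ} {Q : State → Prop} (h : Good ω p s c Q)
    (hc : c ≤ c') : Good ω p s c' Q :=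
  h.mono hc fun _ _ h => h

/-- Sequencing with a total budget `c`, of which `c₁` is for the first program. -/
theorem Good.seq' {p q : Prog} {s : State} {c : ℕ} (c₁ : ℕ) {Q Q₁ : State → Prop}
    (h₁ : Good ω p s c₁ Q₁) (hc : c₁ ≤ c)
    (h₂ : ∀ s₁, Agree p s s₁ → Q₁ s₁ → Good ω q s₁ (c - c₁) Q) :
    Good ω (.seq p q) s c Q :=
  (h₁.seq h₂).of_cost (by omega)

theorem Good.setN_seq {r : ℕ} {e : NExp} {q : Prog} {s : State} {c : ℕ} {Q : State → Prop}
    (h : Good ω q { s with nreg := Function.update s.nreg r (e.eval s) } (c - 60) Q)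
    (he : e.cost + 1 ≤ 60 := by decide) (hc : 60 ≤ c := by omega) :
    Good ω (.seq (.setN r e) q) s c Q :=
  ((Good.setN (Q := (· = _)) rfl).of_cost he).seq' _ hc fun _ _ hs => hs ▸ h

theorem Good.storeN_seq {a : ℕ} {i e : NExp} {q : Prog} {s : State} {c : ℕ} {Q : State → Prop}
    (h : Good ω q { s with narr := updCell s.narr a (i.eval s) (e.eval s) } (c - 60) Q)
    (he : i.cost + e.cost + 1 ≤ 60 := by decide) (hc : 60 ≤ c := by omega) :
    Good ω (.seq (.storeN a i e) q) s c Q :=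
  ((Good.storeN (Q := (· = _)) rfl).of_cost he).seq' _ hc fun _ _ hs => hs ▸ h

theorem Good.setR_seq {r : ℕ} {e : RExp} {q : Prog} {s : State} {c : ℕ} {Q : State → Prop}
    (h : Good ω q { s with rreg := Function.update s.rreg r (e.eval s) } (c - 60) Q)
    (he : e.cost + 1 ≤ 60 := by decide) (hc : 60 ≤ c := by omega) :
    Good ω (.seq (.setR r e) q) s c Q :=
  ((Good.setR (Q := (· = _)) rfl).of_cost he).seq' _ hc fun _ _ hs => hs ▸ h

theorem Good.storeR_seq {a : ℕ} {i : NExp} {e : RExp} {q : Prog} {s : State} {c : ℕ}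
    {Q : State → Prop}
    (h : Good ω q { s with rarr := updCell s.rarr a (i.eval s) (e.eval s) } (c - 60) Q)
    (he : i.cost + e.cost + 1 ≤ 60 := by decide) (hc : 60 ≤ c := by omega) :
    Good ω (.seq (.storeR a i e) q) s c Q :=
  ((Good.storeR (Q := (· = _)) rfl).of_cost he).seq' _ hc fun _ _ hs => hs ▸ h

theorem Good.sample_seq {r : ℕ} {q : Prog} {s : State} {c : ℕ} {Q : State → Prop}
    (h : Good ω q { s with rreg := Function.update s.rreg r (ω s.drawn : ℝ),
                           drawn := s.drawn + 1 } (c - 1) Q) (hc : 1 ≤ c := by omega) :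
    Good ω (.seq (.sample r) q) s c Q :=
  (Good.sample (Q := (· = _)) rfl).seq' _ hc fun _ _ hs => hs ▸ h

/-- The facts about the registers that `initProg` establishes. -/
structure Setup (n k : ℕ) (s : State) : Prop where
  reg0 : s.nreg 0 = n
  reg1 : s.nreg 1 = k
  reg3 : s.nreg 3 = 3 * n + 1
  reg4 : s.nreg 4 = (3 * n + 1) ^ k
  reg5 : s.nreg 5 = (3 * n + 1) ^ (k - 1)
  reg6 : s.nreg 6 = 3 * n
  reg16 : s.nreg 16 = k - 1
  pow : ∀ i ≤ k, s.narr 4 i = (3 * n + 1) ^ i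

theorem Setup.agree {n k : ℕ} {s s' : State} {p : Prog} (h : Setup n k s) (ha : Agree p s s')
    (hp : (∀ r ∈ [0, 1, 3, 4, 5, 6, 16], p.wN r = false) ∧ p.wNA 4 = false) :
    Setup n k s' where
  reg0 := (ha.n _ (hp.1 0 (by simp))).trans h.reg0
  reg1 := (ha.n _ (hp.1 1 (by simp))).trans h.reg1
  reg3 := (ha.n _ (hp.1 3 (by simp))).trans h.reg3
  reg4 := (ha.n _ (hp.1 4 (by simp))).trans h.reg4
  reg5 := (ha.n _ (hp.1 5 (by simp))).trans h.reg5
  reg6 := (ha.n _ (hp.1 6 (by simp))).trans h.reg6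
  reg16 := (ha.n _ (hp.1 16 (by simp))).trans h.reg16
  pow i hi := (congrFun (ha.na _ hp.2) i).trans (h.pow i hi)

theorem initProg_spec {n k : ℕ} {s : State} (hn : s.nreg 0 = n) (hk : s.nreg 1 = k) :
    Good ω initProg s (500 + 30 * k) fun s' => Setup n k s' ∧ s'.nreg 7 = 1 := by
  refine Good.setN_seq ?_
  refine Good.setN_seq ?_
  refine Good.setN_seq ?_
  refine Good.storeN_seq ?_
  refine Good.seq' (k * (15 + 7) + 5) (Good.forLoop
    (fun i s => ∀ l ≤ i, s.narr 4 l = (3 * n + 1) ^ l) ?_ (by decide) rfl rfl ?_ ?_ ?_)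
    (by omega) ?_
  · simp [hk]
  · exact fun i s v h => h
  · simp
  · intro i hi s' ha hr h
    have h3 : s'.nreg 3 = 3 * n + 1 := by simpa [hn] using ha.n 3 rfl
    refine (Good.storeN ?_).of_cost (by decide)
    intro l hl
    simp only [NExp.eval_hadd, NExp.eval_nreg, NExp.eval_hmul, updCell_apply, hr,
      NExp.eval_narr, true_and, NExp.eval_one, h3]
    split_ifs with hl'
    · rw [hl', h i le_rfl, pow_succ]
    · exact h l (by omega)
  · intro s₁ ha h
    refine Good.setN_seq ?_
    refine Good.setN_seq ?_
    refine (Good.setN ?_).of_cost ?_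
    · have h0 := ha.n 0 rfl
      have h1 := ha.n 1 rfl
      have h3 := ha.n 3 rfl
      have h6 := ha.n 6 rfl
      have h16 := ha.n 16 rfl
      simp [hn, hk] at h0 h1 h3 h6 h16
      refine ⟨⟨?_, ?_, ?_, ?_, ?_, ?_, ?_, ?_⟩, ?_⟩ <;> simp [*]
      assumption
    · have : NExp.cost 1 = 1 := rfl
      omega

theorem codeProg_spec {n k : ℕ} (hn : 1 ≤ n) (hk : 1 ≤ k) {s : State} (hs : Setup n k s)
    (cd : ℕ → ℕ)
    (h0 : cd 0 = 1)
    (hcd : ∀ Q, ∀ j < 3 * n + 1, cd (j + (3 * n + 1) * Q) = cd Q * (1 + j * (3 * n + 1) ^ k)) :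
    Good ω codeProg s (150 * (3 * n + 1) ^ k) fun s' =>
      ∀ q < (3 * n + 1) ^ k, s'.narr 3 q = cd q := by
  have hX : (3 * n + 1) ^ k = (3 * n + 1) ^ (k - 1) * (3 * n + 1) := by
    rw [← pow_succ, Nat.sub_add_cancel hk]
  have hY : 1 ≤ (3 * n + 1) ^ (k - 1) := Nat.one_le_pow _ _ (by omega)
  have hX' : 1 ≤ (3 * n + 1) ^ k := Nat.one_le_pow _ _ (by omega)
  refine Good.storeN_seq ?_
  refine Good.mono (c := (3 * n + 1) ^ (k - 1) * (((3 * n + 1) * (20 + 7) + 5) + 7) + 5)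
    (Good.forLoop
    (fun Q s => s.narr 3 0 = 1 ∧ ∀ q < (3 * n + 1) * Q, s.narr 3 q = cd q) ?_ (by decide) rfl rfl
    ?_ ?_ ?_) ?_ ?_
  · exact hs.reg5
  · exact fun i s v h => h
  · simp
  · intro Q hQ s₁ ha hr h
    have hset : Setup n k s₁ := by
      refine Setup.agree ?_ ha ⟨by decide, rfl⟩
      exact ⟨hs.reg0, hs.reg1, hs.reg3, hs.reg4, hs.reg5, hs.reg6, hs.reg16,
        by simpa using hs.pow⟩
    refine Good.mono (Good.forLoop
      (fun j s => s.narr 3 0 = 1 ∧ ∀ q < (3 * n + 1) * Q + j, s.narr 3 q = cd q) hset.reg3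
      (by decide) rfl rfl ?_ ?_ ?_) le_rfl ?_
    · exact fun i s v h => h
    · simpa using h
    · intro j hj s₂ ha₂ hr₂ h₂
      have hset₂ : Setup n k s₂ := hset.agree ha₂ ⟨by decide, rfl⟩
      have h10 := (ha₂.n 10 rfl).trans hr
      refine (Good.storeN ?_).of_cost (by decide)
      have hQ' : s₂.narr 3 Q = cd Q := by
        rcases Nat.eq_zero_or_pos Q with rfl | hQ0
        · rw [h₂.1, h0]
        · exact h₂.2 _ (by nlinarith [Nat.mul_le_mul_right Q hn])
      simp only [NExp.eval_hadd, NExp.eval_nreg, NExp.eval_hmul, updCell_apply, hr₂, h10,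
        NExp.eval_narr, true_and, NExp.eval_one, hset₂.reg3, hset₂.reg4, hQ', ← hcd Q j hj]
      constructor
      · split_ifs with h'
        · rw [← h', h0]
        · exact h₂.1
      · intro q hq
        split_ifs with h'
        · rw [h']
        · exact h₂.2 q (by omega)
    · intro s₂ _ h₂
      simpa [mul_add] using h₂
  · rw [hX]
    generalize (3 * n + 1) ^ (k - 1) = Y at *
    have : 1 ≤ Y * (3 * n + 1) := by nlinarith
    have : Y ≤ Y * (3 * n + 1) := by nlinarith
    have : Y * ((3 * n + 1) * (20 + 7) + 5 + 7) = 27 * (Y * (3 * n + 1)) + 12 * Y := by ring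
    omega
  · intro s' _ h q hq
    refine h.2 q ?_
    rwa [mul_comm, ← hX]

end RealRAM

/-! ## Verification of the reading of the terms -/

namespace RealRAM

variable {ω : Tape}

/-- The code of a tuple. -/
def tupleCode (X : ℕ) (J : ℕ → ℕ) (k : ℕ) : ℕ := ∏ l ∈ Finset.range k, (1 + J l * X)

/-- The number of empty slots among the first `k`. -/
def emptySlots (J : ℕ → ℕ) (k : ℕ) : ℕ := ((Finset.range k).filter fun l => J l = 0).card

/-- The scaled coefficient of a term with coefficient `a`. -/
noncomputable def scaledCoef (X : ℕ) (J : ℕ → ℕ) (k : ℕ) (a : ℝ) : ℝ :=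
  if tupleCode X J k = 1 then 0 else a / √3 ^ ((Finset.range k).filter fun l => J l ≠ 0).card

theorem slotExp_eval {k : ℕ} {s : State} (hk : s.nreg 1 = k) (t l : NExp) :
    (slotExp t l).eval s =
      3 * s.narr 0 (t.eval s * k + l.eval s) + s.narr 1 (t.eval s * k + l.eval s) := by
  simp [slotExp, hk]

theorem slotLoop_spec {k X : ℕ} {s : State} (hk : s.nreg 1 = k) (hX : s.nreg 4 = X) {t : ℕ}
    (ht : s.nreg 10 = t) {J : ℕ → ℕ} {a : ℝ}
    (hJ : ∀ l < k, 3 * s.narr 0 (t * k + l) + s.narr 1 (t * k + l) = J l)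
    (h14 : s.nreg 14 = 1) (h15 : s.nreg 15 = 0) (h0 : s.rreg 0 = a) (h1 : s.rreg 1 = 1) :
    Good ω (forR 11 1 slotProg) s (k * 307 + 5) fun s' =>
      s'.nreg 14 = tupleCode X J k ∧ s'.rreg 1 = (emptySlots J k).factorial ∧
      s'.rreg 0 = a / √3 ^ ((Finset.range k).filter fun l => J l ≠ 0).card := by
  refine (Good.forLoop (N := k) (c := 300) (fun l s' => s'.nreg 14 = tupleCode X J l ∧
    s'.nreg 15 = emptySlots J l ∧ s'.rreg 1 = (emptySlots J l).factorial ∧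
    s'.rreg 0 = a / √3 ^ ((Finset.range l).filter fun l => J l ≠ 0).card)
    hk (by decide) rfl rfl ?_ ?_ ?_).mono le_rfl ?_
  · intro i s v h
    simpa using h
  · simp [tupleCode, emptySlots, *]
  · rintro l hl s₁ ha hr ⟨i14, i15, i1, i0⟩
    have e1 : s₁.nreg 1 = k := (ha.n 1 rfl).trans hk
    have e10 : s₁.nreg 10 = t := (ha.n 10 rfl).trans ht
    have e4 : s₁.nreg 4 = X := (ha.n 4 rfl).trans hX
    have eJ : (slotExp (.reg 10) (.reg 11)).eval s₁ = J l := by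
      rw [slotExp_eval e1, ← hJ l hl, ha.na 0 rfl, ha.na 1 rfl]
      simp [e10, hr]
    refine Good.setN_seq ?_
    refine Good.setN_seq ?_
    have hcode : tupleCode X J (l + 1) = tupleCode X J l * (1 + J l * X) := by
      simp [tupleCode, Finset.prod_range_succ]
    refine (Good.ite (c := 70) (c' := 10) ?_ ?_).of_cost (by decide)
    · intro hb
      have hb : J l = 0 := by simpa [Test.Holds, eJ] using hb
      have hc : emptySlots J (l + 1) = emptySlots J l + 1 := by
        simp [emptySlots, Finset.range_add_one, Finset.filter_insert, hb]
      have hc' : ((Finset.range (l + 1)).filter fun l => J l ≠ 0) =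
          (Finset.range l).filter fun l => J l ≠ 0 := by
        simp [Finset.range_add_one, Finset.filter_insert, hb]
      refine Good.setN_seq ((Good.setR ?_).of_cost (by decide))
      simp [eJ, hcode, hc, hc', hb, i14, i15, i1, i0, Nat.factorial_succ, mul_comm]
    · intro hb
      have hb : J l ≠ 0 := by simpa [Test.Holds, eJ] using hb
      have hc : emptySlots J (l + 1) = emptySlots J l := by
        simp [emptySlots, Finset.range_add_one, Finset.filter_insert, hb]
      have hc' : ((Finset.range (l + 1)).filter fun l => J l ≠ 0).card =
          ((Finset.range l).filter fun l => J l ≠ 0).card + 1 := by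
        simp [Finset.range_add_one, Finset.filter_insert, hb]
      refine (Good.setR ?_).of_cost (by decide)
      simp [eJ, hcode, hc, hc', i14, i15, i1, i0, e4, pow_succ, div_div]
  · rintro s' _ ⟨h1, _, h2, h3⟩
    exact ⟨h1, h2, h3⟩

theorem termsProg_spec {n k : ℕ} {s : State} (hs : Setup n k s) {T : ℕ} (hT : s.nreg 2 = T)
    {J : ℕ → ℕ → ℕ} {a : ℕ → ℝ}
    (hJ : ∀ t < T, ∀ l < k, 3 * s.narr 0 (t * k + l) + s.narr 1 (t * k + l) = J t l)
    (ha : ∀ t < T, s.rarr 0 t = a t) (h3 : ∀ c, s.rarr 3 c = 0) :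
    Good ω termsProg s (T * (k * 307 + 600) + 5) fun s' =>
      (∀ t < T, s'.rarr 2 t = scaledCoef ((3 * n + 1) ^ k) (J t) k (a t)) ∧
      ∀ c, s'.rarr 3 c = ∑ t ∈ Finset.range T,
        if c = tupleCode ((3 * n + 1) ^ k) (J t) k then
          scaledCoef ((3 * n + 1) ^ k) (J t) k (a t) * (emptySlots (J t) k).factorial else 0 := by
  refine (Good.forLoop (N := T) (c := k * 307 + 593) (fun i s' =>
      (∀ t < i, s'.rarr 2 t = scaledCoef ((3 * n + 1) ^ k) (J t) k (a t)) ∧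
      ∀ c, s'.rarr 3 c = ∑ t ∈ Finset.range i,
        if c = tupleCode ((3 * n + 1) ^ k) (J t) k then
          scaledCoef ((3 * n + 1) ^ k) (J t) k (a t) * (emptySlots (J t) k).factorial else 0)
    hT (by decide) rfl rfl ?_ ?_ ?_)
  · exact fun i s v h => h
  · simpa using h3
  · rintro t ht s₁ hag hr ⟨i2, i3⟩
    have hset : Setup n k s₁ := hs.agree hag ⟨by decide, rfl⟩
    refine Good.setN_seq ?_
    refine Good.setN_seq ?_
    refine Good.setR_seq ?_
    refine Good.setR_seq ?_
    refine Good.seq' (k * 307 + 5) (slotLoop_spec (k := k) (X := (3 * n + 1) ^ k) (t := t)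
      (J := J t) (a := a t) ?_ ?_ ?_ ?_ ?_ ?_ ?_ ?_) (by omega) ?_
    · simp [hset.reg1]
    · simp [hset.reg4]
    · simp [hr]
    · intro l hl
      simp only
      rw [hag.na 0 rfl, hag.na 1 rfl, hJ t ht l hl]
    · simp
    · simp
    · simp [hr, hag.ra 0 rfl, ha t ht]
    · simp
    · rintro s₂ ha₂ ⟨j14, j1, j0⟩
      have e2 : s₂.rarr 2 = s₁.rarr 2 := ha₂.ra 2 rfl
      have e3 : s₂.rarr 3 = s₁.rarr 3 := ha₂.ra 3 rfl
      have e10 : s₂.nreg 10 = t := (ha₂.n 10 rfl).trans (by simp [hr])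
      refine Good.seq' (Q₁ := fun s₃ => s₃.nreg = s₂.nreg ∧ s₃.rarr = s₂.rarr ∧
          s₃.rreg 1 = s₂.rreg 1 ∧
          s₃.rreg 0 = scaledCoef ((3 * n + 1) ^ k) (J t) k (a t)) 20
        ((Good.ite (c := 5) (c' := 1) ?_ ?_).of_cost (by decide)) (by omega) ?_
      · intro hb
        have hb : tupleCode ((3 * n + 1) ^ k) (J t) k = 1 := by
          simpa [Test.Holds, j14] using hb
        refine (Good.setR ?_).of_cost (by decide)
        simp [scaledCoef, hb]
      · intro hb
        have hb : tupleCode ((3 * n + 1) ^ k) (J t) k ≠ 1 := by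
          simpa [Test.Holds, j14] using hb
        refine Good.nop ?_
        simp [scaledCoef, hb, j0]
      · rintro s₃ _ ⟨k1, k2, k3, k4⟩
        refine Good.storeR_seq ?_
        refine (Good.storeR ?_).of_cost ?_
        · constructor
          · intro u hu
            simp only [updCell_apply, NExp.eval_nreg, k1, k2, k4, e10, RExp.eval_rreg, e2, j14]
            rcases Nat.lt_succ_iff_lt_or_eq.1 hu with hu | rfl
            · simp [hu.ne, i2 u hu]
            · simp
          · intro c
            simp only [updCell_apply, NExp.eval_nreg, k1, k2, k3, k4, e10, RExp.eval_rreg, e3, j14,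
              j1, RExp.eval_hadd, RExp.eval_hmul, RExp.eval_rarr, i3, Finset.sum_range_succ,
              true_and]
            by_cases hc : c = tupleCode ((3 * n + 1) ^ k) (J t) k
            · subst hc
              simp
            · simp [hc]
        · have : (NExp.reg 14).cost + (RExp.arr 3 (.reg 14) + .reg 0 * .reg 1).cost + 1 ≤ 10 := by
            decide
          omega

theorem fillProg_spec {n k : ℕ} {s : State} (hs : Setup n k s) {cd : ℕ → ℕ}
    (h3 : ∀ q < (3 * n + 1) ^ k, s.narr 3 q = cd q) :
    Good ω fillProg s ((3 * n + 1) ^ k * 17 + 5) fun s' =>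
      ∀ q < (3 * n + 1) ^ k, s'.rarr 4 q = s.rarr 3 (cd q) := by
  refine (Good.forLoop (c := 10) (fun i s' => ∀ q < i, s'.rarr 4 q = s.rarr 3 (cd q)) hs.reg4
    (by decide) rfl rfl ?_ ?_ ?_)
  · exact fun i s v h => h
  · simp
  · intro q hq s₁ hag hr h
    refine (Good.storeR ?_).of_cost (by decide)
    intro u hu
    simp only [updCell_apply, NExp.eval_nreg, hr, RExp.eval_rarr, NExp.eval_narr, hag.na 3 rfl,
      hag.ra 3 rfl, true_and]
    split_ifs with h'
    · rw [h', h3 q hq]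
    · exact h u (by omega)

end RealRAM

/-! ## A derandomized Khinchine inequality -/

namespace Derandomize

open Finset

/-- Conditional expectation of `12 y ^ 2 - y ^ 4 / w`, up to an error of the right sign, when `y` is
the sum of `s` and a Rademacher sum of variance `v`. -/
noncomputable def pot (s v w : ℝ) : ℝ := 12 * (s ^ 2 + v) - (s ^ 4 + 6 * s ^ 2 * v + 3 * v ^ 2) / w

/-- The drift of the potential in the direction of `a`. -/
noncomputable def drift (s a v w : ℝ) : ℝ := s * a * (6 - (s * s + a * a + 3 * v) / w)

theorem pot_step {s a v w ε : ℝ} (hw : 0 ≤ w) (hε : ε = 1 ∨ ε = -1) :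
    pot s (v + a ^ 2) w + 4 * (ε * drift s a v w) ≤ pot (s + ε * a) v w := by
  have h : pot (s + ε * a) v w - (pot s (v + a ^ 2) w + 4 * (ε * drift s a v w)) =
      2 * a ^ 4 * w⁻¹ := by
    unfold pot drift
    simp only [div_eq_mul_inv]
    rcases hε with rfl | rfl <;> ring
  have : 0 ≤ 2 * a ^ 4 * w⁻¹ := by positivity
  linarith

theorem pot_start {s v : ℝ} (hv : 0 ≤ v) : 9 * (s ^ 2 + v) ≤ pot s v (s ^ 2 + v) := by
  unfold pot
  have h : (s ^ 4 + 6 * s ^ 2 * v + 3 * v ^ 2) / (s ^ 2 + v) ≤ 3 * (s ^ 2 + v) := by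
    refine div_le_of_le_mul₀ (by positivity) (by positivity) ?_
    nlinarith [sq_nonneg (s ^ 2)]
  linarith

theorem pot_end {s w : ℝ} (hw : 0 ≤ w) (hs : w = 0 → s = 0) :
    pot s 0 (w ^ 2) ≤ 16 * (w * |s|) := by
  rcases hw.eq_or_lt with h | h
  · simp [pot, hs h.symm]
  · have key : 12 * |s| ^ 2 * w ^ 2 - |s| ^ 4 ≤ 16 * w ^ 3 * |s| := by
      nlinarith [mul_nonneg (abs_nonneg s)
        (mul_nonneg (sq_nonneg (|s| - 2 * w)) (by positivity : 0 ≤ |s| + 4 * w))]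
    have e : pot s 0 (w ^ 2) = (12 * |s| ^ 2 * w ^ 2 - |s| ^ 4) / w ^ 2 := by
      have : |s| ^ 4 = s ^ 4 := by rw [show 4 = 2 * 2 by norm_num, pow_mul, pow_mul, sq_abs]
      rw [this, sq_abs]
      unfold pot
      field_simp
      ring
    rw [e, div_le_iff₀ (by positivity)]
    linarith

variable (N : ℕ) (C B : Finset ℕ) (A : ℕ → ℕ → ℕ → ℝ) (ε : ℕ → ℝ)

/-- Partial signed sums `A 0 + ∑ i < j, ε i * A (i + 1)`. -/
def partialSum (j c R : ℕ) : ℝ := A 0 c R + ∑ i ∈ range j, ε i * A (i + 1) c R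

/-- The variance that remains after `j` signs. -/
def remVar (j c R : ℕ) : ℝ := ∑ i ∈ Ico j N, A (i + 1) c R ^ 2

/-- The total second moment of a cell. -/
def cellSq (c R : ℕ) : ℝ := A 0 c R ^ 2 + remVar N A 0 c R

/-- The norm of a block. -/
noncomputable def blockNorm (c : ℕ) : ℝ := √(∑ R ∈ B, cellSq N A c R)

/-- The total drift. -/
noncomputable def totalDrift (j : ℕ) : ℝ :=
  ∑ c ∈ C, ∑ R ∈ B, drift (partialSum A ε j c R) (A (j + 1) c R) (remVar N A (j + 1) c R)
    (cellSq N A c R) / blockNorm N B A c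

theorem remVar_nonneg (j c R : ℕ) : 0 ≤ remVar N A j c R := sum_nonneg fun _ _ => sq_nonneg _

theorem cellSq_nonneg (c R : ℕ) : 0 ≤ cellSq N A c R :=
  add_nonneg (sq_nonneg _) (remVar_nonneg _ _ _ _ _)

theorem remVar_succ {j : ℕ} (hj : j < N) (c R : ℕ) :
    remVar N A j c R = remVar N A (j + 1) c R + A (j + 1) c R ^ 2 := by
  rw [remVar, sum_eq_sum_Ico_succ_bot hj, add_comm, remVar]

theorem partialSum_succ (j c R : ℕ) :
    partialSum A ε (j + 1) c R = partialSum A ε j c R + ε j * A (j + 1) c R := by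
  rw [partialSum, sum_range_succ, ← add_assoc, partialSum]

theorem partialSum_eq_zero {c R : ℕ} (h : cellSq N A c R = 0) :
    partialSum A ε N c R = 0 := by
  have h0 := remVar_nonneg N A 0 c R
  have h1 : A 0 c R = 0 := by
    have := sq_nonneg (A 0 c R)
    refine pow_eq_zero_iff two_ne_zero |>.1 ?_
    unfold cellSq at h
    linarith
  have h2 : remVar N A 0 c R = 0 := by
    unfold cellSq at h
    simpa [h1] using h
  rw [remVar, sum_eq_zero_iff_of_nonneg fun _ _ => sq_nonneg _] at h2
  rw [partialSum, h1, zero_add]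
  refine sum_eq_zero fun i hi => ?_
  have := h2 i (by simpa using hi)
  rw [pow_eq_zero_iff two_ne_zero] at this
  rw [this, mul_zero]

theorem sum_blockNorm_le
    (hε : ∀ j < N, (ε j = 1 ∨ ε j = -1) ∧ 0 ≤ ε j * totalDrift N C B A ε j) :
    9 * ∑ c ∈ C, blockNorm N B A c ≤
      16 * ∑ c ∈ C, √(∑ R ∈ B, partialSum A ε N c R ^ 2) := by
  have hnn : ∀ c, 0 ≤ blockNorm N B A c := fun c => Real.sqrt_nonneg _
  have hsq : ∀ c, blockNorm N B A c ^ 2 = ∑ R ∈ B, cellSq N A c R := fun c =>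
    Real.sq_sqrt (sum_nonneg fun _ _ => cellSq_nonneg _ _ _ _)
  have start : 9 * ∑ c ∈ C, blockNorm N B A c ≤ ∑ c ∈ C, ∑ R ∈ B,
      pot (partialSum A ε 0 c R) (remVar N A 0 c R) (cellSq N A c R) / blockNorm N B A c := by
    rw [mul_sum]
    refine sum_le_sum fun c _ => ?_
    rw [← sum_div]
    rcases (hnn c).eq_or_lt with h | h
    · simp [← h]
    · rw [le_div_iff₀ h, mul_assoc, ← sq, hsq, mul_sum]
      refine sum_le_sum fun R _ => ?_
      simpa [partialSum, cellSq] using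
        pot_start (s := A 0 c R) (remVar_nonneg N A 0 c R)
  have step : ∀ j ≤ N, ∑ c ∈ C, ∑ R ∈ B,
      pot (partialSum A ε 0 c R) (remVar N A 0 c R) (cellSq N A c R) / blockNorm N B A c ≤
      ∑ c ∈ C, ∑ R ∈ B,
      pot (partialSum A ε j c R) (remVar N A j c R) (cellSq N A c R) / blockNorm N B A c := by
    intro j
    induction j with
    | zero => exact fun _ => le_rfl
    | succ j ih =>
      intro hj
      refine (ih (by omega)).trans ?_
      obtain ⟨h1, h2⟩ := hε j hj
      have : ∑ c ∈ C, ∑ R ∈ B,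
          pot (partialSum A ε j c R) (remVar N A j c R) (cellSq N A c R) / blockNorm N B A c +
          4 * (ε j * totalDrift N C B A ε j) ≤ ∑ c ∈ C, ∑ R ∈ B,
          pot (partialSum A ε (j + 1) c R) (remVar N A (j + 1) c R) (cellSq N A c R) /
            blockNorm N B A c := by
        rw [totalDrift, mul_sum, mul_sum, ← sum_add_distrib]
        refine sum_le_sum fun c _ => ?_
        rw [mul_sum, mul_sum, ← sum_add_distrib]
        refine sum_le_sum fun R _ => ?_
        rw [remVar_succ N A hj, partialSum_succ, mul_div_assoc', mul_div_assoc', ← add_div]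
        exact div_le_div_of_nonneg_right (pot_step (cellSq_nonneg N A c R) h1) (hnn c)
      linarith
  refine start.trans ((step N le_rfl).trans ?_)
  rw [mul_sum]
  refine sum_le_sum fun c _ => ?_
  rw [← sum_div]
  refine div_le_of_le_mul₀ (hnn c) (by positivity) ?_
  calc ∑ R ∈ B, pot (partialSum A ε N c R) (remVar N A N c R) (cellSq N A c R)
      ≤ ∑ R ∈ B, 16 * (√(cellSq N A c R) * |partialSum A ε N c R|) := by
        refine sum_le_sum fun R _ => ?_
        have := pot_end (s := partialSum A ε N c R) (Real.sqrt_nonneg (cellSq N A c R))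
          fun h => partialSum_eq_zero N A ε ((Real.sqrt_eq_zero (cellSq_nonneg N A c R)).1 h)
        rw [Real.sq_sqrt (cellSq_nonneg N A c R)] at this
        simpa [remVar] using this
    _ ≤ 16 * (√(∑ R ∈ B, √(cellSq N A c R) ^ 2) * √(∑ R ∈ B, |partialSum A ε N c R| ^ 2)) := by
        rw [← mul_sum]
        exact mul_le_mul_of_nonneg_left (Real.sum_mul_le_sqrt_mul_sqrt _ _ _) (by norm_num)
    _ = 16 * √(∑ R ∈ B, partialSum A ε N c R ^ 2) * blockNorm N B A c := by
        simp only [sq_abs, Real.sq_sqrt (cellSq_nonneg N A c _)]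
        rw [blockNorm]
        ring

end Derandomize

/-! ## Verification of one contraction -/

namespace RealRAM

open Finset Derandomize

variable {ω : Tape}

/-- The cells of the tensor `T`: digit `c` at the bottom, digit `j` at the top, `R` in between. -/
def cells (T : ℕ → ℝ) (D M j c R : ℕ) : ℝ := T (c + D * R + M * j)

/-- The registers that describe the shape of the current tensor. -/
structure Shape (N M M' : ℕ) (s : State) : Prop where
  reg3 : s.nreg 3 = N + 1
  reg6 : s.nreg 6 = N
  reg8 : s.nreg 8 = M
  reg9 : s.nreg 9 = M'

theorem Shape.agree {N M M' : ℕ} {s s' : State} {p : Prog} (h : Shape N M M' s)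
    (ha : Agree p s s') (hp : ∀ r ∈ [3, 6, 8, 9], p.wN r = false) : Shape N M M' s' where
  reg3 := (ha.n _ (hp 3 (by simp))).trans h.reg3
  reg6 := (ha.n _ (hp 6 (by simp))).trans h.reg6
  reg8 := (ha.n _ (hp 8 (by simp))).trans h.reg8
  reg9 := (ha.n _ (hp 9 (by simp))).trans h.reg9

theorem cell_inj {D c c' R R' : ℕ} (hc : c < D) (hc' : c' < D) (h : c + D * R = c' + D * R') :
    c = c' ∧ R = R' := by
  have h1 := congrArg (· % D) h
  simp only [Nat.add_mul_mod_self_left, Nat.mod_eq_of_lt hc, Nat.mod_eq_of_lt hc'] at h1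
  subst h1
  refine ⟨rfl, ?_⟩
  have : D * R = D * R' := by omega
  exact Nat.eq_of_mul_eq_mul_left (by omega) this

theorem upper_eval (s : State) (q : NExp) :
    (upper q).eval s = q.eval s + s.nreg 8 * (s.nreg 13 + 1) := rfl

theorem prepCellProg_spec {N M M' : ℕ} {s : State} (hs : Shape N M M' s) {c R : ℕ}
    (hc : s.nreg 11 = c) (hR : s.nreg 12 = R) :
    Good ω prepCellProg s (N * 67 + 605) fun s' =>
      (∀ q, s'.rarr 5 q = if q = c + (N + 1) * R then remVar N (cells (s.rarr 4) (N + 1) M) 0 c R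
        else s.rarr 5 q) ∧
      (∀ q, s'.rarr 6 q = if q = c + (N + 1) * R then cellSq N (cells (s.rarr 4) (N + 1) M) c R
        else s.rarr 6 q) ∧
      s'.rreg 0 = s.rreg 0 + cellSq N (cells (s.rarr 4) (N + 1) M) c R := by
  refine Good.setN_seq ?_
  refine Good.setR_seq ?_
  refine Good.seq' (N * 67 + 5) (Good.forLoop (fun j s' => s'.rreg 1 =
    ∑ i ∈ range j, cells (s.rarr 4) (N + 1) M (i + 1) c R ^ 2) (hs.reg6) (by decide) rfl rfl
    ?_ ?_ ?_) (by omega) ?_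
  · exact fun i s v h => h
  · simp
  · intro j hj s₁ ha hr h
    have e18 : s₁.nreg 18 = c + (N + 1) * R := (ha.n 18 rfl).trans (by simp [hc, hR, hs.reg3])
    have e8 : s₁.nreg 8 = M := (ha.n 8 rfl).trans (by simp [hs.reg8])
    have e4 : s₁.rarr 4 = s.rarr 4 := ha.ra 4 rfl
    refine (Good.setR ?_).of_cost (by decide)
    simp [upper_eval, sum_range_succ, h, e18, e8, e4, hr, cells, sq]
  · intro s₁ ha h
    have e18 : s₁.nreg 18 = c + (N + 1) * R := (ha.n 18 rfl).trans (by simp [hc, hR, hs.reg3])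
    have e4 : s₁.rarr 4 = s.rarr 4 := ha.ra 4 rfl
    have e5 : s₁.rarr 5 = s.rarr 5 := ha.ra 5 rfl
    have e6 : s₁.rarr 6 = s.rarr 6 := ha.ra 6 rfl
    have e0 : s₁.rreg 0 = s.rreg 0 := (ha.r 0 rfl).trans (by simp)
    have hrem : remVar N (cells (s.rarr 4) (N + 1) M) 0 c R = s₁.rreg 1 := by
      rw [h, remVar, Nat.Ico_zero_eq_range]
    refine Good.storeR_seq ?_
    refine Good.storeR_seq ?_
    refine (Good.setR ?_).of_cost ?_
    · refine ⟨fun q => ?_, fun q => ?_, ?_⟩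
      · simp [e18, e5, hrem]
      · simp [e18, e4, e6, hrem, cellSq, cells, sq]
      · simp [e18, e4, e0, hrem, cellSq, cells, sq]
    · have : (RExp.reg 0 + .arr 6 (.reg 18)).cost + 1 ≤ 60 := by decide
      omega

theorem prepProg_spec {N M M' : ℕ} {s : State} (hs : Shape N M M' s) :
    Good ω prepProg s ((N + 1) * (M' * (N * 67 + 612) + 200) + 5) fun s' =>
      (∀ c < N + 1, ∀ R < M', s'.rarr 5 (c + (N + 1) * R) =
        remVar N (cells (s.rarr 4) (N + 1) M) 0 c R) ∧
      (∀ c < N + 1, ∀ R < M', s'.rarr 6 (c + (N + 1) * R) =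
        cellSq N (cells (s.rarr 4) (N + 1) M) c R) ∧
      ∀ c < N + 1, s'.rarr 7 c =
        blockNorm N (range M') (cells (s.rarr 4) (N + 1) M) c := by
  refine (Good.forLoop (c := M' * (N * 67 + 612) + 193) (fun i s' =>
      (∀ c < i, ∀ R < M', s'.rarr 5 (c + (N + 1) * R) =
        remVar N (cells (s.rarr 4) (N + 1) M) 0 c R) ∧
      (∀ c < i, ∀ R < M', s'.rarr 6 (c + (N + 1) * R) =
        cellSq N (cells (s.rarr 4) (N + 1) M) c R) ∧
      ∀ c < i, s'.rarr 7 c =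
        blockNorm N (range M') (cells (s.rarr 4) (N + 1) M) c) hs.reg3
    (by decide) rfl rfl ?_ ?_ ?_)
  · exact fun i s v h => h
  · simp
  · rintro c hc s₁ ha hr ⟨h5, h6, h7⟩
    have hs₁ : Shape N M M' s₁ := hs.agree ha (by decide)
    have e4 : s₁.rarr 4 = s.rarr 4 := ha.ra 4 rfl
    refine Good.setR_seq ?_
    refine Good.seq' (M' * (N * 67 + 612) + 5) (Good.forLoop (c := N * 67 + 605) (fun i s' =>
      (∀ c' ≤ c, ∀ R < M', (c' = c → R < i) → s'.rarr 5 (c' + (N + 1) * R) =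
        remVar N (cells (s.rarr 4) (N + 1) M) 0 c' R) ∧
      (∀ c' ≤ c, ∀ R < M', (c' = c → R < i) → s'.rarr 6 (c' + (N + 1) * R) =
        cellSq N (cells (s.rarr 4) (N + 1) M) c' R) ∧
      s'.rreg 0 = ∑ R ∈ range i, cellSq N (cells (s.rarr 4) (N + 1) M) c R) hs₁.reg9
      (by decide) rfl rfl ?_ ?_ ?_) (by omega) ?_
    · exact fun i s v h => h
    · refine ⟨fun c' hc' R hR h => ?_, fun c' hc' R hR h => ?_, by simp⟩
      · exact h5 c' (lt_of_le_of_ne hc' fun h' => absurd (h h') (by simp)) R hR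
      · exact h6 c' (lt_of_le_of_ne hc' fun h' => absurd (h h') (by simp)) R hR
    · rintro R hR s₂ ha₂ hr₂ ⟨i5, i6, i0⟩
      have hs₂ : Shape N M M' s₂ := by
        refine Shape.agree ?_ ha₂ (by decide)
        exact ⟨hs₁.reg3, hs₁.reg6, hs₁.reg8, hs₁.reg9⟩
      have e42 : s₂.rarr 4 = s.rarr 4 := (ha₂.ra 4 rfl).trans e4
      have e11 : s₂.nreg 11 = c := (ha₂.n 11 rfl).trans hr
      refine (prepCellProg_spec hs₂ e11 hr₂).mono le_rfl ?_
      rintro s₃ - ⟨j5, j6, j0⟩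
      rw [e42] at j5 j6 j0
      refine ⟨fun c' hc' R' hR' h => ?_, fun c' hc' R' hR' h => ?_, ?_⟩
      · rw [j5]
        split_ifs with hq
        · obtain ⟨rfl, rfl⟩ := cell_inj (by omega) hc hq
          rfl
        · refine i5 c' hc' R' hR' fun h' => ?_
          have := h h'
          subst h'
          exact lt_of_le_of_ne (by omega) fun h' => hq (by rw [h'])
      · rw [j6]
        split_ifs with hq
        · obtain ⟨rfl, rfl⟩ := cell_inj (by omega) hc hq
          rfl
        · refine i6 c' hc' R' hR' fun h' => ?_
          have := h h'
          subst h'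
          exact lt_of_le_of_ne (by omega) fun h' => hq (by rw [h'])
      · rw [j0, i0, sum_range_succ]
    · rintro s₂ ha₂ ⟨i5, i6, i0⟩
      have e11 : s₂.nreg 11 = c := (ha₂.n 11 rfl).trans hr
      have e7 : s₂.rarr 7 = s₁.rarr 7 := ha₂.ra 7 rfl
      refine (Good.storeR ?_).of_cost ?_
      · refine ⟨fun c' hc' R hR => ?_, fun c' hc' R hR => ?_, fun c' hc' => ?_⟩
        · simpa using i5 c' (by omega) R hR fun _ => hR
        · simpa using i6 c' (by omega) R hR fun _ => hR
        · simp only [updCell_apply, NExp.eval_nreg, e11, true_and, RExp.eval_root, RExp.eval_rreg,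
            i0, e7]
          split_ifs with h'
          · rw [h', blockNorm]
          · exact h7 c' (by omega)
      · have : (NExp.reg 11).cost + (RExp.sqrt (.reg 0)).cost + 1 ≤ 60 := by decide
        omega

theorem driftCellProg_spec {N M M' : ℕ} {s : State} (hs : Shape N M M' s) {c R j : ℕ}
    (hc : s.nreg 11 = c) (hR : s.nreg 12 = R) (hj : s.nreg 13 = j) :
    Good ω driftCellProg s 300 fun s' =>
      (∀ q, s'.rarr 5 q = if q = c + (N + 1) * R then
        s.rarr 5 q - s.rarr 4 (c + (N + 1) * R + M * (j + 1)) ^ 2 else s.rarr 5 q) ∧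
      s'.rreg 2 = s.rreg 2 + drift (s.rarr 4 (c + (N + 1) * R))
        (s.rarr 4 (c + (N + 1) * R + M * (j + 1)))
        (s.rarr 5 (c + (N + 1) * R) - s.rarr 4 (c + (N + 1) * R + M * (j + 1)) ^ 2)
        (s.rarr 6 (c + (N + 1) * R)) / s.rarr 7 c := by
  refine Good.setN_seq ?_
  refine Good.setR_seq ?_
  refine Good.setR_seq ?_
  refine Good.storeR_seq ?_
  refine (Good.setR ?_).of_cost (by decide)
  refine ⟨fun q => ?_, ?_⟩
  · simp only [updCell_apply]
    simp only [upper_eval, NExp.eval_nreg, NExp.eval_hadd, NExp.eval_hmul, hc, hR, hj, hs.reg3,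
      hs.reg8, RExp.eval_hsub, RExp.eval_hmul, RExp.eval_rarr, RExp.eval_rreg,
      Function.update_self, true_and, ne_eq, not_false_eq_true, Function.update_of_ne,
      Nat.reduceEqDiff, sq]
    split_ifs with h
    · rw [h]
    · rfl
  · simp [upper_eval, hc, hR, hj, hs.reg3, hs.reg8, drift, sq]

end RealRAM

namespace RealRAM

open Finset Derandomize

variable {ω : Tape}

/-- A row `S` of the table of subset sums. -/
def tableRow (D : ℕ) (s : State) (S i : ℕ) : ℝ := s.rarr 8 (S * D + i)

theorem row_inj {D i i' S S' : ℕ} (hi : i < D) (hi' : i' < D) (h : S * D + i = S' * D + i') :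
    S = S' ∧ i = i' := by
  have := cell_inj (R := S) (R' := S') hi hi' (by rw [mul_comm D, mul_comm D]; omega)
  exact this.symm

theorem applyProg_spec {D M E j : ℕ} {e : ℝ} {s : State} (h3 : s.nreg 3 = D)
    (h7 : s.nreg 7 = E) (h8 : s.nreg 8 = M) (h13 : s.nreg 13 = j) (hj : j + 1 < D)
    (h5 : s.rreg 5 = e) :
    Good ω applyProg s (M * 47 + E * 47 + 10) fun s' =>
      (∀ q, s'.rarr 4 q = if q < M then s.rarr 4 q + e * s.rarr 4 (q + M * (j + 1))
        else s.rarr 4 q) ∧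
      (∀ S < E, ∀ i < D, tableRow D s' S i = tableRow D s S i) ∧
      ∀ S < E, ∀ i < D, tableRow D s' (S + E) i =
        if i = j + 1 then tableRow D s S i + e else tableRow D s (S + E) i := by
  refine Good.seq' (M * 47 + 5) (Good.forLoop (c := 40) (fun m s' =>
    ∀ q, s'.rarr 4 q = if q < m then s.rarr 4 q + e * s.rarr 4 (q + M * (j + 1))
        else s.rarr 4 q) h8 (by decide) rfl rfl ?_ ?_ ?_) (by omega) ?_
  · exact fun i s v h => h
  · simp
  · intro m hm s₁ ha hr h
    have e8 : s₁.nreg 8 = M := (ha.n 8 rfl).trans h8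
    have e13 : s₁.nreg 13 = j := (ha.n 13 rfl).trans h13
    have e5 : s₁.rreg 5 = e := (ha.r 5 rfl).trans h5
    refine (Good.storeR ?_).of_cost (by decide)
    intro q
    have hM : M ≤ M * (j + 1) := Nat.le_mul_of_pos_right _ (by omega)
    simp only [updCell_apply, NExp.eval_nreg, RExp.eval_hadd, RExp.eval_hmul, RExp.eval_rarr,
      RExp.eval_rreg, upper_eval, e8, e13, e5, hr, true_and]
    by_cases hq : q = m
    · subst hq
      rw [if_pos rfl, if_pos (by omega), h q, h (q + M * (j + 1)), if_neg (by omega),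
        if_neg (by omega)]
    · rw [if_neg hq, h q]
      by_cases hq' : q < m
      · rw [if_pos hq', if_pos (by omega)]
      · rw [if_neg hq', if_neg (by omega)]
  · intro s₁ ha h
    have e8 : s₁.rarr 8 = s.rarr 8 := ha.ra 8 rfl
    refine (Good.forLoop (c := 40) (N := E) (fun m s' =>
      s'.rarr 4 = s₁.rarr 4 ∧
      (∀ S < E, ∀ i < D, tableRow D s' S i = tableRow D s S i) ∧
      ∀ S < E, ∀ i < D, tableRow D s' (S + E) i =
        if i = j + 1 ∧ S < m then tableRow D s S i + e else tableRow D s (S + E) i)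
      ((ha.n 7 rfl).trans h7) (by decide) rfl rfl ?_ ?_ ?_).mono (by omega) ?_
    · exact fun i s v h => h
    · simp [tableRow, e8]
    · rintro m hm s₂ ha₂ hr₂ ⟨i4, iA, iB⟩
      have e3 : s₂.nreg 3 = D := (ha₂.n 3 rfl).trans ((ha.n 3 rfl).trans h3)
      have e7 : s₂.nreg 7 = E := (ha₂.n 7 rfl).trans ((ha.n 7 rfl).trans h7)
      have e13 : s₂.nreg 13 = j := (ha₂.n 13 rfl).trans ((ha.n 13 rfl).trans h13)
      have e5 : s₂.rreg 5 = e := (ha₂.r 5 rfl).trans ((ha.r 5 rfl).trans h5)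
      refine (Good.storeR ?_).of_cost (by decide)
      have hold : s₂.rarr 8 (m * D + (j + 1)) = tableRow D s m (j + 1) := iA m hm _ hj
      simp only [tableRow, updCell_apply, NExp.eval_nreg, NExp.eval_hadd, NExp.eval_hmul,
        NExp.eval_one, RExp.eval_hadd, RExp.eval_rarr, RExp.eval_rreg, e3, e7, e13, e5, hr₂,
        true_and, hold]
      refine ⟨?_, fun S hS i hi => ?_, fun S hS i hi => ?_⟩
      · rw [← i4]
        funext q
        simp
      · rw [if_neg fun h' => ?_]
        · exact iA S hS i hi
        · have := (row_inj hi hj h').1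
          omega
      · have := iB S hS i hi
        simp only [tableRow] at this hold
        by_cases h' : (S + E) * D + i = (m + E) * D + (j + 1)
        · obtain ⟨hS', rfl⟩ := row_inj hi hj h'
          obtain rfl : S = m := by omega
          simp
        · rw [if_neg h', this]
          by_cases hi' : i = j + 1
          · subst hi'
            have hSm : S ≠ m := fun h => h' (by rw [h])
            have : S < m ↔ S < m + 1 := by omega
            simp [this]
          · simp [hi']
    · rintro s₂ - ⟨i4, iA, iB⟩
      refine ⟨fun q => by rw [i4, h q], iA, fun S hS i hi => ?_⟩
      rw [iB S hS i hi]
      simp [hS]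

theorem doubleProg_spec {D E : ℕ} {s : State} (hD : 0 < D) (h3 : s.nreg 3 = D)
    (h7 : s.nreg 7 = E) :
    Good ω doubleProg s (E * 47 + 10) fun s' => s'.nreg 7 = 2 * E ∧
      (∀ S < E, ∀ i < D, tableRow D s' S i = tableRow D s S i) ∧
      ∀ S < E, ∀ i < D, tableRow D s' (S + E) i =
        if i = 0 then tableRow D s S i + 1 else tableRow D s (S + E) i := by
  refine Good.seq' (E * 47 + 5) (Good.forLoop (c := 40) (N := E) (fun m s' =>
      (∀ S < E, ∀ i < D, tableRow D s' S i = tableRow D s S i) ∧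
      ∀ S < E, ∀ i < D, tableRow D s' (S + E) i =
        if i = 0 ∧ S < m then tableRow D s S i + 1 else tableRow D s (S + E) i)
      h7 (by decide) rfl rfl ?_ ?_ ?_) (by omega) ?_
  · exact fun i s v h => h
  · simp
  · rintro m hm s₂ ha₂ hr₂ ⟨iA, iB⟩
    have e3 : s₂.nreg 3 = D := (ha₂.n 3 rfl).trans h3
    have e7 : s₂.nreg 7 = E := (ha₂.n 7 rfl).trans h7
    refine (Good.storeR ?_).of_cost (by decide)
    have hold : s₂.rarr 8 (m * D) = tableRow D s m 0 := by
      simpa [tableRow] using iA m hm 0 hD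
    simp only [tableRow, updCell_apply, NExp.eval_nreg, NExp.eval_hadd, NExp.eval_hmul,
      RExp.eval_one, RExp.eval_hadd, RExp.eval_rarr, e3, e7, hr₂, true_and, hold]
    refine ⟨fun S hS i hi => ?_, fun S hS i hi => ?_⟩
    · rw [if_neg fun h' => ?_]
      · exact iA S hS i hi
      · have := (row_inj hi hD (h'.trans (add_zero _).symm)).1
        omega
    · have := iB S hS i hi
      simp only [tableRow] at this
      by_cases h' : (S + E) * D + i = (m + E) * D
      · obtain ⟨hS', rfl⟩ := row_inj hi hD (h'.trans (add_zero _).symm)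
        obtain rfl : S = m := by omega
        simp
      · rw [if_neg h', this]
        by_cases hi' : i = 0
        · subst hi'
          have hSm : S ≠ m := fun h => h' (by rw [h, add_zero])
          have : S < m ↔ S < m + 1 := by omega
          simp [this]
        · simp [hi']
  · rintro s₁ ha ⟨iA, iB⟩
    refine (Good.setN ?_).of_cost ?_
    · refine ⟨?_, iA, fun S hS i hi => ?_⟩
      · have e7 : s₁.nreg 7 = E := (ha.n 7 rfl).trans h7
        simp [e7, two_mul]
      · refine (iB S hS i hi).trans ?_
        simp [hS]
    · have : (NExp.reg 7 + .reg 7).cost + 1 ≤ 5 := by decide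
      omega

/-- The coordinates of a sign vector with dummy coordinate `1`. -/
def extend (ε : ℕ → ℝ) (i : ℕ) : ℝ := if i = 0 then 1 else ε (i - 1)

/-- The contraction of the top digit of `T` with the first `j` signs. -/
def contract (T : ℕ → ℝ) (M : ℕ) (ε : ℕ → ℝ) (j q : ℕ) : ℝ :=
  T q + ∑ i ∈ range j, ε i * T (q + M * (i + 1))

theorem contract_congr {T : ℕ → ℝ} {M j q : ℕ} {ε ε' : ℕ → ℝ} (h : ∀ i < j, ε i = ε' i) :
    contract T M ε j q = contract T M ε' j q := by
  unfold contract
  congr 1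
  exact sum_congr rfl fun i hi => by rw [h i (by simpa using hi)]

/-- The loop over the signs, for any way `p` of choosing them. -/
theorem signLoop_spec {N M E cp : ℕ} {s : State} {p : Prog} (h3 : s.nreg 3 = N + 1)
    (h6 : s.nreg 6 = N) (h7 : s.nreg 7 = E) (h8 : s.nreg 8 = M)
    (hp : (∀ r ∈ [3, 6, 7, 8, 13], p.wN r = false) ∧ ∀ a ∈ [4, 8], p.wRA a = false)
    (Cond : ℕ → (ℕ → ℝ) → ℝ → Prop) (aux : ℕ → State → Prop)
    (hCond : ∀ j ε ε' e, (∀ i < j, ε i = ε' i) → Cond j ε e → Cond j ε' e)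
    (haux : ∀ j s s', s'.rarr 5 = s.rarr 5 → s'.rarr 6 = s.rarr 6 → s'.rarr 7 = s.rarr 7 →
      aux j s → aux j s')
    (hs : aux 0 s)
    (hstep : ∀ j < N, ∀ s' ε, Agree (forR 13 6 (.seq p applyProg)) s s' → s'.nreg 13 = j →
      (∀ q < M, s'.rarr 4 q = contract (s.rarr 4) M ε j q) →
      (∀ q, M ≤ q → s'.rarr 4 q = s.rarr 4 q) → aux j s' →
      Good ω p s' cp fun s'' => (s''.rreg 5 = 1 ∨ s''.rreg 5 = -1) ∧ Cond j ε (s''.rreg 5) ∧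
        aux (j + 1) s'') :
    Good ω (.seq (forR 13 6 (.seq p applyProg)) doubleProg) s
      (N * (cp + M * 47 + E * 47 + 17) + E * 47 + 15) fun s' =>
      s'.nreg 7 = 2 * E ∧ ∃ ε : ℕ → ℝ, (∀ j < N, (ε j = 1 ∨ ε j = -1) ∧ Cond j ε (ε j)) ∧
        (∀ q < M, s'.rarr 4 q = contract (s.rarr 4) M ε N q) ∧
        ∀ S < E, ∀ i < N + 1, tableRow (N + 1) s' S i = tableRow (N + 1) s S i ∧
          tableRow (N + 1) s' (S + E) i = tableRow (N + 1) s S i + extend ε i := by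
  have hw : ∀ r ∈ [3, 6, 7, 8], (forR 13 6 (.seq p applyProg)).wN r = false := by
    intro r hr
    have := hp.1 r (by simp at hr ⊢; tauto)
    simp at hr
    rcases hr with rfl | rfl | rfl | rfl <;> simp [forR, Prog.wN, this, applyProg]
  refine Good.seq' (N * ((cp + (M * 47 + E * 47 + 10)) + 7) + 5) (Good.forLoop (fun j s' =>
    ∃ ε : ℕ → ℝ, (∀ i < j, (ε i = 1 ∨ ε i = -1) ∧ Cond i ε (ε i)) ∧
        (∀ q < M, s'.rarr 4 q = contract (s.rarr 4) M ε j q) ∧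
        (∀ q, M ≤ q → s'.rarr 4 q = s.rarr 4 q) ∧ aux j s' ∧
        ∀ S < E, ∀ i < N + 1, tableRow (N + 1) s' S i = tableRow (N + 1) s S i ∧
          (i ≠ 0 → i ≤ j → tableRow (N + 1) s' (S + E) i = tableRow (N + 1) s S i + ε (i - 1)))
    h6 (by decide) ?_ ?_ ?_ ?_ ?_) ?_ ?_
  · simp [Prog.wN, hp.1 13 (by simp), applyProg, forR]
  · simp [Prog.wN, hp.1 6 (by simp), applyProg, forR]
  · rintro j s' v ⟨ε, h1, h2, h3, h4, h5⟩
    exact ⟨ε, h1, h2, h3, haux j s' _ rfl rfl rfl h4, h5⟩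
  · refine ⟨fun _ => 1, by simp, by simp [contract], fun _ _ => rfl, hs, fun S hS i hi =>
      ⟨rfl, fun h h' => absurd h' (by omega)⟩⟩
  · rintro j hj s₁ ha hr ⟨ε, i1, i2, i3, i4, i5⟩
    refine Good.seq (hstep j hj s₁ ε ha hr i2 i3 i4) ?_
    rintro s₂ ha₂ ⟨k1, k2, k3⟩
    have g3 := (ha₂.n 3 (hp.1 3 (by simp))).trans ((ha.n 3 (hw 3 (by simp))).trans h3)
    have g7 := (ha₂.n 7 (hp.1 7 (by simp))).trans ((ha.n 7 (hw 7 (by simp))).trans h7)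
    have g8 := (ha₂.n 8 (hp.1 8 (by simp))).trans ((ha.n 8 (hw 8 (by simp))).trans h8)
    have g13 := (ha₂.n 13 (hp.1 13 (by simp))).trans hr
    have r4 := ha₂.ra 4 (hp.2 4 (by simp))
    have r8 := ha₂.ra 8 (hp.2 8 (by simp))
    refine (applyProg_spec g3 g7 g8 g13 (by omega) rfl).mono le_rfl ?_
    rintro s₃ ha₃ ⟨l1, l2, l3⟩
    have hupd : ∀ i < j, ε i = Function.update ε j (s₂.rreg 5) i := fun i hi =>
      (Function.update_of_ne hi.ne _ _).symm
    refine ⟨Function.update ε j (s₂.rreg 5), fun i hi => ?_, fun q hq => ?_, fun q hq => ?_, ?_,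
      fun S hS i hi => ⟨?_, fun h0 hij => ?_⟩⟩
    · rcases Nat.lt_succ_iff_lt_or_eq.1 hi with hi | rfl
      · rw [← hupd i hi]
        exact ⟨(i1 i hi).1, hCond i _ _ _ (fun i' hi' => hupd i' (by omega)) (i1 i hi).2⟩
      · rw [Function.update_self]
        exact ⟨k1, hCond i _ _ _ hupd k2⟩
    · rw [l1, if_pos hq, r4, i2 q hq, i3 _ (by nlinarith), contract_congr hupd, contract, contract,
        sum_range_succ, Function.update_self, add_assoc]
    · rw [l1, if_neg (by omega), r4, i3 q hq]
    · exact haux _ s₂ _ (ha₃.ra 5 rfl) (ha₃.ra 6 rfl) (ha₃.ra 7 rfl) k3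
    · rw [l2 S hS i hi, ← (i5 S hS i hi).1, tableRow, tableRow, r8]
    · rw [l3 S hS i hi]
      simp only [tableRow, r8] at i5 ⊢
      split_ifs with h'
      · subst h'
        simp [(i5 S hS (j + 1) hi).1]
      · rw [(i5 S hS i hi).2 h0 (by omega), ← hupd _ (by omega)]
  · have : N * (cp + (M * 47 + E * 47 + 10) + 7) = N * (cp + M * 47 + E * 47 + 17) := by ring
    omega
  · rintro s₁ ha ⟨ε, i1, i2, i3, i4, i5⟩
    have g3 := (ha.n 3 (hw 3 (by simp))).trans h3
    have g7 := (ha.n 7 (hw 7 (by simp))).trans h7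
    refine (doubleProg_spec (by omega) g3 g7).mono ?_ ?_
    · have : N * (cp + (M * 47 + E * 47 + 10) + 7) = N * (cp + M * 47 + E * 47 + 17) := by ring
      omega
    · rintro s₂ ha₂ ⟨l1, l2, l3⟩
      refine ⟨l1, ε, i1, fun q hq => by rw [ha₂.ra 4 rfl, i2 q hq], fun S hS i hi => ⟨?_, ?_⟩⟩
      · rw [l2 S hS i hi, (i5 S hS i hi).1]
      · rw [l3 S hS i hi]
        by_cases h0 : i = 0
        · simp [h0, extend, (i5 S hS 0 (by omega)).1]
        · rw [if_neg h0, extend, if_neg h0]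
          exact (i5 S hS i hi).2 h0 (by omega)

end RealRAM

namespace RealRAM

open Finset Derandomize

variable {ω : Tape}

/-- The arrays `5, 6, 7` hold the remaining variances, the second moments and the block norms. -/
def Moments (N M M' : ℕ) (T : ℕ → ℝ) (j : ℕ) (s : State) : Prop :=
  (∀ c < N + 1, ∀ R < M', s.rarr 5 (c + (N + 1) * R) = remVar N (cells T (N + 1) M) j c R) ∧
  (∀ c < N + 1, ∀ R < M', s.rarr 6 (c + (N + 1) * R) = cellSq N (cells T (N + 1) M) c R) ∧
  ∀ c < N + 1, s.rarr 7 c = blockNorm N (range M') (cells T (N + 1) M) c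

theorem cell_lt {N M' c R : ℕ} (hc : c < N + 1) (hR : R < M') :
    c + (N + 1) * R < (N + 1) * M' := by
  have : (N + 1) * (R + 1) ≤ (N + 1) * M' := Nat.mul_le_mul_left _ hR
  linarith

theorem partialSum_cells {N M : ℕ} (T : ℕ → ℝ) (ε : ℕ → ℝ) (j c R : ℕ) :
    partialSum (cells T (N + 1) M) ε j c R = contract T M ε j (c + (N + 1) * R) := by
  simp [partialSum, cells, contract]

theorem signProg_spec {N M M' : ℕ} {s : State} (hs : Shape N M M' s) (hM : M = (N + 1) * M')
    {T : ℕ → ℝ} {j : ℕ} (hj : j < N) (h13 : s.nreg 13 = j) {ε : ℕ → ℝ}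
    (hlo : ∀ q < M, s.rarr 4 q = contract T M ε j q) (hhi : ∀ q, M ≤ q → s.rarr 4 q = T q)
    (hmom : Moments N M M' T j s) :
    Good ω signProg s ((N + 1) * (M' * 307 + 12) + 200) fun s' =>
      (s'.rreg 5 = 1 ∨ s'.rreg 5 = -1) ∧
      0 ≤ s'.rreg 5 * totalDrift N (range (N + 1)) (range M') (cells T (N + 1) M) ε j ∧
      Moments N M M' T (j + 1) s' := by
  set A := cells T (N + 1) M with hA
  let term : ℕ → ℕ → ℝ := fun c R =>
    drift (partialSum A ε j c R) (A (j + 1) c R) (remVar N A (j + 1) c R)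
      (cellSq N A c R) / blockNorm N (range M') A c
  refine Good.setR_seq ?_
  refine Good.seq' ((N + 1) * (M' * 307 + 12) + 5) (Q₁ := fun s' =>
    s'.rreg 2 = totalDrift N (range (N + 1)) (range M') A ε j ∧
      Moments N M M' T (j + 1) s') ?_ (by omega) ?_
  · refine Good.mono (Good.forLoop (c := M' * 307 + 5) (fun i s' =>
      s'.rreg 2 = ∑ c ∈ range i, ∑ R ∈ range M', term c R ∧
      ∀ c < N + 1, ∀ R < M', s'.rarr 5 (c + (N + 1) * R) =
        if c < i then remVar N A (j + 1) c R else remVar N A j c R) hs.reg3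
      (by decide) rfl rfl ?_ ?_ ?_) le_rfl ?_
    · exact fun i s v h => h
    · simpa using hmom.1
    · rintro c hc s₁ ha hr ⟨i2, i5⟩
      have hs₁ : Shape N M M' s₁ := by
        refine Shape.agree ?_ ha (by decide)
        exact ⟨hs.reg3, hs.reg6, hs.reg8, hs.reg9⟩
      refine Good.mono (Good.forLoop (c := 300) (fun i s' =>
        s'.rreg 2 = ∑ c ∈ range c, ∑ R ∈ range M', term c R + ∑ R ∈ range i, term c R ∧
        ∀ c' < N + 1, ∀ R < M', s'.rarr 5 (c' + (N + 1) * R) =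
          if c' < c ∨ (c' = c ∧ R < i) then remVar N A (j + 1) c' R else remVar N A j c' R)
        hs₁.reg9 (by decide) rfl rfl ?_ ?_ ?_) le_rfl ?_
      · exact fun i s v h => h
      · exact ⟨by simp [i2], fun c' hc' R hR => by simp [i5 c' hc' R hR]⟩
      · rintro R hR s₂ ha₂ hr₂ ⟨k2, k5⟩
        have hs₂ : Shape N M M' s₂ := hs₁.agree ha₂ (by decide)
        have e4 : s₂.rarr 4 = s.rarr 4 := (ha₂.ra 4 rfl).trans (ha.ra 4 rfl)
        have e6 : s₂.rarr 6 = s.rarr 6 := (ha₂.ra 6 rfl).trans (ha.ra 6 rfl)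
        have e7 : s₂.rarr 7 = s.rarr 7 := (ha₂.ra 7 rfl).trans (ha.ra 7 rfl)
        have e11 : s₂.nreg 11 = c := (ha₂.n 11 rfl).trans hr
        have e13 : s₂.nreg 13 = j := (ha₂.n 13 rfl).trans ((ha.n 13 rfl).trans h13)
        have v4 : s₂.rarr 4 (c + (N + 1) * R) = partialSum A ε j c R := by
          rw [e4, partialSum_cells, hlo _ (hM ▸ cell_lt hc hR)]
        have v4' : s₂.rarr 4 (c + (N + 1) * R + M * (j + 1)) = A (j + 1) c R := by
          rw [e4, hhi _ (by nlinarith)]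
          rfl
        have v5 : s₂.rarr 5 (c + (N + 1) * R) - A (j + 1) c R ^ 2 = remVar N A (j + 1) c R := by
          rw [k5 c hc R hR, if_neg (by omega), remVar_succ N A hj]
          ring
        refine (driftCellProg_spec hs₂ e11 hr₂ e13).mono le_rfl ?_
        rintro s₃ - ⟨l5, l2⟩
        rw [v4, v4', v5, e6, e7, hmom.2.1 c hc R hR, hmom.2.2 c hc, k2] at l2
        refine ⟨by rw [l2, sum_range_succ]; ring, fun c' hc' R' hR' => ?_⟩
        rw [l5]
        by_cases h : c' + (N + 1) * R' = c + (N + 1) * R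
        · obtain ⟨rfl, rfl⟩ := cell_inj hc' hc h
          rw [if_pos rfl, if_pos (by omega), v4', v5]
        · rw [if_neg h, k5 c' hc' R' hR']
          have : ¬ (c' = c ∧ R' = R) := fun h' => h (by rw [h'.1, h'.2])
          congr 1
          apply propext
          omega
      · rintro s₂ - ⟨k2, k5⟩
        refine ⟨by rw [k2, sum_range_succ], fun c' hc' R hR => ?_⟩
        rw [k5 c' hc' R hR]
        congr 1
        apply propext
        omega
    · rintro s₁ ha ⟨i2, i5⟩
      refine ⟨i2, fun c hc R hR => ?_, ?_, ?_⟩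
      · rw [i5 c hc R hR, if_pos hc]
      · rw [ha.ra 6 rfl]
        exact hmom.2.1
      · rw [ha.ra 7 rfl]
        exact hmom.2.2
  · rintro s₁ - ⟨i2, hm⟩
    refine Good.of_cost (c := 40) ((Good.ite (c := 10) (c' := 10) ?_ ?_).of_cost (by decide))
      (by omega)
    · intro hb
      have hb : s₁.rreg 2 < 0 := by simpa [Test.Holds] using hb
      refine (Good.setR ?_).of_cost (by decide)
      refine ⟨by simp, ?_, hm⟩
      simp only [RExp.eval_hsub, RExp.eval_zero, RExp.eval_one, Function.update_self]
      linarith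
    · intro hb
      have hb : 0 ≤ s₁.rreg 2 := by simpa [Test.Holds] using hb
      refine (Good.setR ?_).of_cost (by decide)
      refine ⟨by simp, ?_, hm⟩
      simp only [RExp.eval_one, Function.update_self]
      linarith

/-- The mixed norm of the tensor `T` with `m` cells per block. -/
noncomputable def mixedNorm (D : ℕ) (T : ℕ → ℝ) (m : ℕ) : ℝ :=
  ∑ c ∈ range D, √(∑ R ∈ range m, T (c + D * R) ^ 2)

theorem sum_range_mul' (f : ℕ → ℝ) (m D : ℕ) :
    ∑ R ∈ range (m * D), f R = ∑ R ∈ range m, ∑ j ∈ range D, f (R + m * j) := by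
  rw [sum_comm]
  induction D with
  | zero => simp
  | succ D ih => rw [mul_add_one, sum_range_add, ih, sum_range_succ]; simp [add_comm]

theorem sum_blockNorm_cells {N M M' : ℕ} (hM : M = (N + 1) * M') (T : ℕ → ℝ) :
    ∑ c ∈ range (N + 1), blockNorm N (range M') (cells T (N + 1) M) c =
      mixedNorm (N + 1) T M := by
  refine sum_congr rfl fun c _ => ?_
  rw [blockNorm]
  congr 1
  have : M = M' * (N + 1) := by rw [hM, mul_comm]
  conv_rhs => rw [this, sum_range_mul']
  refine sum_congr rfl fun R _ => ?_
  rw [cellSq, remVar, sum_range_succ', add_comm, Nat.Ico_zero_eq_range]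
  simp only [cells, hM]
  congr 1
  refine sum_congr rfl fun j _ => ?_
  congr 2
  ring

theorem stageProg_spec {n k l E : ℕ} {s : State} (hs : Setup n k s) (hl : l + 1 < k)
    (h10 : s.nreg 10 = l) (h7 : s.nreg 7 = E) :
    Good ω stageProg s
      (2000 * (3 * n + 1) ^ k + 100 * E * (3 * n + 1)) fun s' =>
      s'.nreg 7 = 2 * E ∧ ∃ ε : ℕ → ℝ, (∀ j < 3 * n, ε j = 1 ∨ ε j = -1) ∧
        9 * mixedNorm (3 * n + 1) (s.rarr 4) ((3 * n + 1) ^ (k - 1 - l)) ≤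
          16 * mixedNorm (3 * n + 1) (s'.rarr 4) ((3 * n + 1) ^ (k - 1 - l - 1)) ∧
        (∀ q < (3 * n + 1) ^ (k - 1 - l), s'.rarr 4 q =
          contract (s.rarr 4) ((3 * n + 1) ^ (k - 1 - l)) ε (3 * n) q) ∧
        ∀ S < E, ∀ i < 3 * n + 1, tableRow (3 * n + 1) s' S i = tableRow (3 * n + 1) s S i ∧
          tableRow (3 * n + 1) s' (S + E) i = tableRow (3 * n + 1) s S i + extend ε i := by
  have hX : 1 ≤ (3 * n + 1) ^ k := Nat.one_le_pow _ _ (by omega)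
  set M := (3 * n + 1) ^ (k - 1 - l) with hMdef
  set M' := (3 * n + 1) ^ (k - 1 - l - 1) with hM'def
  have hM : M = (3 * n + 1) * M' := by
    rw [hMdef, hM'def, ← pow_succ', Nat.sub_add_cancel (by omega)]
  have hM1 : 1 ≤ M' := Nat.one_le_pow _ _ (by omega)
  have hMX : (3 * n + 1) * M ≤ (3 * n + 1) ^ k := by
    rw [hMdef, ← pow_succ']
    exact Nat.pow_le_pow_right (by omega) (by omega)
  have e8 : s.narr 4 (k - 1 - l) = M := by rw [hs.pow _ (by omega)]
  have e9 : s.narr 4 (k - 1 - l - 1) = M' := by rw [hs.pow _ (by omega)]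
  have g16 := hs.reg16
  have g3' := hs.reg3
  have g6' := hs.reg6
  clear_value M M'
  clear hMdef hM'def hs
  generalize (3 * n + 1) ^ k = X at *
  have c0 : (3 * n + 1) * (M' * (3 * n * 67 + 612) + 200) ≤ 900 * X := by
    have : (3 * n + 1) * (M' * (3 * n * 67 + 612) + 200) ≤ 900 * ((3 * n + 1) * M) := by
      rw [hM]; nlinarith
    omega
  have c1 : 3 * n * ((3 * n + 1) * (M' * 307 + 12) + 200 + M * 47 + E * 47 + 17) ≤
      600 * X + 47 * E * (3 * n) := by
    have : 3 * n * ((3 * n + 1) * (M' * 307 + 12) + 200 + M * 47 + 17) ≤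
        600 * ((3 * n + 1) * M) := by
      rw [hM]
      have h1 : 3 * n * ((3 * n + 1) * (M' * 307 + 12) + 200 + (3 * n + 1) * M' * 47 + 17) ≤
        (3 * n + 1) * ((3 * n + 1) * (M' * 307 + 12) + 200 + (3 * n + 1) * M' * 47 + 17) :=
        Nat.mul_le_mul_right _ (by omega)
      refine h1.trans ?_
      have h2 : (3 * n + 1) * (M' * 307 + 12) + 200 + (3 * n + 1) * M' * 47 + 17 ≤
          600 * ((3 * n + 1) * M') := by nlinarith
      nlinarith
    nlinarith
  have c2 : 100 * E * (3 * n + 1) = 100 * (E * (3 * n)) + 100 * E := by ring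
  have c3 : 47 * E * (3 * n) = 47 * (E * (3 * n)) := by ring
  refine Good.setN_seq ?_
  refine Good.setN_seq ?_
  refine Good.seq' ((3 * n + 1) * (M' * (3 * n * 67 + 612) + 200) + 5)
    (prepProg_spec (M := M) (M' := M') ?_)
    (Nat.le_sub_of_add_le (Nat.le_sub_of_add_le (by nlinarith))) ?_
  · constructor <;> simp [g3', g6', g16, h10, e8, e9]
  · rintro s₁ ha ⟨i5, i6, i7⟩
    have g3 : s₁.nreg 3 = 3 * n + 1 := (ha.n 3 rfl).trans (by simp [g3'])
    have g6 : s₁.nreg 6 = 3 * n := (ha.n 6 rfl).trans (by simp [g6'])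
    have g7 : s₁.nreg 7 = E := (ha.n 7 rfl).trans (by simp [h7])
    have g8 : s₁.nreg 8 = M := (ha.n 8 rfl).trans (by simp [g16, h10, e8])
    have g9 : s₁.nreg 9 = M' := (ha.n 9 rfl).trans (by simp [g16, h10, e9])
    have hsh : Shape (3 * n) M M' s₁ := ⟨g3, g6, g8, g9⟩
    have r4 : s₁.rarr 4 = s.rarr 4 := ha.ra 4 rfl
    have r8 : s₁.rarr 8 = s.rarr 8 := ha.ra 8 rfl
    refine (signLoop_spec (cp := (3 * n + 1) * (M' * 307 + 12) + 200) g3 g6 g7 g8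
      ⟨by decide, by decide⟩
      (fun j ε e => 0 ≤ e * totalDrift (3 * n) (range (3 * n + 1)) (range M')
        (cells (s.rarr 4) (3 * n + 1) M) ε j)
      (Moments (3 * n) M M' (s.rarr 4)) ?_ ?_ ⟨i5, i6, i7⟩ ?_).mono ?_ ?_
    · intro j ε ε' e h
      have : totalDrift (3 * n) (range (3 * n + 1)) (range M')
          (cells (s.rarr 4) (3 * n + 1) M) ε j = totalDrift (3 * n) (range (3 * n + 1)) (range M')
          (cells (s.rarr 4) (3 * n + 1) M) ε' j := by
        simp only [totalDrift, partialSum_cells, contract_congr h]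
      rw [this]
      exact id
    · rintro j s s' h5 h6 h7 ⟨m5, m6, m7⟩
      exact ⟨by rw [h5]; exact m5, by rw [h6]; exact m6, by rw [h7]; exact m7⟩
    · intro j hj s₂ ε ha₂ hr₂ hlo hhi hmom
      rw [r4] at hlo hhi
      exact signProg_spec (hsh.agree ha₂ (by decide)) hM hj hr₂ hlo hhi hmom
    · refine Nat.le_sub_of_add_le (Nat.le_sub_of_add_le (Nat.le_sub_of_add_le ?_))
      nlinarith
    · rintro s₂ - ⟨j7, ε, j1, j4, j8⟩
      rw [r4] at j4
      refine ⟨j7, ε, fun j hj => (j1 j hj).1, ?_, j4, ?_⟩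
      · have := sum_blockNorm_le (3 * n) (range (3 * n + 1)) (range M')
          (cells (s.rarr 4) (3 * n + 1) M) ε j1
        rw [sum_blockNorm_cells hM] at this
        refine this.trans_eq ?_
        congr 1
        refine sum_congr rfl fun c hc => ?_
        congr 1
        refine sum_congr rfl fun R hR => ?_
        rw [partialSum_cells, j4 _ (hM ▸ cell_lt (by simpa using hc) (by simpa using hR))]
      · intro S hS i hi
        simpa only [tableRow, r8] using j8 S hS i hi

theorem lastStageProg_spec {n k E : ℕ} {s : State} (hs : Setup n k s) (h7 : s.nreg 7 = E) :
    Good ω lastStageProg s (400 * (3 * n + 1) + 100 * E * (3 * n + 1)) fun s' =>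
      s'.nreg 7 = 2 * E ∧ ∃ ε : ℕ → ℝ, (∀ j < 3 * n, ε j = 1 ∨ ε j = -1) ∧
        mixedNorm (3 * n + 1) (s.rarr 4) 1 = |s'.rarr 4 0| ∧
        s'.rarr 4 0 = contract (s.rarr 4) 1 ε (3 * n) 0 ∧
        ∀ S < E, ∀ i < 3 * n + 1, tableRow (3 * n + 1) s' S i = tableRow (3 * n + 1) s S i ∧
          tableRow (3 * n + 1) s' (S + E) i = tableRow (3 * n + 1) s S i + extend ε i := by
  have c2 : 100 * E * (3 * n + 1) = 100 * (E * (3 * n)) + 100 * E := by ring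
  refine Good.setN_seq ?_
  refine (signLoop_spec (E := E) (M := 1) (cp := 100) (N := 3 * n) ?_ ?_ ?_ ?_
      ⟨by decide, by decide⟩
      (fun j ε e => 0 ≤ e * (contract (s.rarr 4) 1 ε j 0 * s.rarr 4 (j + 1)))
      (fun _ _ => True) ?_ ?_ trivial ?_).mono ?_ ?_
  · simp [hs.reg3]
  · simp [hs.reg6]
  · simp [h7]
  · simp
  · intro j ε ε' e h
    rw [contract_congr h]
    exact id
  · exact fun _ _ _ _ _ _ _ => trivial
  · intro j hj s₁ ε ha hr hlo hhi _
    have v0 := hlo 0 one_pos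
    have v1 := hhi (j + 1) (by omega)
    refine (Good.ite (c := 10) (c' := 10) ?_ ?_).of_cost (by decide)
    · intro hb
      have hb : s₁.rarr 4 0 * s₁.rarr 4 (j + 1) < 0 := by simpa [Test.Holds, hr] using hb
      refine (Good.setR ?_).of_cost (by decide)
      simp only at v0 v1
      rw [v0, v1] at hb
      refine ⟨by simp, ?_, trivial⟩
      simp only [RExp.eval_hsub, RExp.eval_zero, RExp.eval_one, Function.update_self]
      linarith
    · intro hb
      have hb : 0 ≤ s₁.rarr 4 0 * s₁.rarr 4 (j + 1) := by simpa [Test.Holds, hr] using hb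
      refine (Good.setR ?_).of_cost (by decide)
      simp only at v0 v1
      rw [v0, v1] at hb
      refine ⟨by simp, ?_, trivial⟩
      simp only [RExp.eval_one, Function.update_self]
      linarith
  · have : 3 * n * (100 + 1 * 47 + E * 47 + 17) = 164 * (3 * n) + 47 * (E * (3 * n)) := by ring
    omega
  · rintro s₁ - ⟨j7, ε, j1, j4, j8⟩
    have j4 := j4 0 one_pos
    refine ⟨j7, ε, fun j hj => (j1 j hj).1, ?_, j4, j8⟩
    rw [j4]
    simp only at j1 ⊢
    have key : ∀ j ≤ 3 * n, |contract (s.rarr 4) 1 ε j 0| =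
        ∑ c ∈ range (j + 1), |s.rarr 4 c| := by
      intro j
      induction j with
      | zero => simp [contract]
      | succ j ih =>
        intro hj
        obtain ⟨h1, h2⟩ := j1 j hj
        have e : contract (s.rarr 4) 1 ε (j + 1) 0 =
            contract (s.rarr 4) 1 ε j 0 + ε j * s.rarr 4 (j + 1) := by
          simp [contract, sum_range_succ, add_assoc]
        rw [e, sum_range_succ, ← ih (by omega), abs_add_eq_add_abs_iff _ _ |>.2 ?_, abs_mul]
        · rcases h1 with h | h <;> simp [h]
        · have h3 : 0 ≤ contract (s.rarr 4) 1 ε j 0 * (ε j * s.rarr 4 (j + 1)) := by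
            linarith
          exact mul_nonneg_iff.1 h3
    rw [key _ le_rfl, mixedNorm]
    refine sum_congr rfl fun c _ => ?_
    simp [Real.sqrt_sq_eq_abs]

end RealRAM

/-! ## Verification of the search and of the rounding -/

namespace RealRAM

open Finset

variable {ω : Tape}

/-- The gain of the candidate with mean vector `F / F 0`. -/
noncomputable def rowGain (T k : ℕ) (J : ℕ → ℕ → ℕ) (coef : ℕ → ℝ) (F : ℕ → ℝ) : ℝ :=
  ∑ t ∈ range T, coef t * ∏ l ∈ range k, (F (J t l) / F 0)

theorem gainProg_spec {k D T S : ℕ} {s : State} (h1 : s.nreg 1 = k) (h2 : s.nreg 2 = T)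
    (h3 : s.nreg 3 = D) (h10 : s.nreg 10 = S) {J : ℕ → ℕ → ℕ} {coef : ℕ → ℝ}
    (hJ : ∀ t < T, ∀ l < k, 3 * s.narr 0 (t * k + l) + s.narr 1 (t * k + l) = J t l)
    (hcoef : ∀ t < T, s.rarr 2 t = coef t) :
    Good ω gainProg s (T * (k * 67 + 200) + 65) fun s' =>
      s'.rreg 0 = rowGain T k J coef (tableRow D s S) := by
  refine Good.setR_seq ?_
  refine Good.of_cost (Good.forLoop (c := k * 67 + 193) (fun i s' => s'.rreg 0 =
    rowGain i k J coef (tableRow D s S)) h2 (by decide) rfl rfl ?_ ?_ ?_)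
    (show T * (k * 67 + 200) + 5 ≤ _ by omega)
  · exact fun i s v h => h
  · simp [rowGain]
  · rintro t ht s₁ ha hr h
    refine Good.setR_seq ?_
    refine Good.seq' (k * 67 + 5) (Good.forLoop (c := 60) (fun i s' => s'.rreg 1 =
      coef t * ∏ l ∈ range i, (tableRow D s S (J t l) / tableRow D s S 0))
      ((ha.n 1 rfl).trans h1) (by decide) rfl rfl ?_ ?_ ?_) (by omega) ?_
    · exact fun i s v h => h
    · have : s₁.rarr 2 = s.rarr 2 := ha.ra 2 rfl
      simp [hr, this, hcoef t ht]
    · rintro l hl s₂ ha₂ hr₂ h'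
      have e1 : s₂.nreg 1 = k := (ha₂.n 1 rfl).trans ((ha.n 1 rfl).trans h1)
      have e3 : s₂.nreg 3 = D := (ha₂.n 3 rfl).trans ((ha.n 3 rfl).trans h3)
      have e10 : s₂.nreg 10 = S := (ha₂.n 10 rfl).trans ((ha.n 10 rfl).trans h10)
      have e11 : s₂.nreg 11 = t := (ha₂.n 11 rfl).trans hr
      have e8 : s₂.rarr 8 = s.rarr 8 := (ha₂.ra 8 rfl).trans (ha.ra 8 rfl)
      have eJ : (slotExp (.reg 11) (.reg 12)).eval s₂ = J t l := by
        rw [slotExp_eval e1, ← hJ t ht l hl, ha₂.na 0 rfl, ha₂.na 1 rfl]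
        simp only
        rw [ha.na 0 rfl, ha.na 1 rfl]
        simp [e11, hr₂]
      refine (Good.setR ?_).of_cost (by decide)
      rw [prod_range_succ, ← mul_assoc, ← h']
      simp [eJ, e3, e8, e10, tableRow]
    · rintro s₂ ha₂ h'
      refine (Good.setR ?_).of_cost ?_
      · have e0 : s₂.rreg 0 = s₁.rreg 0 := (ha₂.r 0 rfl).trans (by simp)
        simp [h', e0, h, rowGain, sum_range_succ]
      · have : (RExp.reg 0 + .reg 1).cost + 1 ≤ 60 := by decide
        omega

theorem searchProg_spec {k D T E : ℕ} {s : State} (h1 : s.nreg 1 = k) (h2 : s.nreg 2 = T)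
    (h3 : s.nreg 3 = D) (h7 : s.nreg 7 = E) (hE : 0 < E) {J : ℕ → ℕ → ℕ} {coef : ℕ → ℝ}
    (hJ : ∀ t < T, ∀ l < k, 3 * s.narr 0 (t * k + l) + s.narr 1 (t * k + l) = J t l)
    (hcoef : ∀ t < T, s.rarr 2 t = coef t) :
    Good ω searchProg s (E * (T * (k * 67 + 200) + 272) + 125) fun s' =>
      s'.nreg 17 < E ∧ ∀ S < E, |rowGain T k J coef (tableRow D s S)| ≤
        |rowGain T k J coef (tableRow D s (s'.nreg 17))| := by
  refine Good.setN_seq ?_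
  refine Good.setR_seq ?_
  refine Good.mono (Good.forLoop (N := E) (c := T * (k * 67 + 200) + 265) (fun i s' =>
    s'.nreg 17 < E ∧ |s'.rreg 6| ≤ |rowGain T k J coef (tableRow D s (s'.nreg 17))| ∧
    ∀ S < i, |rowGain T k J coef (tableRow D s S)| ≤ |s'.rreg 6|) ?_ (by decide) rfl rfl
    ?_ ?_ ?_) (show E * (T * (k * 67 + 200) + 272) + 5 ≤ _ by omega) ?_
  · simpa using h7
  · intro i s v h
    simpa using h
  · simpa using hE
  · rintro S hS s₁ ha hr ⟨i1, i2, i3⟩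
    have e1 : s₁.nreg 1 = k := (ha.n 1 rfl).trans (by simp [h1])
    have e2 : s₁.nreg 2 = T := (ha.n 2 rfl).trans (by simp [h2])
    have e3 : s₁.nreg 3 = D := (ha.n 3 rfl).trans (by simp [h3])
    refine Good.seq' (T * (k * 67 + 200) + 65) (gainProg_spec e1 e2 e3 hr (J := J) (coef := coef)
      ?_ ?_) (by omega) ?_
    · intro t ht l hl
      rw [ha.na 0 rfl, ha.na 1 rfl]
      exact hJ t ht l hl
    · intro t ht
      rw [ha.ra 2 rfl]
      exact hcoef t ht
    · intro s₂ ha₂ hg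
      have hrow : tableRow D s₁ S = tableRow D s S := by
        funext i
        rw [tableRow, ha.ra 8 rfl, tableRow]
      rw [hrow] at hg
      have e17 : s₂.nreg 17 = s₁.nreg 17 := ha₂.n 17 rfl
      have e10 : s₂.nreg 10 = S := (ha₂.n 10 rfl).trans hr
      have e6 : s₂.rreg 6 = s₁.rreg 6 := ha₂.r 6 rfl
      refine Good.of_cost (c := 100) ((Good.ite (c := 70) (c' := 10) ?_ ?_).of_cost (by decide))
        (by omega)
      · intro hb
        have hb : |s₁.rreg 6| < |rowGain T k J coef (tableRow D s S)| := by
          rw [← hg, ← e6, ← sq_lt_sq, sq, sq]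
          simpa [Test.Holds] using hb
        refine Good.setR_seq ((Good.setN ?_).of_cost (by decide))
        simp only [NExp.eval_nreg, e10, Function.update_self, RExp.eval_rreg, hg]
        refine ⟨hS, le_rfl, fun S' hS' => ?_⟩
        rcases Nat.lt_succ_iff_lt_or_eq.1 hS' with h | rfl
        · exact (i3 S' h).trans hb.le
        · exact le_rfl
      · intro hb
        have hb : |rowGain T k J coef (tableRow D s S)| ≤ |s₁.rreg 6| := by
          rw [← not_lt, ← hg, ← e6, ← sq_lt_sq, sq, sq]
          simpa [Test.Holds] using hb
        refine (Good.nop ?_).of_cost (by decide)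
        simp only [e17, e6]
        refine ⟨i1, i2, fun S' hS' => ?_⟩
        rcases Nat.lt_succ_iff_lt_or_eq.1 hS' with h | rfl
        · exact i3 S' h
        · exact hb
  · rintro s₁ - ⟨i1, i2, i3⟩
    exact ⟨i1, fun S hS => (i3 S hS).trans i2⟩

/-- A sign with mean `m`, computed from a uniform sample `u`. -/
noncomputable def roundSign (m u : ℝ) : ℝ := if u + u < 1 + m then 1 else -1

/-- The first amplitude of the state whose Bloch vector is `(±1, ±1, e) / √3`. -/
noncomputable def firstAmp (e : ℝ) : ℝ := √((1 + e / √3) / 2)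

theorem drawProg_spec {D B i d : ℕ} {s : State} (h3 : s.nreg 3 = D) (h10 : s.nreg 10 = i)
    (h17 : s.nreg 17 = B) (hd : s.drawn = d) (c : ℕ) :
    Good ω (drawProg c) s 100 fun s' => s'.drawn = d + 1 ∧ s'.nreg = s.nreg ∧
      s'.rarr = s.rarr ∧ (∀ r, r ≠ 0 → r ≠ c → s'.rreg r = s.rreg r) ∧
      s'.rreg c = roundSign (tableRow D s B (3 * i + c) / tableRow D s B 0) (ω d) := by
  refine Good.sample_seq ?_
  have e : (NExp.const c).eval s = c := rfl
  refine Good.of_cost (Good.ite (c := 10) (c' := 10) ?_ ?_) ?_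
  · intro hb
    have hb : (ω d : ℝ) + ω d < 1 + tableRow D s B (3 * i + c) / tableRow D s B 0 := by
      simpa [Test.Holds, h3, h10, h17, hd, tableRow, NExp.eval] using hb
    refine (Good.setR ?_).of_cost (by decide)
    refine ⟨by simp [hd], rfl, rfl, fun r hr hr' => by simp [hr, hr'], ?_⟩
    simp [roundSign, hb]
  · intro hb
    have hb : ¬ ((ω d : ℝ) + ω d < 1 + tableRow D s B (3 * i + c) / tableRow D s B 0) := by
      simpa [Test.Holds, h3, h10, h17, hd, tableRow, NExp.eval] using hb
    refine (Good.setR ?_).of_cost (by decide)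
    refine ⟨by simp [hd], rfl, rfl, fun r hr hr' => by simp [hr, hr'], ?_⟩
    simp [roundSign, hb]
  · have : (Test.rlt (.reg 0 + .reg 0)
      (1 + .arr 8 (.reg 17 * .reg 3 + (3 * .reg 10 + .const c)) /
        .arr 8 (.reg 17 * .reg 3))).cost ≤ 40 := (by decide : (Test.rlt (.reg 0 + .reg 0)
      (1 + .arr 8 (.reg 17 * .reg 3 + (3 * .reg 10 + .const 0)) /
        .arr 8 (.reg 17 * .reg 3))).cost ≤ 40)
    omega

/-- The cells of the output that describe qubit `i`, for signs `e`. -/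
def QubitCells (f : ℕ → ℝ) (i : ℕ) (e : ℕ → ℝ) : Prop :=
  f (4 * i) = firstAmp (e 3) ∧ f (4 * i + 1) = 0 ∧
    f (4 * i + 2) = e 1 / (2 * √3 * firstAmp (e 3)) ∧
    f (4 * i + 3) = e 2 / (2 * √3 * firstAmp (e 3))

theorem roundProg_spec {n D B : ℕ} {s : State} (h0 : s.nreg 0 = n) (h3 : s.nreg 3 = D)
    (h17 : s.nreg 17 = B) (hd : s.drawn = 0) :
    Good ω roundProg s (n * 707 + 5) fun s' => ∀ i < n, QubitCells (s'.rarr 1) i fun c =>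
      roundSign (tableRow D s B (3 * i + c) / tableRow D s B 0) (ω (3 * i + (c - 1))) := by
  refine Good.mono (Good.forLoop (c := 700) (fun m s' => s'.drawn = 3 * m ∧
    ∀ i < m, QubitCells (s'.rarr 1) i fun c =>
      roundSign (tableRow D s B (3 * i + c) / tableRow D s B 0) (ω (3 * i + (c - 1)))) h0
      (by decide) rfl rfl ?_ ?_ ?_) le_rfl fun _ _ h => h.2
  · exact fun i s v h => h
  · simp [hd]
  · rintro i hi s₁ ha hr ⟨hd₁, hq⟩
    have e3 : s₁.nreg 3 = D := (ha.n 3 rfl).trans h3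
    have e17 : s₁.nreg 17 = B := (ha.n 17 rfl).trans h17
    have hrow : tableRow D s₁ B = tableRow D s B := by
      funext j
      rw [tableRow, ha.ra 8 rfl, tableRow]
    refine Good.seq' 100 (drawProg_spec e3 hr e17 hd₁ 1) (by decide) ?_
    rintro s₂ - ⟨d₂, n₂, a₂, -, v₂⟩
    have hrow₂ : tableRow D s₂ B = tableRow D s B := by
      rw [← hrow]; funext j; rw [tableRow, a₂, tableRow]
    refine Good.seq' 100 (drawProg_spec (by rw [n₂, e3]) (by rw [n₂, hr]) (by rw [n₂, e17]) d₂ 2)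
      (by decide) ?_
    rintro s₃ - ⟨d₃, n₃, a₃, o₃, v₃⟩
    have hrow₃ : tableRow D s₃ B = tableRow D s B := by
      rw [← hrow₂]; funext j; rw [tableRow, a₃, tableRow]
    refine Good.seq' 100 (drawProg_spec (by rw [n₃, n₂, e3]) (by rw [n₃, n₂, hr])
      (by rw [n₃, n₂, e17]) d₃ 3) (by decide) ?_
    rintro s₄ - ⟨d₄, n₄, a₄, o₄, v₄⟩
    rw [hrow] at v₂
    rw [hrow₂] at v₃
    rw [hrow₃] at v₄
    have w3 := o₄ 2 (by decide) (by decide)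
    have w2 := o₄ 1 (by decide) (by decide)
    have w2' := o₃ 1 (by decide) (by decide)
    have e10 : s₄.nreg 10 = i := by rw [n₄, n₃, n₂, hr]
    have e1 : s₄.rarr 1 = s₁.rarr 1 := by rw [a₄, a₃, a₂]
    refine Good.setR_seq ?_
    refine Good.storeR_seq ?_
    refine Good.storeR_seq ?_
    refine Good.storeR_seq ?_
    refine (Good.storeR ?_).of_cost (by decide)
    refine ⟨by simp [d₄]; ring, fun i' hi' => ?_⟩
    rcases Nat.lt_succ_iff_lt_or_eq.1 hi' with h | rfl
    · have := hq i' h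
      unfold QubitCells at this ⊢
      have l1 : 4 * i' ≠ 4 * i := by omega
      have l2 : 4 * i' ≠ 4 * i + 1 := by omega
      have l3 : 4 * i' ≠ 4 * i + 2 := by omega
      have l4 : 4 * i' ≠ 4 * i + 3 := by omega
      have l5 : 4 * i' + 1 ≠ 4 * i := by omega
      have l6 : 4 * i' + 1 ≠ 4 * i + 2 := by omega
      have l7 : 4 * i' + 1 ≠ 4 * i + 3 := by omega
      have l8 : 4 * i' + 2 ≠ 4 * i := by omega
      have l9 : 4 * i' + 2 ≠ 4 * i + 1 := by omega
      have l10 : 4 * i' + 2 ≠ 4 * i + 3 := by omega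
      have l11 : 4 * i' + 3 ≠ 4 * i := by omega
      have l12 : 4 * i' + 3 ≠ 4 * i + 1 := by omega
      have l13 : 4 * i' + 3 ≠ 4 * i + 2 := by omega
      have l14 : i' ≠ i := by omega
      simp [*]
    · simp [QubitCells, e10, v₄, w3, v₃, w2, w2', v₂, firstAmp]

end RealRAM

/-! ## The deterministic phase -/

namespace RealRAM

open Finset

variable {ω : Tape}

/-- The value of the multilinear form with tensor `T` at the vectors `y 0, …, y (m - 1)`. -/
def formValue (D m : ℕ) (T : ℕ → ℝ) (y : ℕ → ℕ → ℝ) : ℝ :=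
  ∑ q ∈ range (D ^ m), T q * ∏ p ∈ range m, y p (q / D ^ p % D)

theorem formValue_congr {D m : ℕ} {T T' : ℕ → ℝ} {y y' : ℕ → ℕ → ℝ}
    (hT : ∀ q < D ^ m, T q = T' q) (hy : ∀ p < m, y p = y' p) :
    formValue D m T y = formValue D m T' y' := by
  refine sum_congr rfl fun q hq => ?_
  rw [hT q (by simpa using hq)]
  congr 1
  exact prod_congr rfl fun p hp => by rw [hy p (by simpa using hp)]

theorem formValue_succ {D : ℕ} (hD : 0 < D) (m : ℕ) (T : ℕ → ℝ) (y : ℕ → ℕ → ℝ) :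
    formValue D (m + 1) T y =
      formValue D m (fun q => ∑ i ∈ range D, y m i * T (q + D ^ m * i)) y := by
  rw [formValue, pow_succ, sum_range_mul', formValue]
  refine sum_congr rfl fun q hq => ?_
  have hq : q < D ^ m := by simpa using hq
  rw [sum_mul]
  refine sum_congr rfl fun i hi => ?_
  have hi : i < D := by simpa using hi
  rw [prod_range_succ]
  have h1 : (q + D ^ m * i) / D ^ m % D = i := by
    rw [Nat.add_mul_div_left _ _ (by positivity), Nat.div_eq_of_lt hq, zero_add,
      Nat.mod_eq_of_lt hi]
  have h2 : ∀ p ∈ range m, y p ((q + D ^ m * i) / D ^ p % D) = y p (q / D ^ p % D) := by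
    intro p hp
    have hp : p < m := by simpa using hp
    have e : D ^ m * i = D ^ p * (D * (D ^ (m - p - 1) * i)) := by
      rw [← mul_assoc, ← mul_assoc, ← pow_succ, ← pow_add]
      congr 2
      omega
    rw [e, Nat.add_mul_div_left _ _ (by positivity), Nat.add_mul_mod_self_left]
  rw [h1, prod_congr rfl h2]
  ring

theorem contract_eq_sum (T : ℕ → ℝ) (M : ℕ) (ε : ℕ → ℝ) (N q : ℕ) :
    contract T M ε N q = ∑ i ∈ range (N + 1), extend ε i * T (q + M * i) := by
  rw [sum_range_succ', add_comm, contract]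
  simp [extend]

/-- The tensor `T` arises from `T₀` by contracting the `l` top digits with the vectors
`x 0, …, x (l - 1)`, and `F` is the table of the subset sums of these vectors. -/
structure Contracted (N k : ℕ) (T₀ : ℕ → ℝ) (l : ℕ) (x : ℕ → ℕ → ℝ) (T : ℕ → ℝ)
    (F : ℕ → ℕ → ℝ) : Prop where
  sign : ∀ r < l, x r 0 = 1 ∧ ∀ i < N + 1, x r i = 1 ∨ x r i = -1
  form : ∀ y, formValue (N + 1) (k - l) T y =
    formValue (N + 1) k T₀ fun p => if p < k - l then y p else x (k - 1 - p)
  bound : ∀ S < 2 ^ l, ∀ i < N + 1, |F S i| ≤ F S 0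
  subset : ∀ A ⊆ range l, ∃ S < 2 ^ l, ∀ i < N + 1, F S i = ∑ r ∈ A, x r i

theorem Contracted.zero {N k : ℕ} {T T₀ : ℕ → ℝ} (hT : ∀ q < (N + 1) ^ k, T q = T₀ q)
    {F : ℕ → ℕ → ℝ} (hF : ∀ i, F 0 i = 0) (x : ℕ → ℕ → ℝ) : Contracted N k T₀ 0 x T F where
  sign := by simp
  form y := formValue_congr hT fun p hp => by
    have hp' : p < k - 0 := hp
    rw [if_pos hp']
  bound S hS i hi := by
    obtain rfl : S = 0 := by simpa using hS
    simp [hF]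
  subset A hA := ⟨0, by simp, fun i _ => by
    have : A = ∅ := by simpa using hA
    simp [this, hF]⟩

theorem Contracted.succ {N k l : ℕ} {T T₀ T' : ℕ → ℝ} {x : ℕ → ℕ → ℝ} {F F' : ℕ → ℕ → ℝ}
    (h : Contracted N k T₀ l x T F) (hl : l < k) {ε : ℕ → ℝ}
    (hε : ∀ j < N, ε j = 1 ∨ ε j = -1)
    (hT : ∀ q < (N + 1) ^ (k - 1 - l), T' q = contract T ((N + 1) ^ (k - 1 - l)) ε N q)
    (hF : ∀ S < 2 ^ l, ∀ i < N + 1, F' S i = F S i ∧ F' (S + 2 ^ l) i = F S i + extend ε i) :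
    Contracted N k T₀ (l + 1) (Function.update x l (extend ε)) T' F' where
  sign r hr := by
    rcases Nat.lt_succ_iff_lt_or_eq.1 hr with hr | rfl
    · rw [Function.update_of_ne hr.ne]
      exact h.sign r hr
    · rw [Function.update_self]
      refine ⟨by simp [extend], fun i hi => ?_⟩
      unfold extend
      split_ifs with h0
      · simp
      · exact hε _ (by omega)
  form y := by
    have e : k - (l + 1) = k - 1 - l := by omega
    have e' : k - l = k - 1 - l + 1 := by omega
    rw [e]
    have h1 := h.form fun p => if p < k - 1 - l then y p else extend ε
    rw [e', formValue_succ (by omega)] at h1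
    refine Eq.trans ?_ (h1.trans ?_)
    · refine formValue_congr (fun q hq => ?_) fun p hp => by simp [hp]
      simp [hT q hq, contract_eq_sum]
    · refine formValue_congr (fun _ _ => rfl) fun p hp => ?_
      rcases lt_trichotomy p (k - 1 - l) with hp' | hp' | hp'
      · simp [hp', hp'.trans (Nat.lt_succ_self _)]
      · have : k - 1 - p = l := by omega
        rw [if_pos (by omega), if_neg (by omega), if_neg (by omega), this, Function.update_self]
      · rw [if_neg (by omega), if_neg (by omega), Function.update_of_ne (by omega)]
  bound S hS i hi := by
    have hx : |extend ε i| ≤ 1 := by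
      unfold extend
      split_ifs with h0
      · simp
      · rcases hε (i - 1) (by omega) with h | h <;> simp [h]
    by_cases hS' : S < 2 ^ l
    · rw [(hF S hS' i hi).1, (hF S hS' 0 (by omega)).1]
      exact h.bound S hS' i hi
    · obtain ⟨S', rfl⟩ : ∃ S', S = S' + 2 ^ l := ⟨S - 2 ^ l, by omega⟩
      have hS'' : S' < 2 ^ l := by rw [pow_succ] at hS; omega
      rw [(hF S' hS'' i hi).2, (hF S' hS'' 0 (by omega)).2]
      refine (abs_add_le _ _).trans ?_
      have e0 : extend ε 0 = 1 := rfl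
      rw [e0]
      exact add_le_add (h.bound S' hS'' i hi) hx
  subset A hA := by
    by_cases hlA : l ∈ A
    · obtain ⟨S, hS, hSA⟩ := h.subset (A.erase l) fun r hr => by
        have h1 := mem_of_mem_erase hr
        have h2 := ne_of_mem_erase hr
        have := mem_range.1 (hA h1)
        exact mem_range.2 (by omega)
      refine ⟨S + 2 ^ l, by rw [pow_succ]; omega, fun i hi => ?_⟩
      rw [(hF S hS i hi).2, hSA i hi, ← sum_erase_add _ _ hlA, Function.update_self]
      congr 1
      exact sum_congr rfl fun r hr => by rw [Function.update_of_ne (ne_of_mem_erase hr)]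
    · have hA' : A ⊆ range l := fun r hr => by
        have := mem_range.1 (hA hr)
        have : r ≠ l := fun h => hlA (h ▸ hr)
        exact mem_range.2 (by omega)
      obtain ⟨S, hS, hSA⟩ := h.subset A hA'
      refine ⟨S, hS.trans (Nat.pow_lt_pow_right (by omega) (by omega)), fun i hi => ?_⟩
      rw [(hF S hS i hi).1, hSA i hi]
      refine sum_congr rfl fun r hr => ?_
      have : r ≠ l := fun h => hlA (h ▸ hr)
      rw [Function.update_of_ne this]

/-- The tensor that the program builds. -/
noncomputable def inputTensor (X T k : ℕ) (J : ℕ → ℕ → ℕ) (a : ℕ → ℝ) (c : ℕ) : ℝ :=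
  ∑ t ∈ range T, if c = tupleCode X (J t) k then
    scaledCoef X (J t) k (a t) * (emptySlots (J t) k).factorial else 0

/-- A bound on the number of steps of the deterministic phase. -/
def phaseCost (k D T : ℕ) : ℕ :=
  500 + 30 * k + 150 * D ^ k + (T * (k * 307 + 600) + 5) + (D ^ k * 17 + 5) +
    (k * (2000 * D ^ k + 100 * 2 ^ k * D + 7) + 5) + (400 * D + 100 * 2 ^ k * D) +
    (2 ^ k * (T * (k * 67 + 200) + 272) + 125)

theorem searchPhase_spec {n k T : ℕ} (hn : 1 ≤ n) (hk : 1 ≤ k) {s : State}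
    (h0 : s.nreg 0 = n) (h1 : s.nreg 1 = k) (h2 : s.nreg 2 = T) (hd : s.drawn = 0)
    {J : ℕ → ℕ → ℕ} {a : ℕ → ℝ}
    (hJ : ∀ t < T, ∀ l < k, 3 * s.narr 0 (t * k + l) + s.narr 1 (t * k + l) = J t l)
    (hJD : ∀ t < T, ∀ l < k, J t l < 3 * n + 1)
    (ha : ∀ t < T, s.rarr 0 t = a t) (hz : ∀ b ≠ 0, ∀ c, s.rarr b c = 0)
    (cd : ℕ → ℕ) (hcd0 : cd 0 = 1)
    (hcd : ∀ Q, ∀ j < 3 * n + 1, cd (j + (3 * n + 1) * Q) = cd Q * (1 + j * (3 * n + 1) ^ k)) :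
    Good ω searchPhase s (phaseCost k (3 * n + 1) T) fun s' =>
      s'.nreg 0 = n ∧ s'.nreg 3 = 3 * n + 1 ∧ s'.drawn = 0 ∧
      ∃ x : ℕ → ℕ → ℝ, (∀ r < k, x r 0 = 1) ∧
        (∀ i < 3 * n + 1, |tableRow (3 * n + 1) s' (s'.nreg 17) i| ≤
          tableRow (3 * n + 1) s' (s'.nreg 17) 0) ∧
        (∀ A ⊆ range k, |rowGain T k J (fun t => scaledCoef ((3 * n + 1) ^ k) (J t) k (a t))
            fun i => ∑ r ∈ A, x r i| ≤
          |rowGain T k J (fun t => scaledCoef ((3 * n + 1) ^ k) (J t) k (a t))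
            (tableRow (3 * n + 1) s' (s'.nreg 17))|) ∧
        9 ^ (k - 1) * mixedNorm (3 * n + 1)
          (fun q => inputTensor ((3 * n + 1) ^ k) T k J a (cd q)) ((3 * n + 1) ^ (k - 1)) ≤
          16 ^ (k - 1) * |formValue (3 * n + 1) k
            (fun q => inputTensor ((3 * n + 1) ^ k) T k J a (cd q)) fun p => x (k - 1 - p)| := by
  set T₀ : ℕ → ℝ := fun q => inputTensor ((3 * n + 1) ^ k) T k J a (cd q) with hT₀
  set coef : ℕ → ℝ := fun t => scaledCoef ((3 * n + 1) ^ k) (J t) k (a t) with hcoef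
  have hsum : phaseCost k (3 * n + 1) T = (500 + 30 * k) + (150 * (3 * n + 1) ^ k +
    ((T * (k * 307 + 600) + 5) + (((3 * n + 1) ^ k * 17 + 5) +
    ((k * (2000 * (3 * n + 1) ^ k + 100 * 2 ^ k * (3 * n + 1) + 7) + 5) +
    ((400 * (3 * n + 1) + 100 * 2 ^ k * (3 * n + 1)) +
    (2 ^ k * (T * (k * 67 + 200) + 272) + 125)))))) := by
    unfold phaseCost
    ring
  rw [hsum]
  refine Good.seq (initProg_spec h0 h1) ?_
  rintro s₁ a₁ ⟨hset₁, e7₁⟩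
  refine Good.seq (codeProg_spec hn hk hset₁ cd hcd0 hcd) ?_
  intro s₂ a₂ hcode₂
  have hset₂ : Setup n k s₂ := hset₁.agree a₂ ⟨by decide, rfl⟩
  refine Good.seq (termsProg_spec hset₂ (T := T) (J := J) (a := a) ?_ ?_ ?_ ?_) ?_
  · rw [a₂.n 2 rfl, a₁.n 2 rfl, h2]
  · rw [a₂.na 0 rfl, a₂.na 1 rfl, a₁.na 0 rfl, a₁.na 1 rfl]
    exact hJ
  · rw [a₂.ra 0 rfl, a₁.ra 0 rfl]
    exact ha
  · rw [a₂.ra 3 rfl, a₁.ra 3 rfl]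
    exact hz 3 (by decide)
  rintro s₃ a₃ ⟨hcoef₃, htens₃⟩
  have hset₃ : Setup n k s₃ := hset₂.agree a₃ ⟨by decide, rfl⟩
  refine Good.seq (fillProg_spec hset₃ (cd := cd) ?_) ?_
  · rw [a₃.na 3 rfl]
    exact hcode₂
  intro s₄ a₄ hfill
  have hset₄ : Setup n k s₄ := hset₃.agree a₄ ⟨by decide, rfl⟩
  have hT₄ : ∀ q < (3 * n + 1) ^ k, s₄.rarr 4 q = T₀ q := fun q hq => by
    rw [hfill q hq, htens₃]
    rfl
  have r8 : s₄.rarr 8 = s.rarr 8 := by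
    rw [a₄.ra 8 rfl, a₃.ra 8 rfl, a₂.ra 8 rfl, a₁.ra 8 rfl]
  refine Good.seq (Q₁ := fun s' => s'.nreg 7 = 2 ^ (k - 1) ∧ ∃ x : ℕ → ℕ → ℝ,
    9 ^ (k - 1) * mixedNorm (3 * n + 1) T₀ ((3 * n + 1) ^ (k - 1)) ≤
      16 ^ (k - 1) * mixedNorm (3 * n + 1) (s'.rarr 4) ((3 * n + 1) ^ (k - 1 - (k - 1))) ∧
    Contracted (3 * n) k T₀ (k - 1) x (s'.rarr 4) (tableRow (3 * n + 1) s')) ?_ ?_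
  · refine Good.of_cost (Good.forLoop (N := k - 1)
      (c := 2000 * (3 * n + 1) ^ k + 100 * 2 ^ k * (3 * n + 1))
      (fun i s' => s'.nreg 7 = 2 ^ i ∧ ∃ x : ℕ → ℕ → ℝ,
      9 ^ i * mixedNorm (3 * n + 1) T₀ ((3 * n + 1) ^ (k - 1)) ≤
        16 ^ i * mixedNorm (3 * n + 1) (s'.rarr 4) ((3 * n + 1) ^ (k - 1 - i)) ∧
      Contracted (3 * n) k T₀ i x (s'.rarr 4) (tableRow (3 * n + 1) s')) hset₄.reg16
      (by decide) rfl rfl ?_ ?_ ?_) ?_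
    · rintro i s v ⟨h1, x, h2, h3⟩
      exact ⟨by simpa using h1, x, h2, h3⟩
    · refine ⟨?_, fun _ _ => 0, ?_, Contracted.zero hT₄ (fun i => ?_) _⟩
      · rw [a₄.n 7 rfl, a₃.n 7 rfl, a₂.n 7 rfl, e7₁, pow_zero]
      · rw [pow_zero, pow_zero, one_mul, one_mul]
        refine le_of_eq ?_
        refine sum_congr rfl fun c hc => ?_
        congr 1
        refine sum_congr rfl fun R hR => ?_
        rw [hT₄]
        have := cell_lt (mem_range.1 hc) (mem_range.1 hR)
        rwa [Nat.sub_zero, ← pow_succ', Nat.sub_add_cancel hk] at this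
      · rw [tableRow, r8, hz 8 (by decide)]
    · rintro l hl s₅ a₅ hr₅ ⟨i7, x, iN, iC⟩
      have hset₅ : Setup n k s₅ := hset₄.agree a₅ ⟨by decide, rfl⟩
      refine (stageProg_spec hset₅ (by omega) hr₅ i7).mono ?_ ?_
      · have : (2 : ℕ) ^ l ≤ 2 ^ k := Nat.pow_le_pow_right (by omega) (by omega)
        gcongr
      · rintro s₆ - ⟨j7, ε, jε, jN, jT, jF⟩
        refine ⟨by rw [j7, pow_succ'], Function.update x l (extend ε), ?_,
          iC.succ (by omega) jε jT jF⟩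
        have e : k - 1 - (l + 1) = k - 1 - l - 1 := by omega
        rw [e, pow_succ, pow_succ]
        calc (9 : ℝ) ^ l * 9 * mixedNorm (3 * n + 1) T₀ ((3 * n + 1) ^ (k - 1))
            = 9 * (9 ^ l * mixedNorm (3 * n + 1) T₀ ((3 * n + 1) ^ (k - 1))) := by ring
          _ ≤ 9 * (16 ^ l * mixedNorm (3 * n + 1) (s₅.rarr 4) ((3 * n + 1) ^ (k - 1 - l))) := by
            gcongr
          _ = 16 ^ l * (9 * mixedNorm (3 * n + 1) (s₅.rarr 4) ((3 * n + 1) ^ (k - 1 - l))) := by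
            ring
          _ ≤ 16 ^ l * (16 * mixedNorm (3 * n + 1) (s₆.rarr 4)
              ((3 * n + 1) ^ (k - 1 - l - 1))) := by gcongr
          _ = _ := by ring
    · have : (k - 1) * (2000 * (3 * n + 1) ^ k + 100 * 2 ^ k * (3 * n + 1) + 7) ≤
        k * (2000 * (3 * n + 1) ^ k + 100 * 2 ^ k * (3 * n + 1) + 7) :=
        Nat.mul_le_mul_right _ (by omega)
      exact Nat.add_le_add_right this 5
  rintro s₅ a₅ ⟨i7, x, iN, iC⟩
  have hset₅ : Setup n k s₅ := hset₄.agree a₅ ⟨by decide, rfl⟩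
  refine Good.seq ((lastStageProg_spec hset₅ i7).of_cost ?_) ?_
  · have : (2 : ℕ) ^ (k - 1) ≤ 2 ^ k := Nat.pow_le_pow_right (by omega) (by omega)
    gcongr
  rintro s₆ a₆ ⟨j7, ε, jε, jN, jT, jF⟩
  have hset₆ : Setup n k s₆ := hset₅.agree a₆ ⟨by decide, rfl⟩
  have iC' := iC.succ (T' := s₆.rarr 4) (by omega) jε (fun q hq => ?_) jF
  swap
  · have e : k - 1 - (k - 1) = 0 := by omega
    rw [e, pow_zero] at hq ⊢
    obtain rfl : q = 0 := by omega
    exact jT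
  rw [Nat.sub_add_cancel hk] at iC'
  have e7 : s₆.nreg 7 = 2 ^ k := by
    rw [j7, ← pow_succ', Nat.sub_add_cancel hk]
  refine (searchProg_spec hset₆.reg1 ?_ hset₆.reg3 e7 (by positivity) (J := J) (coef := coef)
    ?_ ?_).mono le_rfl ?_
  · rw [a₆.n 2 rfl, a₅.n 2 rfl, a₄.n 2 rfl, a₃.n 2 rfl, a₂.n 2 rfl, a₁.n 2 rfl, h2]
  · rw [a₆.na 0 rfl, a₅.na 0 rfl, a₄.na 0 rfl, a₃.na 0 rfl, a₂.na 0 rfl, a₁.na 0 rfl,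
      a₆.na 1 rfl, a₅.na 1 rfl, a₄.na 1 rfl, a₃.na 1 rfl, a₂.na 1 rfl, a₁.na 1 rfl]
    exact hJ
  · rw [a₆.ra 2 rfl, a₅.ra 2 rfl, a₄.ra 2 rfl]
    exact hcoef₃
  rintro s₇ a₇ ⟨k17, kbest⟩
  have hrow : tableRow (3 * n + 1) s₇ = tableRow (3 * n + 1) s₆ := by
    funext S i
    rw [tableRow, a₇.ra 8 rfl, tableRow]
  rw [hrow]
  refine ⟨?_, ?_, ?_, _, fun r hr => (iC'.sign r hr).1, iC'.bound _ k17, ?_, ?_⟩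
  · rw [a₇.n 0 rfl, hset₆.reg0]
  · rw [a₇.n 3 rfl, hset₆.reg3]
  · rw [a₇.d rfl, a₆.d rfl, a₅.d rfl, a₄.d rfl, a₃.d rfl, a₂.d rfl, a₁.d rfl, hd]
  · intro A hA
    obtain ⟨S, hS, hSA⟩ := iC'.subset A hA
    refine le_trans (le_of_eq ?_) (kbest S hS)
    congr 1
    refine sum_congr rfl fun t ht => ?_
    congr 1
    refine prod_congr rfl fun l hl => ?_
    rw [hSA _ (hJD t (mem_range.1 ht) l (mem_range.1 hl)), hSA 0 (by omega)]
  · have h6 := iC'.form fun _ _ => 0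
    rw [Nat.sub_self] at h6
    simp only [Nat.not_lt_zero, if_false] at h6
    rw [← h6]
    have : formValue (3 * n + 1) 0 (s₆.rarr 4) (fun _ _ => 0) = s₆.rarr 4 0 := by
      simp [formValue]
    rw [this, ← jN]
    rwa [Nat.sub_self, pow_zero] at iN

end RealRAM

/-! ## Energies of product states -/

open Finset in
theorem sum_sum_prod_eq_prod {n : ℕ} {β : Type*} [Fintype β] (f : Fin n → β → β → ℂ) :
    ∑ a : Fin n → β, ∑ b : Fin n → β, ∏ i, f i (a i) (b i) = ∏ i, ∑ x, ∑ y, f i x y := by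
  classical
  rw [prod_univ_sum, Fintype.piFinset_univ]
  refine sum_congr rfl fun a _ => ?_
  rw [prod_univ_sum, Fintype.piFinset_univ]

/-- The expectation value of a Pauli matrix in a qubit vector. -/
def qubitMean (v : Fin 2 → ℂ) (c : Fin 4) : ℂ :=
  ∑ x, ∑ y, star (v x) * pauli c x y * v y

theorem star_dotProduct_pauliMatrix_mulVec {n : ℕ} (P : PauliString n) (φ : Fin n → Fin 2 → ℂ) :
    star (productState φ) ⬝ᵥ (pauliMatrix P).mulVec (productState φ) =
      ∏ i, qubitMean (φ i) (P i) := by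
  simp only [qubitMean]
  rw [← sum_sum_prod_eq_prod fun i x y => star (φ i x) * pauli (P i) x y * φ i y]
  simp only [dotProduct, Matrix.mulVec, Finset.mul_sum, Pi.star_apply, productState, pauliMatrix,
    star_prod, Finset.prod_mul_distrib, mul_assoc]

theorem energy_hamiltonian {n : ℕ} (α : PauliString n → ℝ) (ψ : Bits n → ℂ) :
    energy (hamiltonian α) ψ = ∑ P, α P * energy (pauliMatrix P) ψ := by
  simp only [energy, hamiltonian, Matrix.sum_mulVec, dotProduct_sum, Matrix.smul_mulVec,
    dotProduct_smul, Complex.re_sum, smul_eq_mul, Complex.re_ofReal_mul]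

theorem energy_hamiltonian_productState {n : ℕ} (α : PauliString n → ℝ) (φ : Fin n → Fin 2 → ℂ)
    (m : Fin n → Fin 4 → ℝ) (h : ∀ i c, qubitMean (φ i) c = m i c) :
    energy (hamiltonian α) (productState φ) = ∑ P, α P * ∏ i, m i (P i) := by
  rw [energy_hamiltonian]
  refine Finset.sum_congr rfl fun P _ => ?_
  rw [energy, star_dotProduct_pauliMatrix_mulVec]
  simp only [h]
  rw [← Complex.ofReal_prod, Complex.ofReal_re]

namespace RealRAM

theorem firstAmp_pos {e : ℝ} (h : e = 1 ∨ e = -1) :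
    0 < firstAmp e ∧ firstAmp e ^ 2 = (1 + e / √3) / 2 := by
  have h3 : (1 : ℝ) < √3 := by
    rw [Real.lt_sqrt (by norm_num)]
    norm_num
  have : 0 < (1 + e / √3) / 2 := by
    have : 1 / √3 < 1 := by
      rw [div_lt_one (by positivity)]
      exact h3
    rcases h with rfl | rfl
    · positivity
    · rw [neg_div]
      linarith
  exact ⟨Real.sqrt_pos.2 this, Real.sq_sqrt this.le⟩

/-- The pure state with Bloch vector `(e 1, e 2, e 3) / √3`. -/
noncomputable def cornerState (e : ℕ → ℝ) : Fin 2 → ℂ :=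
  ![(firstAmp (e 3) : ℂ), ⟨e 1 / (2 * √3 * firstAmp (e 3)), e 2 / (2 * √3 * firstAmp (e 3))⟩]

theorem secondAmp_sq {e : ℕ → ℝ} (h : ∀ c, e c = 1 ∨ e c = -1) :
    (e 1 / (2 * √3 * firstAmp (e 3))) ^ 2 + (e 2 / (2 * √3 * firstAmp (e 3))) ^ 2 =
      (1 - e 3 / √3) / 2 := by
  obtain ⟨hp, hs⟩ := firstAmp_pos (h 3)
  have hsq : ∀ c, e c ^ 2 = 1 := fun c => by rcases h c with h | h <;> rw [h] <;> norm_num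
  have h3 : √3 ^ 2 = (3 : ℝ) := Real.sq_sqrt (by norm_num)
  have h3' : √3 ≠ 0 := by positivity
  rw [div_pow, div_pow, hsq, hsq, mul_pow, mul_pow, h3, hs]
  have h4 : (1 + e 3 / √3) / 2 ≠ 0 := by
    rw [← hs]
    positivity
  have h5 : (1 + e 3 / √3) * (1 - e 3 / √3) = 2 / 3 := by
    have : (e 3 / √3) ^ 2 = 1 / 3 := by rw [div_pow, hsq, h3]
    linear_combination -this
  have h6 : 1 + e 3 / √3 ≠ 0 := fun h => h4 (by rw [h]; simp)
  generalize e 3 / √3 = u at *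
  field_simp
  linear_combination -3 * h5

theorem cornerState_norm {e : ℕ → ℝ} (h : ∀ c, e c = 1 ∨ e c = -1) :
    ∑ b, ‖cornerState e b‖ ^ 2 = 1 := by
  obtain ⟨hp, hs⟩ := firstAmp_pos (h 3)
  have h1 := secondAmp_sq h
  rw [Fin.sum_univ_two]
  simp only [cornerState, Matrix.cons_val_zero, Matrix.cons_val_one, ← Complex.normSq_eq_norm_sq,
    Complex.normSq_mk, Complex.normSq_ofReal]
  rw [← sq, ← sq, ← sq, h1, hs]
  ring

theorem qubitMean_cornerState {e : ℕ → ℝ} (h : ∀ c, e c = 1 ∨ e c = -1) (c : Fin 4) :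
    qubitMean (cornerState e) c = ((if c = 0 then 1 else e c / √3 : ℝ) : ℂ) := by
  obtain ⟨hp, hs⟩ := firstAmp_pos (h 3)
  have h1 := secondAmp_sq h
  have h3 : √3 ≠ 0 := by positivity
  have h4 : ∀ c, firstAmp (e 3) * (e c / (2 * √3 * firstAmp (e 3))) = e c / √3 / 2 := fun c => by
    field_simp
  have h41 := h4 1
  have h42 := h4 2
  simp only [qubitMean, Fin.sum_univ_two, cornerState, Matrix.cons_val_zero, Matrix.cons_val_one]
  generalize e 1 / (2 * √3 * firstAmp (e 3)) = x at *
  generalize e 2 / (2 * √3 * firstAmp (e 3)) = y at *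
  generalize firstAmp (e 3) = z at *
  apply Complex.ext
  · fin_cases c <;> simp [pauli] <;> linarith
  · fin_cases c <;> simp [pauli] <;> ring

end RealRAM

/-! ## The energy of a Haar-random state -/

open scoped Pointwise in
theorem measurePreserving_toSphere_linearIsometryEquiv {E : Type*} [NormedAddCommGroup E] [NormedSpace ℝ E]
    [MeasurableSpace E] [BorelSpace E] [FiniteDimensional ℝ E] (μ : Measure E) [μ.IsAddHaarMeasure]
    (L : E ≃ₗᵢ[ℝ] E) (g : Metric.sphere (0 : E) 1 → Metric.sphere (0 : E) 1)
    (hg : ∀ x, (g x : E) = L x) : MeasurePreserving g μ.toSphere μ.toSphere := by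
  have hgc : Continuous g := by
    rw [Topology.IsInducing.subtypeVal.continuous_iff]
    have : (Subtype.val ∘ g) = fun x : Metric.sphere (0 : E) 1 => L x := funext hg
    rw [this]
    exact L.continuous.comp continuous_subtype_val
  have hpre : ∀ s : Set E, μ (L ⁻¹' s) = μ s := by
    have h1 := Measure.addHaar_preimage_linearMap μ (f := (L : E →ₗ[ℝ] E))
      (LinearEquiv.isUnit_det' L.toLinearEquiv).ne_zero
    have h2 := h1 (Metric.ball 0 1)
    have h3 : (L : E →ₗ[ℝ] E) ⁻¹' Metric.ball 0 1 = Metric.ball 0 1 := by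
      ext x
      simp
    rw [h3] at h2
    have h4 : μ (Metric.ball (0 : E) 1) ≠ 0 := (Metric.measure_ball_pos μ 0 one_pos).ne'
    have h5 : μ (Metric.ball (0 : E) 1) ≠ ⊤ := measure_ball_lt_top.ne
    have h6 : ENNReal.ofReal |(LinearMap.det (L : E →ₗ[ℝ] E))⁻¹| = 1 := by
      exact (ENNReal.mul_left_inj h4 h5).1 (by rw [one_mul]; exact h2.symm)
    intro s
    have := h1 s
    rwa [h6, one_mul] at this
  refine ⟨hgc.measurable, ?_⟩
  ext s hs
  rw [Measure.map_apply hgc.measurable hs, Measure.toSphere_apply' _ hs,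
    Measure.toSphere_apply' _ (hgc.measurable hs)]
  congr 1
  rw [← hpre (Set.Ioo (0 : ℝ) 1 • (Subtype.val '' s))]
  congr 1
  ext x
  simp only [Set.mem_smul, Set.mem_preimage, Set.mem_image]
  constructor
  · rintro ⟨r, hr, _, ⟨y, hy, rfl⟩, rfl⟩
    exact ⟨r, hr, _, ⟨g y, hy, rfl⟩, by rw [hg, map_smul]⟩
  · rintro ⟨r, hr, _, ⟨y, hy, rfl⟩, hx⟩
    have hz : (L.symm y : E) ∈ Metric.sphere (0 : E) 1 := by
      have := y.2
      simp only [mem_sphere_zero_iff_norm] at this ⊢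
      rw [L.symm.norm_map, this]
    have hgz : g ⟨L.symm y, hz⟩ = y := Subtype.ext (by rw [hg]; simp)
    refine ⟨r, hr, _, ⟨⟨L.symm y, hz⟩, by rwa [hgz], rfl⟩, ?_⟩
    apply L.injective
    rw [← hx, map_smul]
    simp

theorem isProbabilityMeasure_haarState (n : ℕ) : IsProbabilityMeasure (haarState n) := by
  refine ⟨?_⟩
  rw [haarState, Measure.smul_apply, smul_eq_mul, ENNReal.inv_mul_cancel]
  · rw [Measure.toSphere_apply_univ]
    refine mul_ne_zero ?_ (Metric.measure_ball_pos _ 0 one_pos).ne'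
    rw [Nat.cast_ne_zero]
    exact (Module.finrank_pos (R := ℝ) (M := QubitSpace n)).ne'
  · exact measure_ne_top _ _

theorem continuous_energy {n : ℕ} (H : Matrix (Bits n) (Bits n) ℂ) :
    Continuous fun φ : Metric.sphere (0 : QubitSpace n) 1 =>
      energy H fun b => (φ : QubitSpace n) b := by
  unfold energy
  simp only [dotProduct, Matrix.mulVec, Pi.star_apply]
  fun_prop

theorem integrable_energy {n : ℕ} (H : Matrix (Bits n) (Bits n) ℂ) :
    Integrable (fun φ : Metric.sphere (0 : QubitSpace n) 1 =>
      energy H fun b => (φ : QubitSpace n) b) (haarState n) := by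
  have := isProbabilityMeasure_haarState n
  exact (continuous_energy H).integrable_of_hasCompactSupport (HasCompactSupport.of_compactSpace _)

theorem pauliMatrix_mul {n : ℕ} (P Q : PauliString n) (a b : Bits n) :
    (pauliMatrix P * pauliMatrix Q) a b = ∏ i, (pauli (P i) * pauli (Q i)) (a i) (b i) := by
  simp only [Matrix.mul_apply, pauliMatrix]
  rw [Finset.prod_univ_sum, Fintype.piFinset_univ]
  simp only [Finset.prod_mul_distrib]

theorem pauli_zero : pauli 0 = 1 := by
  ext i j
  fin_cases i <;> fin_cases j <;> simp [pauli]

theorem pauli_mul_self (c : Fin 4) : pauli c * pauli c = 1 := by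
  fin_cases c <;> ext i j <;> fin_cases i <;> fin_cases j <;> simp [pauli, Matrix.mul_apply]

theorem pauli_conjTranspose (c : Fin 4) : (pauli c).conjTranspose = pauli c := by
  fin_cases c <;> ext i j <;> fin_cases i <;> fin_cases j <;> simp [pauli]

theorem pauliMatrix_zero {n : ℕ} : pauliMatrix (0 : PauliString n) = 1 := by
  ext a b
  simp only [pauliMatrix, Pi.zero_apply, pauli_zero, Matrix.one_apply]
  by_cases hab : a = b
  · simp [hab]
  · rw [if_neg hab]
    obtain ⟨i, hi⟩ := Function.ne_iff.1 hab
    exact Finset.prod_eq_zero (Finset.mem_univ i) (if_neg hi)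

theorem pauliMatrix_mul_self {n : ℕ} (P : PauliString n) : pauliMatrix P * pauliMatrix P = 1 := by
  rw [← pauliMatrix_zero]
  ext a b
  simp only [pauliMatrix_mul, pauli_mul_self, pauliMatrix, Pi.zero_apply, pauli_zero]

theorem pauliMatrix_conjTranspose {n : ℕ} (P : PauliString n) :
    (pauliMatrix P).conjTranspose = pauliMatrix P := by
  ext a b
  simp only [Matrix.conjTranspose_apply, pauliMatrix, star_prod]
  exact Finset.prod_congr rfl fun i _ => by
    rw [← Matrix.conjTranspose_apply, pauli_conjTranspose]

theorem exists_pauliMatrix_anticommute {n : ℕ} {P : PauliString n} (hP : P ≠ 0) :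
    ∃ Q : PauliString n, pauliMatrix P * pauliMatrix Q = -(pauliMatrix Q * pauliMatrix P) := by
  obtain ⟨i, hi⟩ := Function.ne_iff.1 hP
  obtain ⟨c, hc⟩ : ∃ c, pauli (P i) * pauli c = -(pauli c * pauli (P i)) := by
    generalize P i = d at hi
    refine ⟨if d = 3 then 1 else 3, ?_⟩
    fin_cases d <;> first | exact absurd rfl hi | skip
    all_goals ext i j; fin_cases i <;> fin_cases j <;> simp [pauli, Matrix.mul_apply]
  refine ⟨Function.update 0 i c, ?_⟩
  ext a b
  rw [Matrix.neg_apply, pauliMatrix_mul, pauliMatrix_mul,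
    ← Finset.mul_prod_erase _ _ (Finset.mem_univ i),
    ← Finset.mul_prod_erase _ _ (Finset.mem_univ i), ← neg_mul]
  congr 1
  · rw [Function.update_self, hc, Matrix.neg_apply]
  · refine Finset.prod_congr rfl fun j hj => ?_
    rw [Function.update_of_ne (Finset.ne_of_mem_erase hj), Pi.zero_apply, pauli_zero, mul_one, one_mul]

theorem energy_mulVec {n : ℕ} (H U : Matrix (Bits n) (Bits n) ℂ) (ψ : Bits n → ℂ) :
    energy H (U.mulVec ψ) = energy (U.conjTranspose * H * U) ψ := by
  rw [energy, energy, Matrix.star_mulVec, ← Matrix.dotProduct_mulVec, Matrix.mulVec_mulVec,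
    Matrix.mulVec_mulVec, Matrix.mul_assoc]

theorem energy_one {n : ℕ} (x : QubitSpace n) :
    energy (1 : Matrix (Bits n) (Bits n) ℂ) (fun b => x b) = ‖x‖ ^ 2 := by
  rw [EuclideanSpace.norm_sq_eq, energy, Matrix.one_mulVec]
  simp only [dotProduct, Complex.re_sum, Pi.star_apply]
  refine Finset.sum_congr rfl fun b _ => ?_
  rw [← Complex.normSq_eq_norm_sq, Complex.star_def, ← Complex.normSq_eq_conj_mul_self,
    Complex.ofReal_re]

theorem integral_energy_pauliMatrix {n : ℕ} {P : PauliString n} (hP : P ≠ 0) :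
    ∫ φ : Metric.sphere (0 : QubitSpace n) 1,
      energy (pauliMatrix P) (fun b => (φ : QubitSpace n) b) ∂(haarState n) = 0 := by
  obtain ⟨Q, hQ⟩ := exists_pauliMatrix_anticommute hP
  have hUU : ∀ x : QubitSpace n, WithLp.toLp 2 ((pauliMatrix Q).mulVec
      (WithLp.toLp 2 ((pauliMatrix Q).mulVec x.ofLp)).ofLp) = x := fun x => by
    simp [Matrix.mulVec_mulVec, pauliMatrix_mul_self]
  have hnorm : ∀ x : QubitSpace n, ‖WithLp.toLp 2 ((pauliMatrix Q).mulVec x.ofLp)‖ = ‖x‖ := by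
    intro x
    have key : ∀ y : QubitSpace n, ‖y‖ ^ 2 = energy 1 y.ofLp := fun y => (energy_one y).symm
    rw [← sq_eq_sq₀ (norm_nonneg _) (norm_nonneg _), key, key, energy_mulVec, mul_one,
      pauliMatrix_conjTranspose, pauliMatrix_mul_self]
  let L : QubitSpace n ≃ₗᵢ[ℝ] QubitSpace n :=
    { toFun := fun x => WithLp.toLp 2 ((pauliMatrix Q).mulVec x.ofLp)
      invFun := fun x => WithLp.toLp 2 ((pauliMatrix Q).mulVec x.ofLp)
      map_add' := fun x y => by simp [Matrix.mulVec_add]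
      map_smul' := fun r x => by simp [Matrix.mulVec_smul]
      left_inv := hUU
      right_inv := hUU
      norm_map' := hnorm }
  let g : Metric.sphere (0 : QubitSpace n) 1 → Metric.sphere (0 : QubitSpace n) 1 :=
    fun x => ⟨L x, by
      have := x.2
      rw [mem_sphere_zero_iff_norm] at this ⊢
      rw [L.norm_map, this]⟩
  have hg := measurePreserving_toSphere_linearIsometryEquiv
    (Measure.addHaar : Measure (QubitSpace n)) L g fun x => rfl
  have hg' : MeasurePreserving g (haarState n) (haarState n) := hg.smul_measure _
  have hemb : MeasurableEmbedding g := by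
    refine (MeasurableEquiv.mk ⟨g, g, fun x => ?_, fun x => ?_⟩ hg.measurable
      hg.measurable).measurableEmbedding <;> exact Subtype.ext (hUU x)
  have h := hg'.integral_comp hemb
    (fun φ : Metric.sphere (0 : QubitSpace n) 1 =>
      energy (pauliMatrix P) (fun b => (φ : QubitSpace n) b))
  have h2 : ∀ φ, energy (pauliMatrix P) (fun b => (g φ : QubitSpace n) b) =
      -energy (pauliMatrix P) (fun b => (φ : QubitSpace n) b) := fun φ => by
    change energy (pauliMatrix P) ((pauliMatrix Q).mulVec (φ : QubitSpace n).ofLp) = _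
    rw [energy_mulVec, pauliMatrix_conjTranspose, mul_assoc, hQ, mul_neg, ← mul_assoc,
      pauliMatrix_mul_self, one_mul, energy, energy, Matrix.neg_mulVec, dotProduct_neg,
      Complex.neg_re]
  simp only [h2, integral_neg] at h
  linarith

theorem haarEnergy_hamiltonian {n : ℕ} (α : PauliString n → ℝ) :
    haarEnergy (hamiltonian α) = α 0 := by
  have := isProbabilityMeasure_haarState n
  simp only [haarEnergy, energy_hamiltonian]
  rw [integral_finsetSum _ fun P _ => (integrable_energy _).const_mul _,
    Finset.sum_eq_single 0]
  · have h : ∀ φ : Metric.sphere (0 : QubitSpace n) 1, ‖(φ : QubitSpace n)‖ = 1 := fun φ =>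
      mem_sphere_zero_iff_norm.1 φ.2
    simp only [pauliMatrix_zero, energy_one, h]
    simp
  · intro P _ hP
    rw [integral_const_mul, integral_energy_pauliMatrix hP, mul_zero]
  · simp

/-! ## Ryser's formula -/

open Finset in
theorem sum_neg_one_pow_card_of_disjoint {ι : Type*} [Fintype ι] [DecidableEq ι] (S : Finset ι) :
    ∑ B : Finset ι, (if Disjoint B S then (-1 : ℝ) ^ #B else 0) = if S = univ then 1 else 0 := by
  rw [← sum_filter]
  have h : (univ.filter fun B : Finset ι => Disjoint B S) = Sᶜ.powerset := by
    ext B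
    simp [mem_powerset, ← le_compl_iff_disjoint_right]
  rw [h]
  have := sum_powerset_neg_one_pow_card (x := Sᶜ)
  have h2 : ∑ B ∈ Sᶜ.powerset, (-1 : ℝ) ^ #B = if Sᶜ = ∅ then 1 else 0 := by exact_mod_cast this
  rw [h2]
  exact if_congr (compl_eq_empty_iff _) rfl rfl

open Finset in
theorem sum_neg_one_pow_card_mul_prod_sum_compl {ι : Type*} [Fintype ι] [DecidableEq ι]
    (y : ι → ι → ℝ) :
    ∑ B : Finset ι, (-1 : ℝ) ^ #B * ∏ l, ∑ r ∈ Bᶜ, y r l =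
      ∑ τ : Equiv.Perm ι, ∏ l, y (τ l) l := by
  have h1 : ∀ B : Finset ι, (-1 : ℝ) ^ #B * ∏ l, ∑ r ∈ Bᶜ, y r l =
      ∑ f : ι → ι, (if Disjoint B (univ.image f) then (-1 : ℝ) ^ #B else 0) *
        ∏ l, y (f l) l := by
    intro B
    have : ∀ l, ∑ r ∈ Bᶜ, y r l = ∑ r, if r ∈ Bᶜ then y r l else 0 := fun l => by
      rw [sum_ite_mem, univ_inter]
    simp only [this]
    rw [prod_univ_sum, Fintype.piFinset_univ, mul_sum]
    refine sum_congr rfl fun f _ => ?_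
    split_ifs with h
    · congr 1
      refine prod_congr rfl fun l _ => ?_
      rw [if_pos]
      rw [mem_compl]
      exact fun hl => disjoint_left.1 h hl (mem_image_of_mem f (mem_univ l))
    · rw [zero_mul]
      simp only [disjoint_left, mem_image, mem_univ, true_and] at h
      push Not at h
      obtain ⟨_, ha, l, rfl⟩ := h
      rw [prod_eq_zero (mem_univ l), mul_zero]
      rw [if_neg]
      simpa using ha
  simp only [h1]
  rw [sum_comm]
  simp only [← sum_mul, sum_neg_one_pow_card_of_disjoint]
  simp only [ite_mul, one_mul, zero_mul]
  rw [← sum_filter]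
  symm
  refine sum_bij (fun τ _ => τ) (fun τ _ => ?_) (fun τ _ τ' _ h => ?_) (fun f hf => ?_)
    fun _ _ => rfl
  · simp [image_univ_equiv]
  · exact DFunLike.coe_injective h
  · have hf : univ.image f = univ := by simpa using hf
    have hs : Function.Surjective f := fun a => by
      have := mem_univ a
      rw [← hf] at this
      simpa using this
    exact ⟨Equiv.ofBijective f (Finite.surjective_iff_bijective.1 hs), mem_univ _, rfl⟩

open Finset in
theorem sum_card_pow_le {k : ℕ} (hk : 1 ≤ k) :
    ∑ B : Finset (Fin k), (#Bᶜ : ℝ) ^ k ≤ (3 / 2) ^ k * (k : ℝ) ^ k := by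
  have h1 : ∀ B : Finset (Fin k), (#Bᶜ : ℝ) ^ k ≤ ((1 / 2) ^ #B * 1 ^ (k - #B)) * (k : ℝ) ^ k := by
    intro B
    have hk' : (0 : ℝ) < k := by exact_mod_cast hk
    have hB : #B ≤ k := by simpa using card_le_univ B
    have e : (#Bᶜ : ℝ) = (1 - #B / k) * k := by
      rw [card_compl, Fintype.card_fin, Nat.cast_sub hB]
      field_simp
    rw [e, mul_pow, one_pow, mul_one]
    gcongr
    have h0 : (0 : ℝ) ≤ 1 - #B / k := by
      rw [sub_nonneg, div_le_one hk']
      exact_mod_cast hB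
    calc (1 - (#B : ℝ) / k) ^ k ≤ Real.exp (-(#B / k : ℝ)) ^ k := by
          gcongr
          linarith [Real.add_one_le_exp (-(#B / k : ℝ))]
      _ = Real.exp (-1) ^ #B := by
          rw [← Real.exp_nat_mul, ← Real.exp_nat_mul]
          congr 1
          field_simp
      _ ≤ (1 / 2) ^ #B := by
          gcongr
          rw [Real.exp_neg, one_div]
          gcongr
          linarith [Real.add_one_le_exp (1 : ℝ)]
  refine (sum_le_sum fun B _ => h1 B).trans ?_
  rw [← sum_mul]
  have := Fintype.sum_pow_mul_eq_add_pow (Fin k) (1 / 2 : ℝ) 1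
  rw [Fintype.card_fin] at this
  rw [this]
  norm_num

namespace RealRAM

open Finset

theorem abs_polarized_le {T k : ℕ} (hk : 1 ≤ k) {J : ℕ → ℕ → ℕ} {coef : ℕ → ℝ} {x : ℕ → ℕ → ℝ}
    (hx : ∀ r < k, x r 0 = 1) {G : ℝ}
    (hG : ∀ A ⊆ range k, |rowGain T k J coef fun i => ∑ r ∈ A, x r i| ≤ G) :
    |∑ t ∈ range T, coef t * ∑ τ : Equiv.Perm (Fin k), ∏ l, x (τ l) (J t l)| ≤
      (3 / 2) ^ k * (k : ℝ) ^ k * G := by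
  have hG0 : 0 ≤ G := (abs_nonneg _).trans (hG ∅ (empty_subset _))
  have h1 : ∀ B : Finset (Fin k), ∑ t ∈ range T, coef t * ∏ l : Fin k, ∑ r ∈ Bᶜ, x r (J t l) =
      (#Bᶜ : ℝ) ^ k *
        rowGain T k J coef fun i => ∑ r ∈ Bᶜ.map Fin.valEmbedding, x r i := by
    intro B
    rw [rowGain, mul_sum]
    refine sum_congr rfl fun t _ => ?_
    rw [mul_left_comm]
    congr 1
    have e0 : ∑ r ∈ Bᶜ.map Fin.valEmbedding, x r 0 = (#Bᶜ : ℝ) := by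
      rw [sum_map]
      simp only [Fin.valEmbedding_apply]
      rw [sum_congr rfl fun (r : Fin k) _ => hx r r.2]
      simp
    rw [← Fin.prod_univ_eq_prod_range (fun l => (∑ r ∈ Bᶜ.map Fin.valEmbedding, x r (J t l)) /
      ∑ r ∈ Bᶜ.map Fin.valEmbedding, x r 0) k]
    have e1 : (#Bᶜ : ℝ) ^ k = ∏ _l : Fin k, (#Bᶜ : ℝ) := by simp
    rw [e1, ← prod_mul_distrib]
    refine prod_congr rfl fun l _ => ?_
    rw [e0, sum_map]
    by_cases hB : (#Bᶜ : ℝ) = 0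
    · have : Bᶜ = ∅ := card_eq_zero.1 (by exact_mod_cast hB)
      simp [this]
    · rw [mul_div_cancel₀ _ hB]
      rfl
  have h2 : ∑ t ∈ range T, coef t * ∑ τ : Equiv.Perm (Fin k), ∏ l, x (τ l) (J t l) =
      ∑ B : Finset (Fin k), (-1 : ℝ) ^ #B * ((#Bᶜ : ℝ) ^ k *
        rowGain T k J coef fun i => ∑ r ∈ Bᶜ.map Fin.valEmbedding, x r i) := by
    have h3 : ∀ B : Finset (Fin k), (-1 : ℝ) ^ #B * ((#Bᶜ : ℝ) ^ k *
        rowGain T k J coef fun i => ∑ r ∈ Bᶜ.map Fin.valEmbedding, x r i) =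
        ∑ t ∈ range T, (-1 : ℝ) ^ #B * (coef t * ∏ l : Fin k, ∑ r ∈ Bᶜ, x r (J t l)) :=
      fun B => by rw [← h1, mul_sum]
    simp only [h3]
    rw [sum_comm]
    refine sum_congr rfl fun t _ => ?_
    have := sum_neg_one_pow_card_mul_prod_sum_compl fun r l : Fin k => x r (J t l)
    rw [← this, mul_sum]
    exact sum_congr rfl fun B _ => by ring
  rw [h2]
  refine (abs_sum_le_sum_abs _ _).trans ?_
  refine le_trans (sum_le_sum fun B _ => ?_) ((sum_mul _ _ _).symm.le.trans
    (mul_le_mul_of_nonneg_right (sum_card_pow_le hk) hG0))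
  rw [abs_mul, abs_mul, abs_pow, abs_neg, abs_one, one_pow, one_mul, abs_of_nonneg (by positivity)]
  refine mul_le_mul_of_nonneg_left (hG _ fun r hr => ?_) (by positivity)
  obtain ⟨r', -, rfl⟩ := mem_map.1 hr
  exact mem_range.2 r'.2

end RealRAM

/-! ## A norm inequality of Bohnenblust-Hille type -/

open Finset

/-- The root of the total squared coefficient of the strings with letter `c` at qubit `i`. -/
noncomputable def letterNorm {n : ℕ} (α : PauliString n → ℝ) (i : Fin n) (c : Fin 4) : ℝ :=
  √(∑ P with P i = c, α P ^ 2)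

/-- The sum of the `letterNorm`s over all qubits and nontrivial letters. -/
noncomputable def totalLetterNorm {n : ℕ} (α : PauliString n → ℝ) : ℝ :=
  ∑ i, ∑ c ∈ univ.erase 0, letterNorm α i c

theorem letterNorm_nonneg {n : ℕ} (α : PauliString n → ℝ) (i : Fin n) (c : Fin 4) :
    0 ≤ letterNorm α i c := Real.sqrt_nonneg _

theorem letterNorm_le_total {n : ℕ} (α : PauliString n → ℝ) (i : Fin n) {c : Fin 4}
    (hc : c ≠ 0) : letterNorm α i c ≤ totalLetterNorm α := by
  have h1 := single_le_sum (f := fun c => letterNorm α i c) (s := univ.erase 0)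
    (fun c _ => letterNorm_nonneg α i c) (mem_erase.2 ⟨hc, mem_univ c⟩)
  have h2 := single_le_sum (f := fun i => ∑ c ∈ univ.erase 0, letterNorm α i c) (s := univ)
    (fun i _ => sum_nonneg fun c _ => letterNorm_nonneg α i c) (mem_univ i)
  exact h1.trans h2

theorem abs_le_letterNorm {n : ℕ} (α : PauliString n → ℝ) (P : PauliString n) (i : Fin n) :
    |α P| ≤ letterNorm α i (P i) := by
  refine Real.le_sqrt_of_sq_le ?_
  rw [sq_abs]
  exact single_le_sum (f := fun P => α P ^ 2) (fun _ _ => sq_nonneg _) (by simp)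

theorem sum_prod_support {n : ℕ} (w : Fin n → Fin 4 → ℝ) :
    ∑ P : PauliString n, ∏ i ∈ pauliSupport P, w i (P i) =
      ∏ i, (1 + ∑ c ∈ univ.erase 0, w i c) := by
  have h1 : ∀ i, 1 + ∑ c ∈ univ.erase 0, w i c = ∑ c : Fin 4, if c ≠ 0 then w i c else 1 := by
    intro i
    rw [← add_sum_erase univ _ (mem_univ (0 : Fin 4))]
    congr 1
  simp only [h1]
  rw [prod_univ_sum, Fintype.piFinset_univ]
  refine sum_congr rfl fun P _ => ?_
  rw [pauliSupport, prod_filter]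

theorem sum_sq_mul_sum_inv {n : ℕ} (α : PauliString n → ℝ) :
    ∑ P, α P ^ 2 * ∑ i ∈ pauliSupport P, (letterNorm α i (P i))⁻¹ = totalLetterNorm α := by
  have h1 : ∀ P : PauliString n, α P ^ 2 * ∑ i ∈ pauliSupport P, (letterNorm α i (P i))⁻¹ =
      ∑ i, ∑ c ∈ univ.erase 0, if P i = c then α P ^ 2 * (letterNorm α i c)⁻¹ else 0 := by
    intro P
    rw [mul_sum, pauliSupport, sum_filter]
    refine sum_congr rfl fun i _ => ?_
    rw [sum_ite_eq]
    simp
  simp only [h1]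
  rw [sum_comm]
  refine sum_congr rfl fun i _ => ?_
  rw [sum_comm]
  refine sum_congr rfl fun c _ => ?_
  rw [← sum_filter, ← sum_mul]
  have h2 : ∑ P : PauliString n with P i = c, α P ^ 2 = letterNorm α i c ^ 2 :=
    (Real.sq_sqrt (sum_nonneg fun _ _ => sq_nonneg _)).symm
  rw [h2]
  by_cases h : letterNorm α i c = 0
  · simp [h]
  · field_simp

theorem sum_rpow_le_of_total_eq_one {n k : ℕ} (hk : 1 ≤ k) {α : PauliString n → ℝ}
    (hα : IsKLocal k α) (h1 : totalLetterNorm α = 1) :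
    ∑ P with P ≠ 0, |α P| ^ (2 * (k : ℝ) / ((k : ℝ) + 1)) ≤ 3 / 2 := by
  have hk' : (1 : ℝ) ≤ k := by exact_mod_cast hk
  have hterm : ∀ P : PauliString n, P ≠ 0 → |α P| ^ (2 * (k : ℝ) / ((k : ℝ) + 1)) ≤
      k / (k + 1) * (α P ^ 2 * ∑ i ∈ pauliSupport P, (letterNorm α i (P i))⁻¹) +
        1 / (k + 1) * ∏ i ∈ pauliSupport P, letterNorm α i (P i) := by
    intro P hP
    have hw0 : ∀ i, 0 ≤ letterNorm α i (P i) := fun i => letterNorm_nonneg _ _ _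
    by_cases h0 : α P = 0
    · have hr : 2 * (k : ℝ) / (k + 1) ≠ 0 := by positivity
      rw [h0, abs_zero, Real.zero_rpow hr]
      rw [zero_pow two_ne_zero, zero_mul, mul_zero, zero_add]
      exact mul_nonneg (by positivity) (prod_nonneg fun i _ => hw0 i)
    have hcard : (pauliSupport P).card ≤ k := by
      by_contra h
      exact h0 (hα P (not_le.1 h))
    have hw : ∀ i, 0 < letterNorm α i (P i) := fun i =>
      (abs_pos.2 h0).trans_le (abs_le_letterNorm α P i)
    obtain ⟨i₀, hi₀⟩ : (pauliSupport P).Nonempty := by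
      obtain ⟨i, hi⟩ := Function.ne_iff.1 hP
      exact ⟨i, by simpa [pauliSupport] using hi⟩
    set u := ∑ i ∈ pauliSupport P, (letterNorm α i (P i))⁻¹ with hu
    have hle : ∀ i ∈ pauliSupport P, (letterNorm α i (P i))⁻¹ ≤ u := fun i hi =>
      single_le_sum (f := fun i => (letterNorm α i (P i))⁻¹)
        (fun i _ => inv_nonneg.2 (hw0 i)) hi
    have hu1 : 1 ≤ u := by
      refine le_trans ?_ (hle i₀ hi₀)
      rw [one_le_inv₀ (hw i₀), ← h1]
      exact letterNorm_le_total α i₀ (by simpa [pauliSupport] using hi₀)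
    have hu0 : 0 < u := by linarith
    have hy := Real.geom_mean_le_arith_mean2_weighted (w₁ := (k : ℝ) / (k + 1))
      (w₂ := 1 / ((k : ℝ) + 1)) (p₁ := α P ^ 2 * u) (p₂ := u⁻¹ ^ k) (by positivity)
      (by positivity) (by positivity) (by positivity) (by field_simp)
    have e1 : (α P ^ 2 * u) ^ ((k : ℝ) / (k + 1)) * (u⁻¹ ^ k) ^ (1 / ((k : ℝ) + 1)) =
        |α P| ^ (2 * (k : ℝ) / ((k : ℝ) + 1)) := by
      rw [← sq_abs, Real.mul_rpow (by positivity) hu0.le, ← Real.rpow_natCast (|α P|),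
        ← Real.rpow_natCast u⁻¹, ← Real.rpow_mul (abs_nonneg _), ← Real.rpow_mul (by positivity),
        Real.inv_rpow hu0.le, mul_assoc]
      have : (k : ℝ) * (1 / (k + 1)) = k / (k + 1) := by ring
      rw [this, mul_inv_cancel₀ (by positivity), mul_one]
      congr 1
      push_cast
      ring
    rw [e1] at hy
    refine hy.trans ?_
    gcongr
    calc u⁻¹ ^ k ≤ u⁻¹ ^ (pauliSupport P).card :=
          pow_le_pow_of_le_one (by positivity) (inv_le_one_of_one_le₀ hu1) hcard
      _ = ∏ _i ∈ pauliSupport P, u⁻¹ := by rw [prod_const]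
      _ ≤ _ := prod_le_prod (fun _ _ => by positivity) fun i hi => by
          rw [inv_le_comm₀ hu0 (hw i)]
          exact hle i hi
  have hexp : ∑ P : PauliString n with P ≠ 0, ∏ i ∈ pauliSupport P, letterNorm α i (P i) ≤ 2 := by
    have h2 := sum_prod_support (letterNorm α)
    have h3 : ∏ i, (1 + ∑ c ∈ univ.erase 0, letterNorm α i c) ≤ Real.exp 1 := by
      have he : Real.exp 1 = ∏ i, Real.exp (∑ c ∈ univ.erase 0, letterNorm α i c) := by
        rw [← Real.exp_sum]
        congr 1
        exact h1.symm
      rw [he]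
      refine prod_le_prod (fun i _ => ?_) fun i _ => ?_
      · have := sum_nonneg fun c (_ : c ∈ univ.erase 0) => letterNorm_nonneg α i c
        positivity
      · rw [add_comm]
        exact Real.add_one_le_exp _
    have h4 : ∑ P : PauliString n, ∏ i ∈ pauliSupport P, letterNorm α i (P i) =
        1 + ∑ P : PauliString n with P ≠ 0, ∏ i ∈ pauliSupport P, letterNorm α i (P i) := by
      rw [← add_sum_erase univ _ (mem_univ (0 : PauliString n)), filter_ne' univ 0]
      simp [pauliSupport]
    linarith [Real.exp_one_lt_d9]
  calc ∑ P with P ≠ 0, |α P| ^ (2 * (k : ℝ) / ((k : ℝ) + 1))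
      ≤ ∑ P with P ≠ 0,
        (k / (k + 1) * (α P ^ 2 * ∑ i ∈ pauliSupport P, (letterNorm α i (P i))⁻¹) +
          1 / (k + 1) * ∏ i ∈ pauliSupport P, letterNorm α i (P i)) :=
        sum_le_sum fun P hP => hterm P (by simpa using hP)
    _ ≤ k / (k + 1) * 1 + 1 / (k + 1) * 2 := by
        rw [sum_add_distrib, ← mul_sum, ← mul_sum]
        gcongr
        rw [← h1, ← sum_sq_mul_sum_inv]
        refine sum_le_sum_of_subset_of_nonneg (filter_subset _ _) fun P _ _ => ?_
        have := sum_nonneg fun i (_ : i ∈ pauliSupport P) =>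
          inv_nonneg.2 (letterNorm_nonneg α i (P i))
        positivity
    _ ≤ 3 / 2 := by
        have e : (k : ℝ) / (k + 1) * 1 + 1 / (k + 1) * 2 = (k + 2) / (k + 1) := by ring
        rw [e, div_le_div_iff₀ (by positivity) (by norm_num)]
        linarith

theorem rpow_sum_le_totalLetterNorm {n k : ℕ} (hk : 1 ≤ k) {α : PauliString n → ℝ}
    (hα : IsKLocal k α) :
    (∑ P with P ≠ 0, |α P| ^ (2 * (k : ℝ) / ((k : ℝ) + 1))) ^ (((k : ℝ) + 1) / (2 * (k : ℝ))) ≤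
      3 / 2 * totalLetterNorm α := by
  have hk' : (1 : ℝ) ≤ k := by exact_mod_cast hk
  have hN : 0 ≤ totalLetterNorm α :=
    sum_nonneg fun i _ => sum_nonneg fun c _ => letterNorm_nonneg α i c
  have hr : 2 * (k : ℝ) / (k + 1) ≠ 0 := by positivity
  have hs : ((k : ℝ) + 1) / (2 * k) ≠ 0 := by positivity
  have hrs : 2 * (k : ℝ) / (k + 1) * (((k : ℝ) + 1) / (2 * k)) = 1 := by field_simp
  rcases hN.eq_or_lt with h | h
  · have h0 : ∀ P : PauliString n, P ≠ 0 → α P = 0 := by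
      intro P hP
      obtain ⟨i, hi⟩ := Function.ne_iff.1 hP
      have h1 := (abs_le_letterNorm α P i).trans (letterNorm_le_total α i hi)
      rw [← h] at h1
      exact abs_eq_zero.1 (le_antisymm h1 (abs_nonneg _))
    rw [sum_eq_zero, Real.zero_rpow hs, ← h, mul_zero]
    intro P hP
    rw [h0 P (by simpa using hP), abs_zero, Real.zero_rpow hr]
  · set N := totalLetterNorm α with hNdef
    have hl : ∀ i c, letterNorm (fun P => α P / N) i c = letterNorm α i c / N := fun i c => by
      simp only [letterNorm, div_pow]
      rw [← sum_div, Real.sqrt_div (sum_nonneg fun _ _ => sq_nonneg _), Real.sqrt_sq h.le]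
    have ht : totalLetterNorm (fun P => α P / N) = 1 := by
      simp only [totalLetterNorm, hl, ← sum_div]
      exact div_self h.ne'
    have h2 := sum_rpow_le_of_total_eq_one hk (α := fun P => α P / N)
      (fun P hP => by simp [hα P hP]) ht
    have e : ∑ P with P ≠ 0, |α P| ^ (2 * (k : ℝ) / ((k : ℝ) + 1)) =
        N ^ (2 * (k : ℝ) / ((k : ℝ) + 1)) *
          ∑ P with P ≠ 0, |α P / N| ^ (2 * (k : ℝ) / ((k : ℝ) + 1)) := by
      rw [mul_sum]
      refine sum_congr rfl fun P _ => ?_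
      rw [abs_div, abs_of_pos h, Real.div_rpow (abs_nonneg _) h.le]
      field_simp
    rw [e, Real.mul_rpow (by positivity) (sum_nonneg fun _ _ => by positivity),
      ← Real.rpow_mul h.le, hrs, Real.rpow_one, mul_comm]
    gcongr
    refine (Real.rpow_le_rpow (sum_nonneg fun _ _ => by positivity) h2 (by positivity)).trans ?_
    refine Real.rpow_le_self_of_one_le (by norm_num) ?_
    rw [div_le_one (by positivity)]
    linarith

/-! ## Independent rounding -/

namespace RealRAM

open Finset

theorem roundSign_eq (m u : ℝ) : roundSign m u = 1 ∨ roundSign m u = -1 := by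
  unfold roundSign
  split_ifs <;> simp

theorem measurable_roundSign (m : ℝ) : Measurable (roundSign m) :=
  Measurable.ite (measurableSet_lt (by fun_prop) (by fun_prop)) measurable_const measurable_const

theorem integral_roundSign {m : ℝ} (hm : |m| ≤ 1) :
    ∫ u : unitInterval, roundSign m u = m := by
  rw [abs_le] at hm
  have hx : (1 + m) / 2 ∈ unitInterval := ⟨by linarith, by linarith⟩
  have h1 : (fun u : unitInterval => roundSign m u) = fun u =>
      (Set.Iio (⟨(1 + m) / 2, hx⟩ : unitInterval)).indicator (fun _ => (2 : ℝ)) u - 1 := by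
    funext u
    by_cases hu : (u : ℝ) + u < 1 + m
    · rw [roundSign, if_pos hu, Set.indicator_of_mem]
      · norm_num
      · rw [Set.mem_Iio, ← Subtype.coe_lt_coe]
        change (u : ℝ) < (1 + m) / 2
        linarith
    · rw [roundSign, if_neg hu, Set.indicator_of_notMem]
      · norm_num
      · rw [Set.mem_Iio, ← Subtype.coe_lt_coe]
        change ¬ ((u : ℝ) < (1 + m) / 2)
        intro h
        exact hu (by linarith)
  rw [h1, integral_sub ((integrable_const _).indicator measurableSet_Iio) (integrable_const _),
    integral_indicator_const _ measurableSet_Iio, Measure.real, unitInterval.volume_Iio,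
    ENNReal.toReal_ofReal hx.1]
  simp

instance : IsProbabilityMeasure tapeLaw := by
  unfold tapeLaw
  infer_instance

theorem integral_prod_tape {n : ℕ} {g : Fin n → unitInterval → ℝ} (hg : ∀ i, Measurable (g i))
    {idx : Fin n → ℕ} (hidx : Function.Injective idx) :
    ∫ ω, ∏ i, g i (ω (idx i)) ∂tapeLaw = ∏ i, ∫ u, g i u := by
  have h1 : ProbabilityTheory.iIndepFun (fun i (ω : Tape) => ω (idx i)) tapeLaw :=
    ProbabilityTheory.iIndepFun.precomp hidx (ProbabilityTheory.iIndepFun_infinitePi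
      (P := fun _ : ℕ => (volume : Measure unitInterval)) (X := fun _ u => u)
      fun _ => measurable_id)
  rw [h1.integral_fun_prod_comp (fun i => (measurable_pi_apply _).aemeasurable)
    fun i => (hg i).aestronglyMeasurable]
  refine prod_congr rfl fun i _ => ?_
  have h2 := measurePreserving_eval_infinitePi
    (fun _ : ℕ => (volume : Measure unitInterval)) (idx i)
  rw [← h2.map_eq, integral_map h2.measurable.aemeasurable (hg i).aestronglyMeasurable]
  rfl

/-- The random signs for qubit `i`, with means `m (3 i + c)`. -/
noncomputable def tapeSigns (m : ℕ → ℝ) (ω : Tape) (i : ℕ) (c : ℕ) : ℝ :=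
  roundSign (m (3 * i + c)) (ω (3 * i + (c - 1)))

/-- The Bloch coordinates of a qubit with random signs. -/
noncomputable def tapeBloch {n : ℕ} (m : ℕ → ℝ) (ω : Tape) (i : Fin n) (c : Fin 4) : ℝ :=
  if c = 0 then 1 else tapeSigns m ω i c / √3

theorem energy_cornerState {n : ℕ} (α : PauliString n → ℝ) (m : ℕ → ℝ) (ω : Tape) :
    energy (hamiltonian α) (productState fun i : Fin n => cornerState (tapeSigns m ω i)) =
      ∑ P, α P * ∏ i, tapeBloch m ω i (P i) :=
  energy_hamiltonian_productState α _ _ fun _ c =>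
    qubitMean_cornerState (fun _ => roundSign_eq _ _) c

theorem measurable_tapeBloch {n : ℕ} (m : ℕ → ℝ) (i : Fin n) (c : Fin 4) :
    Measurable fun ω => tapeBloch m ω i c := by
  unfold tapeBloch
  split_ifs
  · exact measurable_const
  · have h : Measurable fun ω : Tape => (ω (3 * (i : ℕ) + ((c : ℕ) - 1)) : ℝ) :=
      measurable_subtype_coe.comp (measurable_pi_apply _)
    exact ((measurable_roundSign _).comp h).div_const _

theorem abs_tapeBloch_le {n : ℕ} (m : ℕ → ℝ) (ω : Tape) (i : Fin n) (c : Fin 4) :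
    |tapeBloch m ω i c| ≤ 1 := by
  unfold tapeBloch
  split_ifs
  · simp
  · have h : |tapeSigns m ω i c| = 1 := by
      rcases roundSign_eq (m (3 * i + c)) (ω (3 * i + (c - 1))) with h | h <;>
        simp [tapeSigns, h]
    rw [abs_div, h, abs_of_nonneg (Real.sqrt_nonneg _), div_le_one (by positivity),
      Real.le_sqrt (by norm_num) (by norm_num)]
    norm_num

theorem integrable_prod_tapeBloch {n : ℕ} (m : ℕ → ℝ) (P : PauliString n) :
    Integrable (fun ω => ∏ i, tapeBloch m ω i (P i)) tapeLaw := by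
  refine Integrable.of_bound
    (Finset.measurable_fun_prod _ fun i _ => measurable_tapeBloch m i (P i)).aestronglyMeasurable
    1 (Filter.Eventually.of_forall fun ω => ?_)
  rw [Real.norm_eq_abs, abs_prod]
  exact prod_le_one (fun _ _ => abs_nonneg _) fun i _ => abs_tapeBloch_le m ω i (P i)

theorem integral_prod_tapeBloch {n : ℕ} {m : ℕ → ℝ} (hm : ∀ j < 3 * n + 1, |m j| ≤ 1)
    (P : PauliString n) :
    ∫ ω, ∏ i, tapeBloch m ω i (P i) ∂tapeLaw =
      ∏ i ∈ pauliSupport P, m (3 * i + P i) / √3 := by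
  have hidx : Function.Injective fun i : Fin n => 3 * (i : ℕ) + ((P i : ℕ) - 1) := by
    intro i j h
    have h : 3 * (i : ℕ) + ((P i : ℕ) - 1) = 3 * (j : ℕ) + ((P j : ℕ) - 1) := h
    have hi := (P i).2
    have hj := (P j).2
    exact Fin.ext (by omega)
  have := integral_prod_tape (g := fun i u => if P i = 0 then 1 else
    roundSign (m (3 * i + P i)) u / √3) (fun i => ?_) hidx
  · refine this.trans ?_
    rw [pauliSupport, prod_filter]
    refine prod_congr rfl fun i _ => ?_
    by_cases h : P i = 0
    · simp [h]
    · simp only [h, if_false, ne_eq, not_false_eq_true, if_true]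
      rw [integral_div, integral_roundSign (hm _ ?_)]
      have := i.2
      have := (P i).2
      omega
  · by_cases h : P i = 0
    · simp [h]
    · simp only [h, if_false]
      exact ((measurable_roundSign _).comp measurable_subtype_coe).div_const _

theorem integrable_energy_cornerState {n : ℕ} (α : PauliString n → ℝ) (m : ℕ → ℝ) :
    Integrable (fun ω => energy (hamiltonian α)
      (productState fun i : Fin n => cornerState (tapeSigns m ω i))) tapeLaw := by
  simp only [energy_cornerState]
  exact integrable_finsetSum _ fun P _ => (integrable_prod_tapeBloch m P).const_mul _

theorem integral_energy_cornerState {n : ℕ} (α : PauliString n → ℝ) {m : ℕ → ℝ}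
    (hm : ∀ j < 3 * n + 1, |m j| ≤ 1) :
    ∫ ω, energy (hamiltonian α)
      (productState fun i : Fin n => cornerState (tapeSigns m ω i)) ∂tapeLaw - α 0 =
      ∑ P with P ≠ 0, α P / √3 ^ pauliWeight P * ∏ i ∈ pauliSupport P, m (3 * i + P i) := by
  simp only [energy_cornerState]
  rw [integral_finsetSum _ fun P _ => (integrable_prod_tapeBloch m P).const_mul _]
  simp only [integral_const_mul, integral_prod_tapeBloch hm]
  rw [← add_sum_erase univ _ (mem_univ (0 : PauliString n)), filter_ne' univ 0]
  have h0 : pauliSupport (0 : PauliString n) = ∅ := by simp [pauliSupport]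
  rw [h0, prod_empty, mul_one, add_sub_cancel_left]
  refine sum_congr rfl fun P _ => ?_
  rw [prod_div_distrib, prod_const, pauliWeight]
  ring

end RealRAM

/-! ## The code of a tuple determines it up to order -/

open Finset

theorem mem_of_dvd_prod_one_add_mul {D k X j : ℕ} (hX : D ^ k ≤ X) (hj : 0 < j) (hjD : j < D)
    {t : Multiset ℕ} (ht : ∀ i ∈ t, i < D) (htk : Multiset.card t ≤ k)
    (h : 1 + j * X ∣ (t.map fun i => 1 + i * X).prod) : j ∈ t := by
  have h1 : (1 + j * X : ℤ) ∣ (t.map fun i : ℕ => (j : ℤ) - i).prod := by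
    have h2 : ((1 + j * X : ℕ) : ℤ) ∣ (j : ℤ) ^ Multiset.card t *
        ((t.map fun i => 1 + i * X).prod : ℕ) :=
      Dvd.dvd.mul_left (Int.natCast_dvd_natCast.2 h) _
    have h3 : ∀ t : Multiset ℕ, (1 + j * X : ℤ) ∣ (j : ℤ) ^ Multiset.card t *
        ((t.map fun i => 1 + i * X).prod : ℕ) - (t.map fun i : ℕ => (j : ℤ) - i).prod := by
      intro t
      induction t using Multiset.induction_on with
      | empty => simp
      | cons i t ih =>
        obtain ⟨u, hu⟩ := ih
        simp only [Multiset.map_cons, Multiset.prod_cons, Multiset.card_cons, Nat.cast_mul,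
          pow_succ]
        refine ⟨(i : ℤ) * ((j : ℤ) ^ Multiset.card t *
          ((t.map fun i => 1 + i * X).prod : ℕ)) + (j - i) * u, ?_⟩
        push_cast at hu ⊢
        linear_combination ((j : ℤ) - i) * hu
    have h4 := h3 t
    push_cast at h2 h4
    exact (dvd_sub_right h2).1 h4
  have h5 : ∀ t : Multiset ℕ, (∀ i ∈ t, i < D) →
      |(t.map fun i : ℕ => (j : ℤ) - i).prod| ≤ (D : ℤ) ^ Multiset.card t := by
    intro t
    induction t using Multiset.induction_on with
    | empty => simp
    | cons i t ih =>
      intro ht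
      simp only [Multiset.map_cons, Multiset.prod_cons, Multiset.card_cons, abs_mul, pow_succ']
      have hi := ht i (Multiset.mem_cons_self i t)
      have : |(j : ℤ) - i| ≤ D := by
        rw [abs_le]
        constructor <;> omega
      exact mul_le_mul this (ih fun i hi => ht i (Multiset.mem_cons_of_mem hi)) (abs_nonneg _)
        (by positivity)
  have h6 : (t.map fun i : ℕ => (j : ℤ) - i).prod = 0 := by
    refine Int.eq_zero_of_abs_lt_dvd h1 ((h5 t ht).trans_lt ?_)
    have h7 : D ^ Multiset.card t ≤ D ^ k := Nat.pow_le_pow_right (by omega) htk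
    have h8 : X ≤ j * X := Nat.le_mul_of_pos_left X hj
    have : D ^ Multiset.card t < 1 + j * X := by omega
    exact_mod_cast this
  rw [Multiset.prod_eq_zero_iff, Multiset.mem_map] at h6
  obtain ⟨i, hi, h9⟩ := h6
  have : j = i := by omega
  rwa [this]

theorem eq_of_prod_one_add_mul_eq {D k X : ℕ} (hX : D ^ k ≤ X) {s t : Multiset ℕ}
    (hs : ∀ i ∈ s, 0 < i ∧ i < D) (ht : ∀ i ∈ t, 0 < i ∧ i < D) (htk : Multiset.card t ≤ k)
    (h : (s.map fun i => 1 + i * X).prod = (t.map fun i => 1 + i * X).prod) : s = t := by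
  induction s using Multiset.induction_on generalizing t with
  | empty =>
    by_contra hne
    obtain ⟨i, hi⟩ := Multiset.exists_mem_of_ne_zero (Ne.symm hne)
    have h1 : 1 + i * X ∣ (t.map fun i => 1 + i * X).prod :=
      Multiset.dvd_prod (Multiset.mem_map_of_mem _ hi)
    rw [← h, Multiset.map_zero, Multiset.prod_zero, Nat.dvd_one] at h1
    have hX0 : 0 < X := lt_of_lt_of_le (Nat.pow_pos (by have := ht i hi; omega)) hX
    have := Nat.mul_pos (ht i hi).1 hX0
    omega
  | cons j s ih =>
    have hj := hs j (Multiset.mem_cons_self j s)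
    rw [Multiset.map_cons, Multiset.prod_cons] at h
    have hjt : j ∈ t := mem_of_dvd_prod_one_add_mul hX hj.1 hj.2 (fun i hi => (ht i hi).2) htk
      ⟨_, h.symm⟩
    obtain ⟨t', rfl⟩ := Multiset.exists_cons_of_mem hjt
    rw [Multiset.map_cons, Multiset.prod_cons] at h
    congr 1
    refine ih (fun i hi => hs i (Multiset.mem_cons_of_mem hi))
      (fun i hi => ht i (Multiset.mem_cons_of_mem hi)) ?_ (Nat.eq_of_mul_eq_mul_left (by omega) h)
    rw [Multiset.card_cons] at htk
    omega

theorem exists_perm_of_map_univ_eq {ι β : Type*} [Fintype ι] [DecidableEq β] {f g : ι → β}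
    (h : (univ : Finset ι).val.map f = (univ : Finset ι).val.map g) :
    ∃ τ : Equiv.Perm ι, ∀ a, g (τ a) = f a := by
  have e : ∀ c, Nonempty ({a // f a = c} ≃ {b // g b = c}) := fun c => by
    refine ⟨Fintype.equivOfCardEq ?_⟩
    have h1 := congrArg (Multiset.count c) h
    rw [Multiset.count_map, Multiset.count_map] at h1
    rw [Fintype.card_subtype, Fintype.card_subtype]
    simp only [eq_comm (b := c)] at h1 ⊢
    simpa [Finset.card_def, Finset.filter_val, eq_comm] using h1
  exact ⟨Equiv.ofFiberEquiv fun c => (e c).some, fun a => Equiv.ofFiberEquiv_map _ a⟩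

theorem exists_perm_of_prod_one_add_mul_eq {D k X : ℕ} (hX : D ^ k ≤ X) {f g : Fin k → ℕ}
    (hf : ∀ l, f l < D) (hg : ∀ l, g l < D) (h : ∏ l, (1 + f l * X) = ∏ l, (1 + g l * X)) :
    ∃ τ : Equiv.Perm (Fin k), ∀ l, g (τ l) = f l := by
  refine exists_perm_of_map_univ_eq ?_
  have hprod : ∀ s : Multiset ℕ, (s.map fun i => 1 + i * X).prod =
      ((s.filter (· ≠ 0)).map fun i => 1 + i * X).prod := by
    intro s
    induction s using Multiset.induction_on with
    | empty => simp
    | cons i s ih =>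
      by_cases hi : i = 0
      · simp [hi, ih]
      · simp [hi, ih]
  have hsplit : ∀ s : Multiset ℕ, s =
      s.filter (· ≠ 0) +
        Multiset.replicate (Multiset.card s - Multiset.card (s.filter (· ≠ 0))) 0 := by
    intro s
    conv_lhs => rw [← Multiset.filter_add_not (· ≠ 0) s]
    congr 1
    have h1 := congrArg Multiset.card (Multiset.filter_add_not (· ≠ 0) s)
    rw [Multiset.card_add] at h1
    rw [Multiset.eq_replicate]
    refine ⟨by omega, fun b hb => ?_⟩
    have := (Multiset.mem_filter.1 hb).2
    simpa using this
  set s := (univ : Finset (Fin k)).val.map f with hs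
  set t := (univ : Finset (Fin k)).val.map g with ht
  have hcs : Multiset.card s = k := by simp [hs]
  have hct : Multiset.card t = k := by simp [ht]
  have h2 : s.filter (· ≠ 0) = t.filter (· ≠ 0) := by
    refine eq_of_prod_one_add_mul_eq hX (fun i hi => ?_) (fun i hi => ?_)
      ((Multiset.card_le_card (Multiset.filter_le _ _)).trans hct.le) ?_
    · rw [Multiset.mem_filter, hs, Multiset.mem_map] at hi
      obtain ⟨⟨l, -, rfl⟩, h0⟩ := hi
      exact ⟨Nat.pos_of_ne_zero h0, hf l⟩
    · rw [Multiset.mem_filter, ht, Multiset.mem_map] at hi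
      obtain ⟨⟨l, -, rfl⟩, h0⟩ := hi
      exact ⟨Nat.pos_of_ne_zero h0, hg l⟩
    · rw [← hprod, ← hprod, hs, ht, Multiset.map_map, Multiset.map_map]
      exact h
  rw [hsplit s, hsplit t, h2, hcs, hct]

theorem card_perm_comp_eq {k : ℕ} {f g : Fin k → ℕ}
    (hg : ∀ a b, g a = g b → g a ≠ 0 → a = b) (h : ∃ τ : Equiv.Perm (Fin k), ∀ l, g (τ l) = f l) :
    #{τ : Equiv.Perm (Fin k) | ∀ l, g (τ l) = f l} = (#{l | g l = 0}).factorial := by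
  obtain ⟨τ₀, h₀⟩ := h
  have h1 : #{τ : Equiv.Perm (Fin k) | ∀ l, g (τ l) = f l} =
      #{τ : Equiv.Perm (Fin k) | g ∘ τ = g} := by
    refine card_bij (fun τ _ => τ * τ₀⁻¹) (fun τ hτ => ?_) (fun τ _ τ' _ h => ?_) fun τ hτ => ?_
    · have hτ : ∀ l, g (τ l) = f l := by simpa using hτ
      rw [mem_filter]
      refine ⟨mem_univ _, funext fun l => ?_⟩
      simp [hτ, ← h₀]
    · exact mul_right_cancel h
    · have hτ : g ∘ τ = g := by simpa using hτ
      refine ⟨τ * τ₀, ?_, by simp⟩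
      rw [mem_filter]
      refine ⟨mem_univ _, fun l => ?_⟩
      rw [← h₀]
      exact congrFun hτ (τ₀ l)
  rw [h1, ← Fintype.card_subtype, DomMulAct.stabilizer_card' g]
  have h2 : ∀ c ≠ 0, (Fintype.card {a // g a = c}).factorial = 1 := by
    intro c hc
    rw [Nat.factorial_eq_one, Fintype.card_le_one_iff]
    rintro ⟨a, ha⟩ ⟨b, hb⟩
    exact Subtype.ext (hg a b (ha.trans hb.symm) (ha ▸ hc))
  by_cases h0 : 0 ∈ univ.image g
  · rw [prod_eq_single_of_mem 0 h0 fun c _ hc => h2 c hc, Fintype.card_subtype]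
  · rw [prod_eq_one fun c hc => h2 c fun h => h0 (h ▸ hc)]
    have : #{l | g l = 0} = 0 := by
      rw [card_eq_zero, filter_eq_empty_iff]
      intro l _ hl
      exact h0 (hl ▸ mem_image_of_mem g (mem_univ l))
    rw [this, Nat.factorial_zero]

theorem factorial_le_card_perm {k : ℕ} (hk : 1 ≤ k) (l : Fin k) :
    (k - 1).factorial ≤ #{τ : Equiv.Perm (Fin k) | τ ⟨0, hk⟩ = l} := by
  obtain ⟨m, rfl⟩ : ∃ m, k = m + 1 := ⟨k - 1, by omega⟩
  have h1 : #(univ : Finset (Equiv.Perm (Fin m))) = m.factorial := by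
    rw [card_univ, Fintype.card_perm, Fintype.card_fin]
  rw [Nat.add_sub_cancel, ← h1]
  refine card_le_card_of_injOn (fun e => Equiv.Perm.decomposeFin.symm (l, e)) (fun e _ => ?_)
    fun e _ e' _ h => ?_
  · simp only [coe_filter, mem_univ, true_and, Set.mem_ofPred_eq]
    exact Equiv.Perm.decomposeFin_symm_apply_zero l e
  · exact (Prod.ext_iff.1 (Equiv.Perm.decomposeFin.symm.injective h)).2

/-! ## The symmetric tensor of the terms -/

namespace RealRAM

open Finset

theorem code_eq_prod_digits {D X : ℕ} (hD : 0 < D) {cd : ℕ → ℕ} (hcd0 : cd 0 = 1)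
    (hcd : ∀ Q, ∀ j < D, cd (j + D * Q) = cd Q * (1 + j * X)) (m : ℕ) :
    ∀ q < D ^ m, cd q = ∏ l ∈ range m, (1 + q / D ^ l % D * X) := by
  induction m with
  | zero =>
    intro q hq
    obtain rfl : q = 0 := by simpa using hq
    simp [hcd0]
  | succ m ih =>
    intro q hq
    have h1 := hcd (q / D) (q % D) (Nat.mod_lt _ hD)
    rw [Nat.mod_add_div] at h1
    rw [h1, ih _ (Nat.div_lt_of_lt_mul (by rwa [← pow_succ'])), prod_range_succ']
    simp [pow_succ', Nat.div_div_eq_div_mul]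

theorem sum_range_pow {D k : ℕ} (f : ℕ → ℝ) :
    ∑ q ∈ range (D ^ k), f q =
      ∑ d : Fin k → Fin D, f (finFunctionFinEquiv d) := by
  rw [sum_range, ← Equiv.sum_comp finFunctionFinEquiv]

theorem digit_finFunctionFinEquiv {D k : ℕ} (d : Fin k → Fin D) (p : Fin k) :
    (finFunctionFinEquiv d : ℕ) / D ^ (p : ℕ) % D = d p := by
  have := congrFun (finFunctionFinEquiv.symm_apply_apply d) p
  exact congrArg Fin.val this

/-- A list of `T` tuples of `k` slots with values below `D`: a nonzero value occurs only once in a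
tuple, and no two tuples agree up to order. -/
structure SlotSystem (D k T : ℕ) (J : ℕ → ℕ → ℕ) : Prop where
  lt : ∀ t < T, ∀ l < k, J t l < D
  inj : ∀ t < T, ∀ l < k, ∀ l' < k, J t l = J t l' → J t l ≠ 0 → l = l'
  perm : ∀ t < T, ∀ s < T, ∀ τ : Equiv.Perm (Fin k), (∀ l, J t (τ l) = J s l) → t = s

/-- The number of orderings of the tuple `g` that give `d`. -/
def orderings {D k : ℕ} (g : ℕ → ℕ) (d : Fin k → Fin D) : ℕ :=
  #{τ : Equiv.Perm (Fin k) | ∀ l, g (τ l) = d l}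

theorem sum_orderings_mul {D k : ℕ} {g : ℕ → ℕ} (hg : ∀ l < k, g l < D)
    (F : (Fin k → Fin D) → ℝ) :
    ∑ d, (orderings g d : ℝ) * F d =
      ∑ τ : Equiv.Perm (Fin k), F fun l => ⟨g (τ l), hg _ (τ l).2⟩ := by
  have h : ∀ d : Fin k → Fin D, (orderings g d : ℝ) * F d = ∑ τ : Equiv.Perm (Fin k),
      if d = (fun l => ⟨g (τ l), hg _ (τ l).2⟩) then F d else 0 := by
    intro d
    rw [orderings, card_eq_sum_ones, sum_filter, Nat.cast_sum, sum_mul]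
    refine sum_congr rfl fun τ _ => ?_
    have : (∀ l, g (τ l) = d l) ↔ d = fun l => ⟨g (τ l), hg _ (τ l).2⟩ := by
      rw [funext_iff]
      exact forall_congr' fun l => by rw [Fin.ext_iff, eq_comm]
    by_cases h : d = fun l => ⟨g (τ l), hg _ (τ l).2⟩
    · rw [if_pos h, if_pos (this.2 h), Nat.cast_one, one_mul]
    · rw [if_neg h, if_neg fun h' => h (this.1 h'), Nat.cast_zero, zero_mul]
  simp only [h]
  rw [sum_comm]
  refine sum_congr rfl fun τ _ => ?_
  rw [sum_ite_eq' univ, if_pos (mem_univ _)]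

theorem inputTensor_eq {D k T : ℕ} (hD : 0 < D) {J : ℕ → ℕ → ℕ} (hJ : SlotSystem D k T J)
    (a : ℕ → ℝ) {cd : ℕ → ℕ} (hcd0 : cd 0 = 1)
    (hcd : ∀ Q, ∀ j < D, cd (j + D * Q) = cd Q * (1 + j * D ^ k)) (d : Fin k → Fin D) :
    inputTensor (D ^ k) T k J a (cd (finFunctionFinEquiv d)) =
      ∑ t ∈ range T, scaledCoef (D ^ k) (J t) k (a t) * orderings (J t) d := by
  rw [inputTensor]
  refine sum_congr rfl fun t ht => ?_
  have ht := mem_range.1 ht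
  have h1 : cd (finFunctionFinEquiv d) = ∏ l : Fin k, (1 + (d l : ℕ) * D ^ k) := by
    rw [code_eq_prod_digits hD hcd0 hcd k _ (finFunctionFinEquiv d).2,
      ← Fin.prod_univ_eq_prod_range (fun l =>
        1 + (finFunctionFinEquiv d : ℕ) / D ^ l % D * D ^ k) k]
    simp only [digit_finFunctionFinEquiv]
  have h2 : tupleCode (D ^ k) (J t) k = ∏ l : Fin k, (1 + J t l * D ^ k) := by
    rw [tupleCode, ← Fin.prod_univ_eq_prod_range (fun l => 1 + J t l * D ^ k) k]
  have h3 : emptySlots (J t) k = #{l : Fin k | J t l = 0} := by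
    rw [emptySlots, card_filter, card_filter,
      ← Fin.sum_univ_eq_sum_range (fun l => if J t l = 0 then 1 else 0) k]
  by_cases h : ∃ τ : Equiv.Perm (Fin k), ∀ l, J t (τ l) = d l
  · rw [if_pos, orderings, h3]
    · rw [← card_perm_comp_eq (g := fun l : Fin k => J t l) (f := fun l => (d l : ℕ))
        (fun a b hab h0 => Fin.ext (hJ.inj t ht a a.2 b b.2 hab h0)) h]
    · obtain ⟨τ, hτ⟩ := h
      rw [h1, h2, ← Equiv.prod_comp τ fun l : Fin k => 1 + J t l * D ^ k]
      exact prod_congr rfl fun l _ => by rw [hτ]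
  · have h0 : orderings (J t) d = 0 := by
      rw [orderings, card_eq_zero, filter_eq_empty_iff]
      exact fun τ _ hτ => h ⟨τ, hτ⟩
    rw [h0, Nat.cast_zero, mul_zero, if_neg]
    intro hc
    rw [h1, h2] at hc
    exact h (exists_perm_of_prod_one_add_mul_eq (f := fun l => (d l : ℕ))
      (g := fun l : Fin k => J t l) le_rfl (fun l => (d l).2) (fun l => hJ.lt t ht l l.2) hc)

theorem formValue_inputTensor {D k T : ℕ} (hD : 0 < D) {J : ℕ → ℕ → ℕ}
    (hJ : SlotSystem D k T J) (a : ℕ → ℝ) {cd : ℕ → ℕ} (hcd0 : cd 0 = 1)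
    (hcd : ∀ Q, ∀ j < D, cd (j + D * Q) = cd Q * (1 + j * D ^ k)) (x : ℕ → ℕ → ℝ) :
    formValue D k (fun q => inputTensor (D ^ k) T k J a (cd q)) (fun p => x (k - 1 - p)) =
      ∑ t ∈ range T, scaledCoef (D ^ k) (J t) k (a t) *
        ∑ τ : Equiv.Perm (Fin k), ∏ l : Fin k, x (τ l) (J t l) := by
  rw [formValue, sum_range_pow]
  have h1 : ∀ d : Fin k → Fin D, inputTensor (D ^ k) T k J a (cd (finFunctionFinEquiv d)) *
      ∏ p ∈ range k, x (k - 1 - p) ((finFunctionFinEquiv d : ℕ) / D ^ p % D) =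
      ∑ t ∈ range T, scaledCoef (D ^ k) (J t) k (a t) *
        (orderings (J t) d * ∏ p : Fin k, x (k - 1 - p) (d p)) := by
    intro d
    rw [inputTensor_eq hD hJ a hcd0 hcd, ← Fin.prod_univ_eq_prod_range (fun p =>
      x (k - 1 - p) ((finFunctionFinEquiv d : ℕ) / D ^ p % D)) k, sum_mul]
    simp only [digit_finFunctionFinEquiv, mul_assoc]
  simp only [h1]
  rw [sum_comm]
  refine sum_congr rfl fun t ht => ?_
  rw [← mul_sum, sum_orderings_mul (hJ.lt t (mem_range.1 ht))
    fun d => ∏ p : Fin k, x (k - 1 - p) (d p)]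
  congr 1
  refine Fintype.sum_equiv ((Equiv.inv _).trans (Equiv.mulLeft Fin.revPerm)) _ _ fun τ => ?_
  rw [← Equiv.prod_comp τ fun l : Fin k =>
    x (((Equiv.inv _).trans (Equiv.mulLeft Fin.revPerm)) τ l) (J t l)]
  refine prod_congr rfl fun p _ => ?_
  have e : ((((Equiv.inv _).trans (Equiv.mulLeft Fin.revPerm)) τ (τ p) : Fin k) : ℕ) =
      k - 1 - p := by
    simp only [Equiv.trans_apply, Equiv.inv_apply, Equiv.coe_mulLeft, Equiv.Perm.mul_apply,
      Equiv.Perm.inv_def, Equiv.symm_apply_apply, Fin.revPerm_apply, Fin.val_rev]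
    omega
  rw [e]

theorem sum_sq_eq_of_pairwise_mul_eq_zero {ι : Type*} {s : Finset ι} {f : ι → ℝ}
    (h : ∀ a ∈ s, ∀ b ∈ s, a ≠ b → f a * f b = 0) : (∑ a ∈ s, f a) ^ 2 = ∑ a ∈ s, f a ^ 2 := by
  rw [sq, sum_mul_sum]
  refine sum_congr rfl fun a ha => ?_
  rw [sum_eq_single_of_mem a ha fun b hb hba => h a ha b hb hba.symm, sq]

theorem sum_sq_slice_ge {D k T : ℕ} (hk : 1 ≤ k) {J : ℕ → ℕ → ℕ}
    (hJ : SlotSystem D k T J) (a : ℕ → ℝ) {cd : ℕ → ℕ} (hcd0 : cd 0 = 1)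
    (hcd : ∀ Q, ∀ j < D, cd (j + D * Q) = cd Q * (1 + j * D ^ k)) {c : ℕ} (hc : c < D) :
    ((k - 1).factorial : ℝ) * ∑ t ∈ range T with ∃ l < k, J t l = c,
      scaledCoef (D ^ k) (J t) k (a t) ^ 2 ≤
    ∑ R ∈ range (D ^ (k - 1)), inputTensor (D ^ k) T k J a (cd (c + D * R)) ^ 2 := by
  have hD : 0 < D := by omega
  set V : ℕ → ℝ := fun q => inputTensor (D ^ k) T k J a (cd q) with hV
  have h1 : ∑ R ∈ range (D ^ (k - 1)), V (c + D * R) ^ 2 =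
      ∑ q ∈ range (D ^ k), if q % D = c then V q ^ 2 else 0 := by
    have e : D ^ k = D * D ^ (k - 1) := by rw [← pow_succ', Nat.sub_add_cancel hk]
    rw [e, sum_range_mul', sum_eq_single_of_mem c (mem_range.2 hc)]
    · refine sum_congr rfl fun R _ => ?_
      rw [Nat.add_mul_mod_self_left, Nat.mod_eq_of_lt hc, if_pos rfl]
    · intro j hj hjc
      refine sum_eq_zero fun R _ => ?_
      rw [Nat.add_mul_mod_self_left, Nat.mod_eq_of_lt (mem_range.1 hj), if_neg hjc]
  have h2 : ∀ d : Fin k → Fin D, V (finFunctionFinEquiv d) ^ 2 =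
      ∑ t ∈ range T, (scaledCoef (D ^ k) (J t) k (a t) * orderings (J t) d) ^ 2 := by
    intro d
    rw [hV]
    simp only [inputTensor_eq hD hJ a hcd0 hcd]
    refine sum_sq_eq_of_pairwise_mul_eq_zero fun t ht s hs hts => ?_
    have h0 : orderings (J t) d = 0 ∨ orderings (J s) d = 0 := by
      by_contra! h
      obtain ⟨⟨τ, hτ⟩, σ, hσ⟩ := h.imp (fun h => card_ne_zero.1 h) fun h => card_ne_zero.1 h
      have hτ : ∀ l, J t (τ l) = d l := by simpa using hτ
      have hσ : ∀ l, J s (σ l) = d l := by simpa using hσ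
      refine hts (hJ.perm t (mem_range.1 ht) s (mem_range.1 hs) (τ * σ⁻¹) fun l => ?_)
      have := hσ (σ⁻¹ l)
      rw [← Equiv.Perm.mul_apply, mul_inv_cancel, Equiv.Perm.one_apply] at this
      rw [Equiv.Perm.mul_apply, hτ, this]
    rcases h0 with h0 | h0 <;> simp [h0]
  have h3 : ∀ d : Fin k → Fin D, (finFunctionFinEquiv d : ℕ) % D = d ⟨0, hk⟩ := fun d => by
    have := digit_finFunctionFinEquiv d ⟨0, hk⟩
    simpa using this
  have h4 : ∑ R ∈ range (D ^ (k - 1)), V (c + D * R) ^ 2 =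
      ∑ t ∈ range T, ∑ d : Fin k → Fin D, if (d ⟨0, hk⟩ : ℕ) = c then
        (scaledCoef (D ^ k) (J t) k (a t) * orderings (J t) d) ^ 2 else 0 := by
    rw [h1, sum_range_pow, sum_comm]
    refine sum_congr rfl fun d _ => ?_
    rw [h3, h2]
    split_ifs
    · rfl
    · rw [sum_const_zero]
  rw [h4, mul_sum, sum_filter]
  refine sum_le_sum fun t ht => ?_
  have ht := mem_range.1 ht
  set b := scaledCoef (D ^ k) (J t) k (a t) with hb
  split_ifs with hl
  · obtain ⟨l, hl, hlc⟩ := hl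
    have h5 : ((k - 1).factorial : ℝ) ≤
        ∑ d : Fin k → Fin D, orderings (J t) d * (if (d ⟨0, hk⟩ : ℕ) = c then 1 else 0 : ℝ) := by
      rw [sum_orderings_mul (hJ.lt t ht)
        fun d => (if (d ⟨0, hk⟩ : ℕ) = c then 1 else 0 : ℝ)]
      rw [sum_boole, Nat.cast_le]
      refine (factorial_le_card_perm hk ⟨l, hl⟩).trans (card_le_card fun τ hτ => ?_)
      rw [mem_filter] at hτ ⊢
      refine ⟨mem_univ _, ?_⟩
      change J t (τ ⟨0, hk⟩) = c
      rw [hτ.2]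
      exact hlc
    calc ((k - 1).factorial : ℝ) * b ^ 2
        ≤ (∑ d : Fin k → Fin D, orderings (J t) d *
          (if (d ⟨0, hk⟩ : ℕ) = c then 1 else 0 : ℝ)) * b ^ 2 := by gcongr
      _ ≤ _ := by
        rw [sum_mul]
        refine sum_le_sum fun d _ => ?_
        split_ifs
        · rw [mul_one, mul_pow, mul_comm]
          refine mul_le_mul_of_nonneg_left ?_ (sq_nonneg _)
          rw [← Nat.cast_pow, Nat.cast_le]
          exact Nat.le_self_pow two_ne_zero _
        · simp
  · exact sum_nonneg fun d _ => by split_ifs <;> positivity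

theorem SlotSystem.card_le {D k T : ℕ} {J : ℕ → ℕ → ℕ} (hJ : SlotSystem D k T J) :
    T ≤ D ^ k := by
  have h : Function.Injective fun (t : Fin T) (l : Fin k) =>
      (⟨J t l, hJ.lt t t.2 l l.2⟩ : Fin D) := by
    intro t s h
    refine Fin.ext (hJ.perm t t.2 s s.2 1 fun l => ?_)
    exact congrArg Fin.val (congrFun h l)
  have := Fintype.card_le_of_injective _ h
  simpa using this

end RealRAM

/-! ## Slots of Pauli strings -/

namespace RealRAM

open Finset

/-- The index `3 i + P i` of the `l`-th letter of `P`, at qubit `i`, or `0` if there is none. -/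
def slotIndex {n : ℕ} (P : PauliString n) (l : ℕ) : ℕ :=
  match slot P l with
  | none => 0
  | some i => 3 * i + P i

theorem slotIndex_of_some {n : ℕ} {P : PauliString n} {l : ℕ} {i : Fin n} (h : slot P l = some i) :
    slotIndex P l = 3 * i + P i := by
  simp [slotIndex, h]

theorem slotIndex_of_none {n : ℕ} {P : PauliString n} {l : ℕ} (h : slot P l = none) :
    slotIndex P l = 0 := by
  simp [slotIndex, h]

theorem val_pos_of_slot {n : ℕ} {P : PauliString n} {l : ℕ} {i : Fin n} (h : slot P l = some i) :
    P i ≠ 0 := by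
  have h1 : i ∈ (pauliSupport P).sort := List.mem_of_getElem? h
  simpa [pauliSupport] using h1

theorem slotIndex_lt {n : ℕ} (P : PauliString n) (l : ℕ) : slotIndex P l < 3 * n + 1 := by
  rcases h : slot P l with _ | i
  · rw [slotIndex_of_none h]
    omega
  · rw [slotIndex_of_some h]
    have := (P i).2
    have := i.2
    omega

theorem slotIndex_inj {n : ℕ} {P : PauliString n} {l l' : ℕ} (h : slotIndex P l = slotIndex P l')
    (h0 : slotIndex P l ≠ 0) : l = l' := by
  rcases h1 : slot P l with _ | i
  · exact absurd (slotIndex_of_none h1) h0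
  rcases h2 : slot P l' with _ | i'
  · exact absurd (h.trans (slotIndex_of_none h2)) h0
  rw [slotIndex_of_some h1, slotIndex_of_some h2] at h
  have e1 := val_pos_of_slot h1
  have e2 := val_pos_of_slot h2
  rw [← Fin.val_ne_zero_iff] at e1 e2
  have := (P i).2
  have := (P i').2
  have e : i = i' := Fin.ext (by omega)
  subst e
  obtain ⟨hl, -⟩ := List.getElem?_eq_some_iff.1 h1
  exact (List.getElem?_inj hl (Finset.sort_nodup _ _)).1 (h1.trans h2.symm)

theorem exists_slotIndex_eq_iff {n k : ℕ} {P : PauliString n} (hP : pauliWeight P ≤ k) (i : Fin n)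
    {c : Fin 4} (hc : c ≠ 0) : (∃ l < k, slotIndex P l = 3 * i + c) ↔ P i = c := by
  rw [← Fin.val_ne_zero_iff] at hc
  constructor
  · rintro ⟨l, -, hl⟩
    rcases h1 : slot P l with _ | j
    · rw [slotIndex_of_none h1] at hl
      omega
    · rw [slotIndex_of_some h1] at hl
      have e1 := val_pos_of_slot h1
      rw [← Fin.val_ne_zero_iff] at e1
      have := (P j).2
      have := c.2
      have e : j = i := Fin.ext (by omega)
      subst e
      exact Fin.ext (by omega)
  · rintro rfl
    have h1 : i ∈ (pauliSupport P).sort := by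
      rw [Finset.mem_sort, pauliSupport, mem_filter]
      exact ⟨mem_univ _, Fin.val_ne_zero_iff.1 hc⟩
    obtain ⟨l, hl, hi⟩ := List.mem_iff_getElem.1 h1
    have hl' := hl
    rw [Finset.length_sort] at hl'
    refine ⟨l, hl'.trans_le hP, slotIndex_of_some ?_⟩
    rw [slot, List.getElem?_eq_getElem hl, hi]

theorem eq_of_perm_slotIndex {n k : ℕ} {P Q : PauliString n} (hP : pauliWeight P ≤ k)
    (hQ : pauliWeight Q ≤ k) (τ : Equiv.Perm (Fin k))
    (h : ∀ l, slotIndex P (τ l) = slotIndex Q l) : P = Q := by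
  have h1 : ∀ (i : Fin n) (c : Fin 4), c ≠ 0 → (P i = c ↔ Q i = c) := by
    intro i c hc
    rw [← exists_slotIndex_eq_iff hP i hc, ← exists_slotIndex_eq_iff hQ i hc]
    constructor
    · rintro ⟨l, hl, e⟩
      refine ⟨τ.symm ⟨l, hl⟩, (τ.symm ⟨l, hl⟩).2, ?_⟩
      rw [← h, Equiv.apply_symm_apply]
      exact e
    · rintro ⟨l, hl, e⟩
      exact ⟨τ ⟨l, hl⟩, (τ ⟨l, hl⟩).2, (h _).trans e⟩
  funext i
  by_cases hp : P i = 0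
  · by_cases hq : Q i = 0
    · rw [hp, hq]
    · exact (h1 i _ hq).2 rfl
  · exact ((h1 i _ hp).1 rfl).symm

@[to_additive]
theorem prod_range_getElem? {β M : Type*} [CommMonoid M] (f : β → M) (L : List β) {k : ℕ}
    (hk : L.length ≤ k) : ∏ l ∈ range k, (L[l]?).elim 1 f = (L.map f).prod := by
  induction L generalizing k with
  | nil => simp
  | cons b L ih =>
    obtain ⟨m, rfl⟩ : ∃ m, k = m + 1 := ⟨k - 1, by simp at hk; omega⟩
    rw [prod_range_succ', List.map_cons, List.prod_cons, mul_comm]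
    congr 1
    rw [← ih (k := m) (by simpa using hk)]
    rfl

theorem prod_slotIndex {M : Type*} [CommMonoid M] {n k : ℕ} {P : PauliString n}
    (hP : pauliWeight P ≤ k) {f : ℕ → M} (hf : f 0 = 1) :
    ∏ l ∈ range k, f (slotIndex P l) = ∏ i ∈ pauliSupport P, f (3 * i + P i) := by
  have h1 : ∀ l, f (slotIndex P l) =
      (((pauliSupport P).sort)[l]?).elim 1 fun i => f (3 * i + P i) := by
    intro l
    change _ = (slot P l).elim 1 _
    rcases h : slot P l with _ | i
    · rw [slotIndex_of_none h, hf]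
      rfl
    · rw [slotIndex_of_some h]
      rfl
  simp only [h1]
  rw [prod_range_getElem? _ _ (by rw [Finset.length_sort]; exact hP), ← Multiset.prod_coe,
    ← Multiset.map_coe, Finset.sort_eq]
  rfl

/-- The slots of a list of Pauli strings. -/
def termSlots {n : ℕ} (terms : List (PauliString n)) (t l : ℕ) : ℕ :=
  (terms[t]?).elim 0 fun P => slotIndex P l

/-- The coefficients of a list of Pauli strings. -/
def termCoef {n : ℕ} (α : PauliString n → ℝ) (terms : List (PauliString n)) (t : ℕ) : ℝ :=
  (terms[t]?).elim 0 α

theorem termSlots_eq {n : ℕ} {terms : List (PauliString n)} {t : ℕ} (ht : t < terms.length) :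
    termSlots terms t = slotIndex terms[t] := by
  funext l
  rw [termSlots, List.getElem?_eq_getElem ht, Option.elim_some]

theorem slotSystem_termSlots {n k : ℕ} {terms : List (PauliString n)} (hnd : terms.Nodup)
    (hw : ∀ P ∈ terms, pauliWeight P ≤ k) :
    SlotSystem (3 * n + 1) k terms.length (termSlots terms) where
  lt t ht l _ := by
    rw [termSlots_eq ht]
    exact slotIndex_lt _ l
  inj t ht l _ l' _ h h0 := by
    rw [termSlots_eq ht] at h h0
    exact slotIndex_inj h h0
  perm t ht s hs τ h := by
    have h1 : ∀ l : Fin k, slotIndex terms[t] (τ l) = slotIndex terms[s] l := fun l => by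
      have := h l
      rwa [termSlots_eq ht, termSlots_eq hs] at this
    exact (hnd.getElem_inj_iff).1 (eq_of_perm_slotIndex (hw _ (List.getElem_mem ht))
      (hw _ (List.getElem_mem hs)) τ h1)

theorem tupleCode_slotIndex {n k X : ℕ} (hX : 0 < X) {P : PauliString n}
    (hP : pauliWeight P ≤ k) : tupleCode X (slotIndex P) k = 1 ↔ P = 0 := by
  rw [tupleCode, prod_slotIndex hP (f := fun j => 1 + j * X) (by simp)]
  constructor
  · intro h
    funext i
    by_contra hi
    have h1 := dvd_prod_of_mem (fun i : Fin n => 1 + (3 * (i : ℕ) + P i) * X)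
      (show i ∈ pauliSupport P by simpa [pauliSupport] using hi)
    rw [h, Nat.dvd_one] at h1
    have h2 : P i ≠ 0 := hi
    rw [← Fin.val_ne_zero_iff] at h2
    have : 0 < (3 * (i : ℕ) + P i) * X := Nat.mul_pos (by omega) hX
    omega
  · rintro rfl
    simp [pauliSupport]

theorem scaledCoef_slotIndex {n k X : ℕ} (hX : 0 < X) {P : PauliString n}
    (hP : pauliWeight P ≤ k) (a : ℝ) :
    scaledCoef X (slotIndex P) k a = if P = 0 then 0 else a / √3 ^ pauliWeight P := by
  have h1 : √3 ^ #{l ∈ range k | slotIndex P l ≠ 0} = √3 ^ pauliWeight P := by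
    rw [← prod_const, prod_filter,
      prod_slotIndex hP (f := fun j => if j ≠ 0 then √3 else 1) (by simp), pauliWeight,
      ← prod_const]
    refine prod_congr rfl fun i hi => if_pos ?_
    have h2 : P i ≠ 0 := by simpa [pauliSupport] using hi
    rw [← Fin.val_ne_zero_iff] at h2
    omega
  rw [scaledCoef, h1]
  exact if_congr (tupleCode_slotIndex hX hP) rfl rfl

/-- The sum over a term list is the sum over all strings. -/
theorem sum_terms {n : ℕ} {terms : List (PauliString n)} (hnd : terms.Nodup)
    {F : PauliString n → ℝ} (hF : ∀ P ∉ terms, F P = 0) :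
    ∑ t ∈ range terms.length, (terms[t]?).elim 0 F = ∑ P, F P := by
  rw [sum_range_getElem? F terms le_rfl, ← List.sum_toFinset F hnd]
  exact sum_subset (subset_univ _) fun P _ hP => hF P (by simpa using hP)

end RealRAM

/-! ## The guarantee of the deterministic phase for a term list -/

namespace RealRAM

open Finset

section Terms

variable {n k : ℕ} {α : PauliString n → ℝ} {terms : List (PauliString n)}

theorem rowGain_terms (hk : 1 ≤ k) (ht : IsTermList k α terms) (row : ℕ → ℝ) :
    rowGain terms.length k (termSlots terms)
      (fun t => scaledCoef ((3 * n + 1) ^ k) (termSlots terms t) k (termCoef α terms t)) row =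
    ∑ P with P ≠ 0, α P / √3 ^ pauliWeight P *
      ∏ i ∈ pauliSupport P, (row (3 * i + P i) / row 0) := by
  have hX : 0 < (3 * n + 1) ^ k := by positivity
  rw [rowGain, sum_filter, ← sum_terms ht.1]
  · refine sum_congr rfl fun t htl => ?_
    have htl : t < terms.length := mem_range.1 htl
    have hw := ht.2.1 _ (List.getElem_mem htl)
    simp only [termSlots_eq htl, termCoef, List.getElem?_eq_getElem htl, Option.elim_some]
    generalize terms[t] = P at hw
    rw [scaledCoef_slotIndex hX hw]
    by_cases hP : P = 0
    · simp [hP]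
    rw [if_neg hP, if_pos hP]
    congr 1
    by_cases h0 : row 0 = 0
    · obtain ⟨i, hi⟩ := Function.ne_iff.1 hP
      rw [prod_eq_zero (mem_range.2 (show 0 < k by omega)) (by rw [h0, div_zero]),
        prod_eq_zero (i := i) (by simpa [pauliSupport] using hi) (by rw [h0, div_zero])]
    · exact prod_slotIndex hw (f := fun j => row j / row 0) (div_self h0)
  · intro P hP
    have : α P = 0 := by
      by_contra h
      exact hP (ht.2.2 P h)
    simp [this]

theorem totalLetterNorm_le_mixedNorm (hk : 1 ≤ k) (ht : IsTermList k α terms) {cd : ℕ → ℕ}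
    (hcd0 : cd 0 = 1)
    (hcd : ∀ Q, ∀ j < 3 * n + 1, cd (j + (3 * n + 1) * Q) = cd Q * (1 + j * (3 * n + 1) ^ k)) :
    √((k - 1).factorial) / √3 ^ k * totalLetterNorm α ≤ mixedNorm (3 * n + 1)
      (fun q => inputTensor ((3 * n + 1) ^ k) terms.length k (termSlots terms)
        (termCoef α terms) (cd q)) ((3 * n + 1) ^ (k - 1)) := by
  have hX : 0 < (3 * n + 1) ^ k := by positivity
  have h3 : (1 : ℝ) ≤ √3 := by
    rw [Real.le_sqrt (by norm_num) (by norm_num)]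
    norm_num
  have key : ∀ (i : Fin n) (c : Fin 4), c ≠ 0 →
      √((k - 1).factorial) / √3 ^ k * letterNorm α i c ≤
        √(∑ R ∈ range ((3 * n + 1) ^ (k - 1)), inputTensor ((3 * n + 1) ^ k) terms.length k
          (termSlots terms) (termCoef α terms)
          (cd ((3 * (i : ℕ) + c) + (3 * n + 1) * R)) ^ 2) := by
    intro i c hc
    refine le_trans ?_ (Real.sqrt_le_sqrt (sum_sq_slice_ge hk
      (slotSystem_termSlots ht.1 ht.2.1) (termCoef α terms) hcd0 hcd
      (c := 3 * (i : ℕ) + c) (by have := i.2; have := c.2; omega)))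
    rw [Real.sqrt_mul (by positivity), letterNorm, div_mul_eq_mul_div, mul_div_assoc]
    refine mul_le_mul_of_nonneg_left ?_ (Real.sqrt_nonneg _)
    rw [div_le_iff₀ (by positivity)]
    have e : √3 ^ k = √((√3 ^ k) ^ 2) := (Real.sqrt_sq (by positivity)).symm
    rw [e, ← Real.sqrt_mul (sum_nonneg fun _ _ => sq_nonneg _)]
    refine Real.sqrt_le_sqrt ?_
    have h4 : ∑ t ∈ range terms.length with ∃ l < k, termSlots terms t l = 3 * (i : ℕ) + c,
        scaledCoef ((3 * n + 1) ^ k) (termSlots terms t) k (termCoef α terms t) ^ 2 =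
        ∑ P with P i = c, (α P / √3 ^ pauliWeight P) ^ 2 := by
      rw [sum_filter, sum_filter, ← sum_terms ht.1]
      · refine sum_congr rfl fun t htl => ?_
        have htl : t < terms.length := mem_range.1 htl
        have hw := ht.2.1 _ (List.getElem_mem htl)
        simp only [termSlots_eq htl, termCoef, List.getElem?_eq_getElem htl, Option.elim_some]
        generalize terms[t] = P at hw
        rw [scaledCoef_slotIndex hX hw]
        refine (if_congr (exists_slotIndex_eq_iff hw i hc) rfl rfl).trans ?_
        by_cases hP : P i = c
        · rw [if_pos hP, if_pos hP, if_neg]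
          rintro rfl
          exact hc hP.symm
        · rw [if_neg hP, if_neg hP]
      · intro P hP
        have : α P = 0 := by
          by_contra h
          exact hP (ht.2.2 P h)
        simp [this]
    rw [h4, sum_mul]
    refine sum_le_sum fun P _ => ?_
    by_cases h0 : α P = 0
    · simp [h0]
    have hw := ht.2.1 P (ht.2.2 P h0)
    rw [div_pow, div_mul_eq_mul_div, le_div_iff₀ (by positivity)]
    gcongr
  rw [totalLetterNorm, mul_sum, mixedNorm]
  simp only [mul_sum]
  rw [sum_sigma']
  refine (sum_le_sum fun x hx => key x.1 x.2 ?_).trans ?_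
  · simpa using hx
  · rw [← sum_image (s := univ.sigma fun _ : Fin n => univ.erase (0 : Fin 4))
      (g := fun x : (_ : Fin n) × Fin 4 => 3 * (x.1 : ℕ) + x.2)
      (f := fun c => √(∑ R ∈ range ((3 * n + 1) ^ (k - 1)), inputTensor ((3 * n + 1) ^ k)
        terms.length k (termSlots terms) (termCoef α terms) (cd (c + (3 * n + 1) * R)) ^ 2))]
    · refine sum_le_sum_of_subset_of_nonneg (fun c hc => ?_) fun _ _ _ => Real.sqrt_nonneg _
      obtain ⟨⟨i, a⟩, -, rfl⟩ := mem_image.1 hc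
      have := i.2
      have := a.2
      exact mem_range.2 (by dsimp only; omega)
    · rintro ⟨i, a⟩ hx ⟨j, b⟩ hy h
      have ha : a ≠ 0 := by simpa using hx
      have hb : b ≠ 0 := by simpa using hy
      rw [← Fin.val_ne_zero_iff] at ha hb
      have h : 3 * (i : ℕ) + a = 3 * (j : ℕ) + b := h
      have := a.2
      have := b.2
      have e1 : i = j := Fin.ext (by omega)
      have e2 : a = b := Fin.ext (by omega)
      rw [e1, e2]

end Terms

theorem optConst_le {k : ℕ} (hk : 1 ≤ k) :
    optConst k * (3 / 2) * ((3 / 2) ^ k * (k : ℝ) ^ k) * 16 ^ (k - 1) ≤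
      9 ^ (k - 1) * (√((k - 1).factorial) / √3 ^ k) := by
  have hk' : (1 : ℝ) ≤ k := by exact_mod_cast hk
  have h3 : (√3 : ℝ) ^ 2 = 3 := Real.sq_sqrt (by norm_num)
  have h2 : (√2 : ℝ) ^ 2 = 2 := Real.sq_sqrt (by norm_num)
  have hp3 : 0 < (√3 : ℝ) := by positivity
  have hp2 : 0 < (√2 : ℝ) := by positivity
  have hfac : √(2 * (k.factorial : ℝ)) = √2 * √k * √((k - 1).factorial) := by
    rw [← Nat.mul_factorial_pred (by omega : k ≠ 0), Nat.cast_mul, Real.sqrt_mul (by norm_num),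
      Real.sqrt_mul (by positivity), mul_assoc]
  have hpow : (k : ℝ) ^ k * √k ≤ (k : ℝ) ^ ((k : ℝ) + 3 / 2 + ((k : ℝ) + 1) / (2 * (k : ℝ))) := by
    rw [← Real.rpow_natCast (k : ℝ) k, Real.sqrt_eq_rpow, ← Real.rpow_add (by linarith)]
    refine Real.rpow_le_rpow_of_exponent_le hk' ?_
    have : 0 ≤ ((k : ℝ) + 1) / (2 * k) := by positivity
    linarith
  have hbase : (8 / 3 * √3) ^ k ≤ (√6 + 2 * √3) ^ k := by
    refine pow_le_pow_left₀ (by positivity) ?_ k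
    have h6 : √6 = √2 * √3 := by
      rw [← Real.sqrt_mul (by norm_num)]
      norm_num
    rw [h6]
    have : 2 / 3 ≤ √2 := Real.le_sqrt_of_sq_le (by norm_num)
    nlinarith
  have hs2 : √2 ≤ 3 / 2 := by
    rw [Real.sqrt_le_left (by norm_num)]
    norm_num
  set F := √((k - 1).factorial : ℝ)
  have hF : 0 ≤ F := Real.sqrt_nonneg _
  set W := (k : ℝ) ^ k
  have hW : 0 < W := by positivity
  have hq : 0 < √(k : ℝ) := by positivity
  have h1 : optConst k ≤ √2 * F / (2 * W * (8 / 3 * √3) ^ k) := by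
    rw [optConst, hfac]
    calc √2 * √k * F / (2 * (k : ℝ) ^ ((k : ℝ) + 3 / 2 + ((k : ℝ) + 1) / (2 * (k : ℝ))) *
          (√6 + 2 * √3) ^ k) ≤ √2 * √k * F / (2 * (W * √k) * (8 / 3 * √3) ^ k) := by gcongr
      _ = _ := by field_simp
  have e16 : (16 : ℝ) ^ (k - 1) * 16 = 16 ^ k := by rw [← pow_succ, Nat.sub_add_cancel hk]
  have e9 : (9 : ℝ) ^ (k - 1) * 9 = 9 ^ k := by rw [← pow_succ, Nat.sub_add_cancel hk]
  have e3 : (8 / 3 * √3) ^ k * (9 ^ k * √3 ^ k) = (3 / 2) ^ k * 16 ^ k * 3 ^ k := by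
    rw [← mul_pow, ← mul_pow, ← mul_pow, ← mul_pow]
    congr 1
    linear_combination 24 * h3
  set a := (16 : ℝ) ^ (k - 1)
  set b := (9 : ℝ) ^ (k - 1)
  set c := (3 / 2 : ℝ) ^ k
  set B := (8 / 3 * √3) ^ k
  have hB : 0 < B := by positivity
  have hs : (3 : ℝ) ^ k = √3 ^ k * √3 ^ k := by rw [← mul_pow, ← sq, h3]
  rw [hs, ← e16, ← e9] at e3
  set s := √3 ^ k
  have hs0 : 0 < s := by positivity
  have e4 : B * (9 * b) = 16 * c * a * s := by
    refine mul_right_cancel₀ hs0.ne' ?_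
    linear_combination e3
  have ha : 0 < a := by positivity
  have hb : 0 < b := by positivity
  have hc : 0 < c := by positivity
  clear_value a b c B s F W
  calc optConst k * (3 / 2) * (c * W) * a
      ≤ √2 * F / (2 * W * B) * (3 / 2) * (c * W) * a := by gcongr
    _ = √2 * (27 / 64) * (b * (F / s)) := by
        field_simp
        linear_combination (-12 * F) * e4
    _ ≤ 1 * (b * (F / s)) := by
        gcongr
        linarith
    _ = _ := one_mul _

/-- A factor `A` with `phaseCost k (3 n + 1) T + 707 n + 5 ≤ A * n ^ k`. -/
def costFactor (k : ℕ) : ℕ :=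
  4 ^ k * (2000 + 30 * k + (k * 307 + 600) + k * (2000 + 100 * 2 ^ k + 7) + 100 * 2 ^ k +
    2 ^ k * (k * 67 + 500))

theorem phaseCost_le {n k T : ℕ} (hn : 1 ≤ n) (hk : 1 ≤ k) (hT : T ≤ (3 * n + 1) ^ k) :
    phaseCost k (3 * n + 1) T + (n * 707 + 5) ≤ costFactor k * n ^ k := by
  have hD : 3 * n + 1 ≤ (3 * n + 1) ^ k := Nat.le_self_pow (by omega) _
  have hny : n ≤ (3 * n + 1) ^ k := by omega
  have h4 : (3 * n + 1) ^ k ≤ 4 ^ k * n ^ k := by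
    rw [← mul_pow]
    exact Nat.pow_le_pow_left (by omega) k
  unfold phaseCost costFactor
  refine le_trans ?_ (le_of_le_of_eq (Nat.mul_le_mul_right (2000 + 30 * k + (k * 307 + 600) +
    k * (2000 + 100 * 2 ^ k + 7) + 100 * 2 ^ k + 2 ^ k * (k * 67 + 500)) h4) (by ring))
  generalize (3 * n + 1) ^ k = y at *
  generalize 3 * n + 1 = D at *
  generalize 2 ^ k = E
  have hy : 1 ≤ y := by omega
  have a1 : k ≤ k * y := Nat.le_mul_of_pos_right k hy
  have a2 : E ≤ E * y := Nat.le_mul_of_pos_right E hy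
  have a3 : T * k ≤ y * k := Nat.mul_le_mul_right k hT
  have a4 : E * T ≤ E * y := Nat.mul_le_mul_left E hT
  have a5 : E * T * k ≤ E * y * k := Nat.mul_le_mul_right k a4
  have a6 : E * D ≤ E * y := Nat.mul_le_mul_left E hD
  have a7 : E * D * k ≤ E * y * k := Nat.mul_le_mul_right k a6
  nlinarith

end RealRAM

/-! ## The main theorem -/

namespace RealRAM

open Finset

theorem input_slots {n k : ℕ} (hk : 1 ≤ k) (α : PauliString n → ℝ) (terms : List (PauliString n))
    (t : ℕ) {l : ℕ} (hl : l < k) :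
    3 * (input k α terms).narr 0 (t * k + l) + (input k α terms).narr 1 (t * k + l) =
      termSlots terms t l := by
  have h1 : (t * k + l) / k = t := by
    rw [mul_comm, Nat.mul_add_div (by omega), Nat.div_eq_of_lt hl, add_zero]
  have h2 : (t * k + l) % k = l := by
    rw [mul_comm, Nat.mul_add_mod, Nat.mod_eq_of_lt hl]
  simp only [input, h1, h2, termSlots]
  rcases terms[t]? with _ | P
  · rfl
  · simp only [Option.elim_some]
    rcases h : slot P l with _ | i
    · simp [slotIndex_of_none h]
    · rw [slotIndex_of_some h]
      simp

theorem input_coef {n k : ℕ} (α : PauliString n → ℝ) (terms : List (PauliString n)) (t : ℕ) :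
    (input k α terms).rarr 0 t = termCoef α terms t := by
  simp only [input, termCoef]
  rcases terms[t]? with _ | P <;> rfl

theorem output_eq_cornerState {n : ℕ} {s : State} {e : Fin n → ℕ → ℝ}
    (h : ∀ i : Fin n, QubitCells (s.rarr 1) i (e i)) :
    output n s = fun i => cornerState (e i) := by
  funext i b
  obtain ⟨h0, h1, h2, h3⟩ := h i
  rcases Fin.exists_fin_two.1 ⟨b, rfl⟩ with rfl | rfl
  · apply Complex.ext
    · simpa [output, cornerState] using h0
    · simpa [output, cornerState] using h1
  · apply Complex.ext
    · simpa [output, cornerState] using h2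
    · simpa [output, cornerState] using h3

/-- The result of the deterministic phase: a table row whose gain is large. -/
theorem exists_searchPhase_row {n k : ℕ} (hn : 1 ≤ n) (hk : 1 ≤ k) {α : PauliString n → ℝ}
    (hα : IsKLocal k α) {terms : List (PauliString n)} (ht : IsTermList k α terms) :
    ∃ (s : State) (t : ℕ), (∀ ω, Exec ω searchPhase (input k α terms) s t) ∧
      t ≤ phaseCost k (3 * n + 1) terms.length ∧
      s.nreg 0 = n ∧ s.nreg 3 = 3 * n + 1 ∧ s.drawn = 0 ∧
      (∀ j < 3 * n + 1, |tableRow (3 * n + 1) s (s.nreg 17) j /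
        tableRow (3 * n + 1) s (s.nreg 17) 0| ≤ 1) ∧
      optConst k * (∑ P with P ≠ 0,
        |α P| ^ (2 * (k : ℝ) / ((k : ℝ) + 1))) ^ (((k : ℝ) + 1) / (2 * (k : ℝ))) ≤
      |∑ P with P ≠ 0, α P / √3 ^ pauliWeight P * ∏ i ∈ pauliSupport P,
        (tableRow (3 * n + 1) s (s.nreg 17) (3 * i + P i) /
          tableRow (3 * n + 1) s (s.nreg 17) 0)| := by
  obtain ⟨cd, hcd0, hcd⟩ : ∃ cd : ℕ → ℕ, cd 0 = 1 ∧ ∀ Q, ∀ j < 3 * n + 1,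
      cd (j + (3 * n + 1) * Q) = cd Q * (1 + j * (3 * n + 1) ^ k) := by
    refine ⟨fun q => (((Nat.digits (3 * n + 1) q).map fun j => 1 + j * (3 * n + 1) ^ k)).prod,
      by simp, fun Q j hj => ?_⟩
    dsimp only
    by_cases h : j = 0 ∧ Q = 0
    · simp [h.1, h.2]
    · rw [Nat.digits_add _ (by omega) j Q hj (by tauto), List.map_cons, List.prod_cons, mul_comm]
  have hS := slotSystem_termSlots ht.1 ht.2.1
  obtain ⟨s, t, he, htc, h0, h3, hd, x, hx, hrow, hbest, hform⟩ :=
    searchPhase_spec (ω := fun _ => 0) hn hk (s := input k α terms) (T := terms.length)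
      (J := termSlots terms) (a := termCoef α terms) rfl rfl rfl rfl
      (fun t _ l hl => input_slots hk α terms t hl) hS.lt (fun t _ => input_coef α terms t)
      (fun b hb c => if_neg hb) cd hcd0 hcd
  refine ⟨s, t, he.change_tape rfl, htc, h0, h3, hd, fun j hj => ?_, ?_⟩
  · rw [abs_div]
    exact div_le_one_of_le₀ ((hrow j hj).trans (le_abs_self _)) (abs_nonneg _)
  rw [← rowGain_terms hk ht]
  set G := |rowGain terms.length k (termSlots terms)
    (fun t => scaledCoef ((3 * n + 1) ^ k) (termSlots terms t) k (termCoef α terms t))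
    (tableRow (3 * n + 1) s (s.nreg 17))|
  rw [formValue_inputTensor (by omega) hS (termCoef α terms) hcd0 hcd x] at hform
  have h1 := abs_polarized_le hk hx hbest
  have h2 := totalLetterNorm_le_mixedNorm hk ht hcd0 hcd
  have h4 := rpow_sum_le_totalLetterNorm hk hα
  have h5 := optConst_le hk
  set K := (3 / 2 : ℝ) ^ k * (k : ℝ) ^ k
  have hk' : (1 : ℝ) ≤ k := by exact_mod_cast hk
  have hK : 0 < K := by positivity
  have hN : 0 ≤ totalLetterNorm α :=
    sum_nonneg fun i _ => sum_nonneg fun c _ => letterNorm_nonneg α i c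
  have hC : 0 ≤ optConst k := by
    unfold optConst
    positivity
  refine le_of_mul_le_mul_left ?_ (show (0 : ℝ) < 16 ^ (k - 1) * K by positivity)
  refine le_trans ?_ (le_of_le_of_eq (hform.trans
    (mul_le_mul_of_nonneg_left h1 (by positivity))) (by ring))
  refine le_trans ?_ (mul_le_mul_of_nonneg_left h2 (by positivity))
  refine le_trans ?_ (le_of_le_of_eq (mul_le_mul_of_nonneg_right h5 hN) (mul_assoc _ _ _))
  refine le_of_le_of_eq (mul_le_mul_of_nonneg_left (mul_le_mul_of_nonneg_left h4 hC)
    (by positivity)) ?_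
  ring

end RealRAM

theorem mainTheorem9 :
    ∃ prog : RealRAM.Prog, ∀ k : ℕ, 1 ≤ k → ∃ A : ℕ, ∀ n : ℕ, 1 ≤ n →
      ∀ α : PauliString n → ℝ, IsKLocal k α →
      ∀ terms : List (PauliString n), RealRAM.IsTermList k α terms →
      ∃ φ : RealRAM.Tape → Fin n → Fin 2 → ℂ,
        (∀ ω, ∃ (s : RealRAM.State) (t : ℕ),
          RealRAM.Exec ω prog (RealRAM.input k α terms) s t ∧
          t ≤ A * n ^ k ∧ RealRAM.output n s = φ ω) ∧
        (∀ ω i, ∑ b, ‖φ ω i b‖ ^ 2 = 1) ∧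
        MeasureTheory.Integrable (fun ω => energy (hamiltonian α) (productState (φ ω)))
          RealRAM.tapeLaw ∧
        optConst k *
            (∑ P ∈ Finset.univ.filter (fun P : PauliString n => P ≠ 0),
              |α P| ^ (2 * (k : ℝ) / ((k : ℝ) + 1))) ^ (((k : ℝ) + 1) / (2 * (k : ℝ))) ≤
          |(∫ ω, energy (hamiltonian α) (productState (φ ω)) ∂(RealRAM.tapeLaw)) -
            haarEnergy (hamiltonian α)| := by
  refine ⟨RealRAM.optimizer, fun k hk => ⟨RealRAM.costFactor k, fun n hn α hα terms ht => ?_⟩⟩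
  obtain ⟨s, t, he, htc, h0, h3, hd, hrow, hgain⟩ := RealRAM.exists_searchPhase_row hn hk hα ht
  set m : ℕ → ℝ := fun j => RealRAM.tableRow (3 * n + 1) s (s.nreg 17) j /
    RealRAM.tableRow (3 * n + 1) s (s.nreg 17) 0 with hm
  refine ⟨fun ω i => RealRAM.cornerState (RealRAM.tapeSigns m ω i), fun ω => ?_, fun ω i => ?_,
    RealRAM.integrable_energy_cornerState α m, ?_⟩
  · obtain ⟨s', t', he', htc', hq⟩ := RealRAM.roundProg_spec (ω := ω) h0 h3 rfl hd
    refine ⟨s', t + t', (he ω).seq he', ?_, RealRAM.output_eq_cornerState fun i => hq i i.2⟩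
    have := RealRAM.phaseCost_le hn hk (RealRAM.slotSystem_termSlots ht.1 ht.2.1).card_le
    omega
  · exact RealRAM.cornerState_norm fun _ => RealRAM.roundSign_eq _ _
  · rw [haarEnergy_hamiltonian, RealRAM.integral_energy_cornerState α hrow]
    exact hgain
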